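/- Throughout, graphs are undirected and simple; for a graph $G$ on the vertex set $\{1,\dots,n\}$ let $m$ be its number of edges and $T$ its number of triangles. A BIS (bipartite independent set) query takes two disjoint vertex sets $A,B$ and answers whether $G$ has an edge with one endpoint in $A$ and the other in $B$. An algorithm with BIS query access knows $n$, may toss coins, adaptively makes BIS queries to the otherwise unknown graph $G$, and finally outputs a real number. A number $a$ is a $(1\pm\epsilon)$-approximation of $b$ if $(1-\epsilon)b\le a\le(1+\epsilon)b$. **Theorem.** There is a randomized algorithm $\textsc{Triangle-Est}(G,\epsilon)$ that has BIS query access to a graph $G$ on $n$ vertices, takes a parameter $\epsilon\in(0,1)$ as input, and outputs a $(1\pm\epsilon)$-approximation of $T$ with probability at least $1-o(1)$, where the $o(1)$ term depends only on $n$ and tends to $0$ as $n\to\infty$. Moreover, whenever $T\ge 1$, the expected number of BIS queries that it makes is $$\widetilde O\!\left(\min\left\{\frac{m}{\sqrt T},\ \frac{m^{3/2}}{T}\right\}\right),$$ where $\widetilde O(\cdot)$ hides a multiplicative factor $\mathrm{poly}(\log n,1/\epsilon)$; that is, there are absolute constants $C$ and $k$ such that this expectation is at most $C\,\bigl(\tfrac{\log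 n}{\epsilon}\bigr)^{k}\min\{m/\sqrt T,\ m^{3/2}/T\}$ for all $n$, all $\epsilon\in(0,1)$ and all such $G$. -/

import Mathlib

/-- A randomized adaptive algorithm with BIS query access to an unknown graph on the vertex set
`Fin n`. At each step it stops with a real output, makes a random choice from a finite
distribution, or issues a BIS query on two disjoint vertex sets and proceeds according to the
answer. The next step depends only on the random choices and on the answers received so far. -/
inductive BISAlgorithm (n : ℕ) : Type
  | output (x : ℝ) : BISAlgorithm n
  | sample (k : ℕ) (μ : PMF (Fin k)) (next : Fin k → BISAlgorithm n) : BISAlgorithm n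
  | query (A B : Finset (Fin n)) (hAB : Disjoint A B) (next : Bool → BISAlgorithm n) :
      BISAlgorithm n

/-- The answer to the BIS query `(A, B)`: is there an edge of `G` between `A` and `B`? -/
def bisAnswer {n : ℕ} (G : SimpleGraph (Fin n)) [DecidableRel G.Adj]
    (A B : Finset (Fin n)) : Bool :=
  decide (∃ a ∈ A, ∃ b ∈ B, G.Adj a b)

namespace BISAlgorithm

/-- The joint distribution of the output and of the number of BIS queries made on the graph `G`. -/
noncomputable def run {n : ℕ} (G : SimpleGraph (Fin n)) [DecidableRel G.Adj] :
    BISAlgorithm n → PMF (ℝ × ℕ)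
  | output x => PMF.pure (x, 0)
  | sample _ μ next => μ.bind fun i => run G (next i)
  | query A B _ next => (run G (next (bisAnswer G A B))).map fun r => (r.1, r.2 + 1)

/-- The probability that the output of the algorithm on `G` satisfies `P`. -/
noncomputable def outputProb {n : ℕ} (alg : BISAlgorithm n) (G : SimpleGraph (Fin n))
    [DecidableRel G.Adj] (P : ℝ → Prop) : ℝ :=
  ((alg.run G).toOuterMeasure {r | P r.1}).toReal

/-- The expected number of BIS queries the algorithm makes on `G`. -/
noncomputable def expectedQueries {n : ℕ} (alg : BISAlgorithm n) (G : SimpleGraph (Fin n))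
    [DecidableRel G.Adj] : ENNReal :=
  ∑' r : ℝ × ℕ, alg.run G r * (r.2 : ENNReal)

end BISAlgorithm

/-- `a` is a `(1 ± ε)`-approximation of `b`. -/
def IsApproximation (ε a b : ℝ) : Prop :=
  (1 - ε) * b ≤ a ∧ a ≤ (1 + ε) * b

/-- The number `m` of edges of `G`. -/
def edgeCount {n : ℕ} (G : SimpleGraph (Fin n)) [DecidableRel G.Adj] : ℕ :=
  G.edgeFinset.card

/-- The number `T` of triangles of `G`. -/
def triangleCount {n : ℕ} (G : SimpleGraph (Fin n)) [DecidableRel G.Adj] : ℕ :=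
  (G.cliqueFinset 3).card

/-! Write `L` for `logSize n`. Two unbiased estimators of `T` are combined: one that is cheap when
`T ≤ m`, where `m/√T` is the smaller entry of the minimum, and one that is cheap when `T > m`, where
`m^{3/2}/T` is.

Primitives. Bisection lists all edges between two sets at polylogarithmic cost per edge
(`cost_listEdges`). Random test sets at rates `2^{-j}` give each vertex a level whose power of two
approximates its degree. Sampling a vertex of level `i` at rate `p / max(2^{-i}, p)`, and then its
neighbours at rate `max(2^{-i}, p)`, selects every directed edge with probability `p` at a cost of
about `m p`. Edges at the same vertex are correlated, but the second moment of a sampled sum loses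
only a factor of order `L` (`exp_sampleEdges_sq`, `cost_sampleEdges_le`).

Many triangles. Orienting edges by level gives every vertex expected out-degree `O(L √m)`
(`expect_outDeg_le`). Edges are sampled at rate `p = √m/T`, apexes at rate `q = 1/√m`, and a
triangle counts only at its lowest vertex. The variance is then `O(L² T²)` and the cost is about
`m^{3/2}/T`.

Few triangles. With `p = 1/√T`, a vertex sample marks the pairs having a common neighbour in it.
Edges in many triangles tend to be marked, yet few edges are marked in expectation. Triangles with a
marked edge are split among vertices opposite to marked edges; every vertex load is at most the
number of marked ordered edges, so sampling vertices estimates the total well. For triangles without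
marked edges, the sum of squared triangle counts per edge has expectation `O(T/p)`
(`expect_lightSq_le`), so they can be counted among three random vertex sets, averaged over about
`1/p` repetitions. The variance is `O(T²)` and the cost about `m/√T`.

Unknown `m` and `T`. A descending search yields `2^i` close enough to `m`: a severe underestimate is
unlikely, and the second moments of `2^i/m` and `m/2^i` are polylogarithmic, which is what an
expected cost bound needs. For `T`, guesses `s` are halved until an average of estimates reaches
`2s`. A trial has error at most `(ε/2) max(T, s)` with probability `1 - O(1/L²)`, so a union bound
over `O(L)` guesses gives correctness. A guess far below `T` inflates the cost by `(T/s)²`, but is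
reached only after trials that each fail with probability at most `1/16`, so the expected costs
still sum (`cost_guessSearch_le`).

All probability is done with finite weighted sums on randomized decision trees, seen as positive
linear functionals; `outputProb_toAlgorithm` and `expectedQueries_toAlgorithm` translate the results
to `PMF`s. -/

/-! ### Expectation functionals -/

/-- A normalized positive linear functional on the real functions on `Ω`. -/
structure Expectation (Ω : Type*) where
  toFun : (Ω → ℝ) → ℝ
  map_add' : ∀ f g, toFun (fun x => f x + g x) = toFun f + toFun g
  map_mul' : ∀ (c : ℝ) f, toFun (fun x => c * f x) = c * toFun f
  mono' : ∀ f g, (∀ x, f x ≤ g x) → toFun f ≤ toFun g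
  one' : toFun (fun _ => 1) = 1

namespace Expectation

variable {Ω : Type*}

instance : CoeFun (Expectation Ω) (fun _ => (Ω → ℝ) → ℝ) := ⟨toFun⟩

variable (E : Expectation Ω)

theorem add (f g : Ω → ℝ) : E (fun x => f x + g x) = E f + E g := E.map_add' f g

theorem const_mul (c : ℝ) (f : Ω → ℝ) : E (fun x => c * f x) = c * E f := E.map_mul' c f

theorem mul_const (f : Ω → ℝ) (c : ℝ) : E (fun x => f x * c) = E f * c := by
  rw [mul_comm, ← E.const_mul]; simp only [mul_comm]

theorem mono {f g : Ω → ℝ} (h : ∀ x, f x ≤ g x) : E f ≤ E g := E.mono' f g h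

theorem const (c : ℝ) : E (fun _ => c) = c := by
  have := E.const_mul c (fun _ => 1)
  rw [E.one', mul_one] at this
  simpa using this

theorem sub (f g : Ω → ℝ) : E (fun x => f x - g x) = E f - E g := by
  have h := E.add (fun x => f x - g x) g
  simp only [sub_add_cancel] at h
  linarith

theorem sum {ι : Type*} (s : Finset ι) (f : ι → Ω → ℝ) :
    E (fun x => ∑ i ∈ s, f i x) = ∑ i ∈ s, E (f i) := by
  classical
  induction s using Finset.induction_on with
  | empty => simpa using E.const 0
  | insert a s ha ih => simp only [Finset.sum_insert ha, E.add, ih]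

theorem nonneg {f : Ω → ℝ} (h : ∀ x, 0 ≤ f x) : 0 ≤ E f := by
  simpa only [E.const] using E.mono h

theorem le_const {f : Ω → ℝ} {c : ℝ} (h : ∀ x, f x ≤ c) : E f ≤ c := by
  simpa only [E.const] using E.mono h

/-- The probability of an event. -/
noncomputable def prob (P : Ω → Prop) : ℝ :=
  E (fun x => by classical exact if P x then 1 else 0)

theorem prob_le_one (P : Ω → Prop) : E.prob P ≤ 1 :=
  E.le_const fun x => by split_ifs <;> norm_num

theorem prob_mono {P Q : Ω → Prop} (h : ∀ x, P x → Q x) : E.prob P ≤ E.prob Q :=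
  E.mono fun x => by
    by_cases hp : P x
    · simp [hp, h x hp]
    · simp only [hp, if_false]; split_ifs <;> norm_num

theorem prob_not (P : Ω → Prop) : E.prob (fun x => ¬ P x) = 1 - E.prob P := by
  unfold prob
  rw [← E.const 1, ← E.sub, E.const 1]
  congr 1; funext x
  by_cases hp : P x <;> simp [hp]

/-- Markov's inequality. -/
theorem prob_le_div {f : Ω → ℝ} (hf : ∀ x, 0 ≤ f x) {c : ℝ} (hc : 0 < c) :
    E.prob (fun x => c ≤ f x) ≤ E f / c := by
  rw [le_div_iff₀ hc, prob, ← E.mul_const]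
  refine E.mono fun x => ?_
  split_ifs with h
  · simpa using h
  · simpa using hf x

/-- Chebyshev's inequality. -/
theorem prob_abs_le {f : Ω → ℝ} {a c : ℝ} (hc : 0 < c) :
    E.prob (fun x => c < |f x - a|) ≤ E (fun x => (f x - a) ^ 2) / c ^ 2 := by
  refine le_trans (E.prob_mono fun x hx => ?_)
    (E.prob_le_div (f := fun x => (f x - a) ^ 2) (fun x => sq_nonneg _) (by positivity))
  rw [← sq_abs (f x - a)]
  exact pow_le_pow_left₀ hc.le (le_of_lt hx) 2

end Expectation

/-! ### Deterministic query trees -/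

/-- A deterministic adaptive procedure that makes BIS queries and returns an element of `α`. -/
inductive QueryTree (n : ℕ) (α : Type) : Type
  | ret (a : α) : QueryTree n α
  | query (A B : Finset (Fin n)) (hAB : Disjoint A B) (next : Bool → QueryTree n α) :
      QueryTree n α

namespace QueryTree

variable {n : ℕ} {α β γ : Type}

/-- The value returned on the graph `G`. -/
def eval (G : SimpleGraph (Fin n)) [DecidableRel G.Adj] : QueryTree n α → α
  | ret a => a
  | query A B _ next => eval G (next (bisAnswer G A B))

/-- The number of queries made on the graph `G`. -/
def cost (G : SimpleGraph (Fin n)) [DecidableRel G.Adj] : QueryTree n α → ℝ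
  | ret _ => 0
  | query A B _ next => cost G (next (bisAnswer G A B)) + 1

/-- Sequential composition. -/
def bind : QueryTree n α → (α → QueryTree n β) → QueryTree n β
  | ret a, k => k a
  | query A B h next, k => query A B h fun b => bind (next b) k

/-- Postprocessing of the returned value. -/
def map (f : α → β) (t : QueryTree n α) : QueryTree n β := t.bind fun a => ret (f a)

variable (G : SimpleGraph (Fin n)) [DecidableRel G.Adj]

@[simp] theorem eval_ret (a : α) : eval G (ret a : QueryTree n α) = a := rfl

@[simp] theorem cost_ret (a : α) : cost G (ret a : QueryTree n α) = 0 := rfl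

@[simp] theorem eval_bind (t : QueryTree n α) (k : α → QueryTree n β) :
    eval G (t.bind k) = eval G (k (eval G t)) := by
  induction t with
  | ret a => rfl
  | query A B h next ih => simp only [bind, eval, ih]

@[simp] theorem cost_bind (t : QueryTree n α) (k : α → QueryTree n β) :
    cost G (t.bind k) = cost G t + cost G (k (eval G t)) := by
  induction t with
  | ret a => simp [bind]
  | query A B h next ih => simp only [bind, eval, cost, ih]; ring

@[simp] theorem eval_map (f : α → β) (t : QueryTree n α) :
    eval G (t.map f) = f (eval G t) := by simp [map]

@[simp] theorem cost_map (f : α → β) (t : QueryTree n α) : cost G (t.map f) = cost G t := by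
  simp [map]

/-- Runs a procedure for every element of a list. -/
def traverse : List β → (β → QueryTree n γ) → QueryTree n (List γ)
  | [], _ => ret []
  | b :: l, f => (f b).bind fun c => (traverse l f).map (c :: ·)

@[simp] theorem eval_traverse (l : List β) (f : β → QueryTree n γ) :
    eval G (traverse l f) = l.map fun b => eval G (f b) := by
  induction l with
  | nil => rfl
  | cons b l ih => simp [traverse, ih]

@[simp] theorem cost_traverse (l : List β) (f : β → QueryTree n γ) :
    cost G (traverse l f) = (l.map fun b => cost G (f b)).sum := by
  induction l with
  | nil => rfl
  | cons b l ih => simp [traverse, ih]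

/-- The sum of the values of procedures indexed by a finite set. -/
noncomputable def sumOver (s : Finset β) (f : β → QueryTree n ℝ) : QueryTree n ℝ :=
  (traverse s.toList f).map List.sum

@[simp] theorem eval_sumOver (s : Finset β) (f : β → QueryTree n ℝ) :
    eval G (sumOver s f) = ∑ b ∈ s, eval G (f b) := by
  simp [sumOver]

@[simp] theorem cost_sumOver (s : Finset β) (f : β → QueryTree n ℝ) :
    cost G (sumOver s f) = ∑ b ∈ s, cost G (f b) := by
  simp [sumOver]

/-- The supremum of the values of procedures indexed by a finite set. -/
noncomputable def supOver [SemilatticeSup γ] [OrderBot γ] (s : Finset β)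
    (f : β → QueryTree n γ) : QueryTree n γ :=
  (traverse s.toList f).map fun l => l.foldr (· ⊔ ·) ⊥

@[simp] theorem eval_supOver [SemilatticeSup γ] [OrderBot γ] (s : Finset β)
    (f : β → QueryTree n γ) : eval G (supOver s f) = s.sup fun b => eval G (f b) := by
  classical
  simp only [supOver, eval_map, eval_traverse]
  conv_rhs => rw [← Finset.toList_toFinset s]
  induction s.toList with
  | nil => simp
  | cons b l ih => simp [ih]

@[simp] theorem cost_supOver [SemilatticeSup γ] [OrderBot γ] (s : Finset β)
    (f : β → QueryTree n γ) : cost G (supOver s f) = ∑ b ∈ s, cost G (f b) := by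
  simp [supOver]

end QueryTree

/-! ### Randomized query trees -/

/-- A randomized adaptive procedure that makes BIS queries and returns an element of `α`. -/
inductive RandTree (n : ℕ) (α : Type) : Type
  | ret (a : α) : RandTree n α
  | sample (k : ℕ) (μ : PMF (Fin k)) (next : Fin k → RandTree n α) : RandTree n α
  | query (A B : Finset (Fin n)) (hAB : Disjoint A B) (next : Bool → RandTree n α) :
      RandTree n α

theorem PMF.sum_toReal_eq_one {k : ℕ} (μ : PMF (Fin k)) : ∑ i, (μ i).toReal = 1 := by
  rw [← ENNReal.toReal_sum fun i _ => μ.apply_ne_top i, ← tsum_fintype (L := .unconditional _),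
    μ.tsum_coe]
  rfl

namespace RandTree

variable {n : ℕ} {α β γ : Type}

/-- The expected value of a function of the result. -/
noncomputable def ev (G : SimpleGraph (Fin n)) [DecidableRel G.Adj] :
    RandTree n α → (α → ℝ) → ℝ
  | ret a, f => f a
  | sample _ μ next, f => ∑ i, (μ i).toReal * ev G (next i) f
  | query A B _ next, f => ev G (next (bisAnswer G A B)) f

/-- The expected number of queries. -/
noncomputable def cost (G : SimpleGraph (Fin n)) [DecidableRel G.Adj] : RandTree n α → ℝ
  | ret _ => 0
  | sample _ μ next => ∑ i, (μ i).toReal * cost G (next i)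
  | query A B _ next => cost G (next (bisAnswer G A B)) + 1

/-- Sequential composition. -/
def bind : RandTree n α → (α → RandTree n β) → RandTree n β
  | ret a, k => k a
  | sample j μ next, k => sample j μ fun i => bind (next i) k
  | query A B h next, k => query A B h fun b => bind (next b) k

/-- Postprocessing of the returned value. -/
def map (f : α → β) (t : RandTree n α) : RandTree n β := t.bind fun a => ret (f a)

/-- A deterministic procedure as a randomized one. -/
def ofQueryTree : QueryTree n α → RandTree n α
  | .ret a => ret a
  | .query A B h next => query A B h fun b => ofQueryTree (next b)

/-- A procedure that returns a real number as an algorithm. -/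
def toAlgorithm : RandTree n ℝ → BISAlgorithm n
  | ret a => .output a
  | sample k μ next => .sample k μ fun i => toAlgorithm (next i)
  | query A B h next => .query A B h fun b => toAlgorithm (next b)

variable (G : SimpleGraph (Fin n)) [DecidableRel G.Adj]

/-- The distribution of the result on `G`, as an expectation functional. -/
noncomputable def exp (t : RandTree n α) : Expectation α where
  toFun := ev G t
  map_add' f g := by
    induction t with
    | ret a => rfl
    | sample k μ next ih => simp only [ev, ih, mul_add, Finset.sum_add_distrib]
    | query A B h next ih => exact ih _
  map_mul' c f := by
    induction t with
    | ret a => rfl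
    | sample k μ next ih =>
      simp only [ev, ih, Finset.mul_sum]
      exact Finset.sum_congr rfl fun i _ => by ring
    | query A B h next ih => exact ih _
  mono' f g h := by
    induction t with
    | ret a => exact h a
    | sample k μ next ih =>
      exact Finset.sum_le_sum fun i _ => mul_le_mul_of_nonneg_left (ih i) ENNReal.toReal_nonneg
    | query A B h next ih => exact ih _
  one' := by
    induction t with
    | ret a => rfl
    | sample k μ next ih => simp only [ev, ih, mul_one, PMF.sum_toReal_eq_one]
    | query A B h next ih => exact ih _

@[simp] theorem exp_ret (a : α) (f : α → ℝ) : (ret a : RandTree n α).exp G f = f a := rfl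

@[simp] theorem cost_ret (a : α) : cost G (ret a : RandTree n α) = 0 := rfl

theorem cost_nonneg (t : RandTree n α) : 0 ≤ cost G t := by
  induction t with
  | ret a => simp
  | sample k μ next ih =>
    exact Finset.sum_nonneg fun i _ => mul_nonneg ENNReal.toReal_nonneg (ih i)
  | query A B h next ih => simp only [cost]; linarith [ih (bisAnswer G A B)]

@[simp] theorem exp_bind (t : RandTree n α) (k : α → RandTree n β) (f : β → ℝ) :
    (t.bind k).exp G f = t.exp G fun a => (k a).exp G f := by
  change ev G (t.bind k) f = ev G t fun a => ev G (k a) f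
  induction t with
  | ret a => rfl
  | sample j μ next ih => simp only [bind, ev, ih]
  | query A B h next ih => simp only [bind, ev, ih]

@[simp] theorem cost_bind (t : RandTree n α) (k : α → RandTree n β) :
    cost G (t.bind k) = cost G t + t.exp G fun a => cost G (k a) := by
  change _ = _ + ev G t fun a => cost G (k a)
  induction t with
  | ret a => simp [bind, ev]
  | sample j μ next ih => simp only [bind, cost, ev, ih, mul_add, Finset.sum_add_distrib]
  | query A B h next ih => simp only [bind, cost, ev, ih]; ring

@[simp] theorem exp_map (t : RandTree n α) (h : α → β) (f : β → ℝ) :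
    (t.map h).exp G f = t.exp G fun a => f (h a) := by simp [map]

@[simp] theorem cost_map (t : RandTree n α) (h : α → β) : cost G (t.map h) = cost G t := by
  simp [map, Expectation.const]

@[simp] theorem exp_ofQueryTree (t : QueryTree n α) (f : α → ℝ) :
    (ofQueryTree t).exp G f = f (t.eval G) := by
  change ev G (ofQueryTree t) f = _
  induction t with
  | ret a => rfl
  | query A B h next ih => simp only [ofQueryTree, ev, QueryTree.eval, ih]

@[simp] theorem cost_ofQueryTree (t : QueryTree n α) :
    cost G (ofQueryTree t) = t.cost G := by
  induction t with
  | ret a => rfl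
  | query A B h next ih => simp only [ofQueryTree, cost, QueryTree.cost, ih]

/-- This and `expectedQueries_toAlgorithm` are the only links between the finite real sums used in
the analysis and the measure-theoretic quantities of the statement. -/
theorem outputProb_toAlgorithm (t : RandTree n ℝ) (P : ℝ → Prop) :
    t.toAlgorithm.outputProb G P = (t.exp G).prob P := by
  classical
  change _ = ev G t _
  unfold BISAlgorithm.outputProb
  induction t with
  | ret a =>
    simp only [toAlgorithm, BISAlgorithm.run, PMF.toOuterMeasure_pure_apply, ev, Set.mem_ofPred_eq]
    by_cases h : P a <;> simp [h]
  | sample k μ next ih =>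
    simp only [toAlgorithm, BISAlgorithm.run, PMF.toOuterMeasure_bind_apply, ev, ← ih]
    rw [tsum_fintype, ENNReal.toReal_sum]
    · simp only [ENNReal.toReal_mul]
    · intro i _
      refine ENNReal.mul_ne_top (μ.apply_ne_top i) ?_
      refine ne_top_of_le_ne_top ENNReal.one_ne_top ?_
      rw [PMF.toOuterMeasure_apply, ← PMF.tsum_coe (BISAlgorithm.run G (next i).toAlgorithm)]
      exact ENNReal.tsum_le_tsum fun r => Set.indicator_le_self _ _ r
  | query A B h next ih =>
    simp only [toAlgorithm, BISAlgorithm.run, PMF.toOuterMeasure_map_apply, ev, ← ih]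
    rfl

theorem expectedQueries_toAlgorithm (t : RandTree n ℝ) :
    t.toAlgorithm.expectedQueries G = ENNReal.ofReal (cost G t) := by
  classical
  unfold BISAlgorithm.expectedQueries
  induction t with
  | ret a =>
    simp only [toAlgorithm, BISAlgorithm.run, cost, ENNReal.ofReal_zero]
    refine ENNReal.tsum_eq_zero.2 fun r => ?_
    by_cases h : r = (a, 0)
    · simp [h]
    · simp [PMF.pure_apply, h]
  | sample k μ next ih =>
    simp only [toAlgorithm, BISAlgorithm.run, cost, PMF.bind_apply]
    rw [ENNReal.ofReal_sum_of_nonneg fun i _ => mul_nonneg ENNReal.toReal_nonneg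
      (cost_nonneg G _)]
    simp only [tsum_fintype, Finset.sum_mul]
    rw [Summable.tsum_finsetSum fun _ _ => ENNReal.summable]
    refine Finset.sum_congr rfl fun i _ => ?_
    rw [ENNReal.ofReal_mul ENNReal.toReal_nonneg, ENNReal.ofReal_toReal (μ.apply_ne_top i), ← ih,
      ← ENNReal.tsum_mul_left]
    simp only [mul_assoc]
  | query A B h next ih =>
    simp only [toAlgorithm, BISAlgorithm.run, cost]
    set ν := (toAlgorithm (next (bisAnswer G A B))).run G with hν
    -- Change of variables for the push-forward that increments the query counter; in `ENNReal` the
    -- two sums can be exchanged without a summability condition.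
    have key : ∀ g : ℝ × ℕ → ENNReal, ∑' r, (ν.map fun r => (r.1, r.2 + 1)) r * g r =
        ∑' r, ν r * g (r.1, r.2 + 1) := by
      intro g
      simp only [PMF.map_apply, ← ENNReal.tsum_mul_right]
      rw [ENNReal.tsum_comm]
      refine tsum_congr fun r => ?_
      rw [tsum_eq_single (r.1, r.2 + 1)]
      · simp
      · intro b hb; simp [hb]
    rw [key fun r => (r.2 : ENNReal),
      ENNReal.ofReal_add (cost_nonneg G _) zero_le_one, ← ih]
    simp only [Nat.cast_add, Nat.cast_one, mul_add, mul_one, ENNReal.tsum_add, ENNReal.ofReal_one,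
      hν, PMF.tsum_coe]

/-- Draws an element of a finite type with given probabilities. -/
noncomputable def draw {Ω : Type} [Fintype Ω] (w : Ω → ℝ) (h0 : ∀ x, 0 ≤ w x)
    (h1 : ∑ x, w x = 1) : RandTree n Ω :=
  sample (Fintype.card Ω)
    (PMF.ofFintype (fun i => ENNReal.ofReal (w ((Fintype.equivFin Ω).symm i))) (by
      rw [← ENNReal.ofReal_sum_of_nonneg fun i _ => h0 _,
        Equiv.sum_comp (Fintype.equivFin Ω).symm w, h1, ENNReal.ofReal_one]))
    fun i => ret ((Fintype.equivFin Ω).symm i)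

@[simp] theorem exp_draw {Ω : Type} [Fintype Ω] (w : Ω → ℝ) (h0 : ∀ x, 0 ≤ w x)
    (h1 : ∑ x, w x = 1) (f : Ω → ℝ) :
    (draw w h0 h1 : RandTree n Ω).exp G f = ∑ x, w x * f x := by
  change ev G _ _ = _
  simp only [draw, ev, PMF.ofFintype_apply]
  rw [← Equiv.sum_comp (Fintype.equivFin Ω).symm]
  exact Finset.sum_congr rfl fun i _ => by rw [ENNReal.toReal_ofReal (h0 _)]

@[simp] theorem cost_draw {Ω : Type} [Fintype Ω] (w : Ω → ℝ) (h0 : ∀ x, 0 ≤ w x)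
    (h1 : ∑ x, w x = 1) : cost G (draw w h0 h1 : RandTree n Ω) = 0 := by
  simp [draw, cost]

end RandTree

/-! ### Random subsets with independent membership -/

section Bernoulli

variable {ι : Type} [Fintype ι] [DecidableEq ι]

/-- The truncation of a real number to the unit interval. -/
noncomputable def clampUnit (x : ℝ) : ℝ := max 0 (min 1 x)

theorem clampUnit_nonneg (x : ℝ) : 0 ≤ clampUnit x := le_max_left _ _

theorem clampUnit_le_one (x : ℝ) : clampUnit x ≤ 1 := max_le zero_le_one (min_le_left _ _)

theorem clampUnit_of_mem {x : ℝ} (h0 : 0 ≤ x) (h1 : x ≤ 1) : clampUnit x = x := by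
  rw [clampUnit, min_eq_right h1, max_eq_right h0]

/-- The probability that the random subset with membership rates `r` equals `S`. -/
noncomputable def bernoulliWeight (r : ι → ℝ) (S : Finset ι) : ℝ :=
  ∏ i, if i ∈ S then clampUnit (r i) else 1 - clampUnit (r i)

theorem bernoulliWeight_nonneg (r : ι → ℝ) (S : Finset ι) : 0 ≤ bernoulliWeight r S :=
  Finset.prod_nonneg fun i _ => by
    split_ifs
    · exact clampUnit_nonneg _
    · linarith [clampUnit_le_one (r i)]

/-- Expanding a product of two-term sums produces one term per subset, and these terms are the
weighted products. This identity encodes the independence of the memberships. -/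
theorem sum_bernoulliWeight_mul_prod (r x y : ι → ℝ) :
    ∑ S, bernoulliWeight r S * (∏ i, if i ∈ S then x i else y i) =
      ∏ i, (clampUnit (r i) * x i + (1 - clampUnit (r i)) * y i) := by
  rw [Finset.prod_add, Finset.powerset_univ]
  refine Finset.sum_congr rfl fun S _ => ?_
  rw [bernoulliWeight, ← Finset.prod_mul_distrib]
  have : ∀ i, ((if i ∈ S then clampUnit (r i) else 1 - clampUnit (r i)) *
      if i ∈ S then x i else y i) =
      if i ∈ S then clampUnit (r i) * x i else (1 - clampUnit (r i)) * y i := by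
    intro i; split_ifs <;> rfl
  simp only [this]
  rw [Finset.prod_ite]
  congr 1
  · exact Finset.prod_congr (by ext; simp) fun _ _ => rfl
  · exact Finset.prod_congr (by ext; simp) fun _ _ => rfl

theorem sum_bernoulliWeight (r : ι → ℝ) : ∑ S, bernoulliWeight r S = 1 := by
  have := sum_bernoulliWeight_mul_prod r (fun _ => 1) (fun _ => 1)
  simpa using this

/-- The random subset of `ι` that contains each `i` independently with probability `r i`. -/
noncomputable def bernoulliSet (r : ι → ℝ) : Expectation (Finset ι) where
  toFun f := ∑ S, bernoulliWeight r S * f S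
  map_add' f g := by simp only [mul_add, Finset.sum_add_distrib]
  map_mul' c f := by
    rw [Finset.mul_sum]; exact Finset.sum_congr rfl fun S _ => by ring
  mono' f g h := Finset.sum_le_sum fun S _ =>
    mul_le_mul_of_nonneg_left (h S) (bernoulliWeight_nonneg r S)
  one' := by simpa using sum_bernoulliWeight r

/-- Draws a random subset with independent membership. -/
noncomputable def RandTree.bern {n : ℕ} (r : ι → ℝ) : RandTree n (Finset ι) :=
  RandTree.draw (bernoulliWeight r) (bernoulliWeight_nonneg r) (sum_bernoulliWeight r)

@[simp] theorem RandTree.exp_bern {n : ℕ} (G : SimpleGraph (Fin n)) [DecidableRel G.Adj]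
    (r : ι → ℝ) (f : Finset ι → ℝ) : (RandTree.bern r).exp G f = bernoulliSet r f := by
  simp only [bern, exp_draw]; rfl

@[simp] theorem RandTree.cost_bern {n : ℕ} (G : SimpleGraph (Fin n)) [DecidableRel G.Adj]
    (r : ι → ℝ) : (RandTree.bern r : RandTree n (Finset ι)).cost G = 0 := by
  simp [bern]

/-- The truncation in the weights makes drawing possible for arbitrary rates; for rates in the unit
interval it disappears. -/
theorem bernoulliSet_prod {r : ι → ℝ} (hr : ∀ i, 0 ≤ r i ∧ r i ≤ 1)
    (x y : ι → ℝ) :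
    bernoulliSet r (fun S => ∏ i, if i ∈ S then x i else y i) =
      ∏ i, (r i * x i + (1 - r i) * y i) := by
  refine (sum_bernoulliWeight_mul_prod r x y).trans ?_
  exact Finset.prod_congr rfl fun i _ => by rw [clampUnit_of_mem (hr i).1 (hr i).2]

theorem bernoulliSet_subset {r : ι → ℝ} (hr : ∀ i, 0 ≤ r i ∧ r i ≤ 1)
    (A : Finset ι) :
    bernoulliSet r (fun S => if A ⊆ S then 1 else 0) = ∏ i ∈ A, r i := by
  have h := bernoulliSet_prod hr (fun _ => 1) (fun i => if i ∈ A then 0 else 1)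
  have h2 : ∏ i, (r i * 1 + (1 - r i) * if i ∈ A then 0 else 1) = ∏ i ∈ A, r i := by
    rw [← Finset.prod_subset (Finset.subset_univ A)]
    · exact Finset.prod_congr rfl fun i hi => by simp [hi]
    · intro i _ hi; simp [hi]
  rw [← h2, ← h]
  congr 1; funext S
  split_ifs with hA
  · refine (Finset.prod_eq_one fun i _ => ?_).symm
    by_cases hS : i ∈ S
    · simp [hS]
    · have : i ∉ A := fun hi => hS (hA hi)
      simp [hS, this]
  · obtain ⟨i, hiA, hiS⟩ := Finset.not_subset.1 hA
    exact (Finset.prod_eq_zero (Finset.mem_univ i) (by simp [hiA, hiS])).symm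

theorem bernoulliSet_disjoint {r : ι → ℝ} (hr : ∀ i, 0 ≤ r i ∧ r i ≤ 1)
    (A : Finset ι) :
    bernoulliSet r (fun S => if Disjoint A S then 1 else 0) = ∏ i ∈ A, (1 - r i) := by
  have h := bernoulliSet_prod hr (fun i => if i ∈ A then 0 else 1) (fun _ => 1)
  have h2 : ∏ i, ((r i * if i ∈ A then 0 else 1) + (1 - r i) * 1) = ∏ i ∈ A, (1 - r i) := by
    rw [← Finset.prod_subset (Finset.subset_univ A)]
    · exact Finset.prod_congr rfl fun i hi => by simp [hi]
    · intro i _ hi; simp [hi]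
  rw [← h2, ← h]
  congr 1; funext S
  split_ifs with hA
  · refine (Finset.prod_eq_one fun i _ => ?_).symm
    by_cases hS : i ∈ S
    · have : i ∉ A := fun hi => Finset.disjoint_left.1 hA hi hS
      simp [hS, this]
    · simp [hS]
  · obtain ⟨i, hiA, hiS⟩ := Finset.not_disjoint_iff.1 hA
    exact (Finset.prod_eq_zero (Finset.mem_univ i) (by simp [hiA, hiS])).symm

theorem bernoulliSet_mem {r : ι → ℝ} (hr : ∀ i, 0 ≤ r i ∧ r i ≤ 1)
    (i : ι) : bernoulliSet r (fun S => if i ∈ S then 1 else 0) = r i := by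
  simpa using bernoulliSet_subset hr {i}

/-- On the diagonal the indicator is idempotent, so `r i` replaces `r i ^ 2`; the difference is the
variance of one membership. -/
theorem bernoulliSet_mem_mem {r : ι → ℝ} (hr : ∀ i, 0 ≤ r i ∧ r i ≤ 1)
    (i j : ι) :
    bernoulliSet r (fun S => (if i ∈ S then 1 else 0) * (if j ∈ S then 1 else 0)) =
      r i * r j + if i = j then r i * (1 - r i) else 0 := by
  have h := bernoulliSet_subset hr {i, j}
  have h2 : (fun S : Finset ι => if ({i, j} : Finset ι) ⊆ S then (1 : ℝ) else 0) =
      fun S => (if i ∈ S then 1 else 0) * (if j ∈ S then 1 else 0) := by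
    funext S
    by_cases hi : i ∈ S <;> by_cases hj : j ∈ S <;> simp [Finset.insert_subset_iff, hi, hj]
  rw [← h2, h]
  split_ifs with hij
  · subst hij; simp; ring
  · rw [Finset.prod_pair hij, add_zero]

/-- The second moment of a linear statistic of a random subset. -/
theorem bernoulliSet_sum_sq {r : ι → ℝ} (hr : ∀ i, 0 ≤ r i ∧ r i ≤ 1)
    (c : ι → ℝ) :
    bernoulliSet r (fun S => (∑ i, c i * if i ∈ S then 1 else 0) ^ 2) =
      (∑ i, c i * r i) ^ 2 + ∑ i, c i ^ 2 * (r i * (1 - r i)) := by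
  have h1 : ∀ S : Finset ι, (∑ i, c i * if i ∈ S then (1 : ℝ) else 0) ^ 2 =
      ∑ i, ∑ j, c i * c j * ((if i ∈ S then 1 else 0) * (if j ∈ S then 1 else 0)) := by
    intro S
    rw [sq, Finset.sum_mul_sum]
    exact Finset.sum_congr rfl fun i _ => Finset.sum_congr rfl fun j _ => by ring
  simp only [h1, Expectation.sum, Expectation.const_mul, bernoulliSet_mem_mem hr, mul_add,
    Finset.sum_add_distrib]
  congr 1
  · rw [sq, Finset.sum_mul_sum]
    exact Finset.sum_congr rfl fun i _ => Finset.sum_congr rfl fun j _ => by ring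
  · refine Finset.sum_congr rfl fun i _ => ?_
    simp only [mul_ite, mul_zero, Finset.sum_ite_eq, Finset.mem_univ, if_true]
    ring

/-- The probability that a random subset misses a set all of whose rates equal `x`. -/
theorem bernoulliSet_disjoint_le {r : ι → ℝ} (hr : ∀ i, 0 ≤ r i ∧ r i ≤ 1)
    (A : Finset ι) {x : ℝ} (hA : ∀ i ∈ A, r i = x) (hx0 : 0 ≤ x)
    (hx1 : x ≤ 1) :
    (A.card * x) * bernoulliSet r (fun S => if Disjoint A S then 1 else 0) ≤ 1 := by
  rw [bernoulliSet_disjoint hr, Finset.prod_congr rfl fun i hi => by rw [hA i hi],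
    Finset.prod_const]
  -- Bernoulli's inequality together with `(1 + x)(1 - x) ≤ 1` gives `k x (1 - x)^k ≤ 1` without
  -- exponentials.
  have h1 : 1 + (A.card : ℝ) * x ≤ (1 + x) ^ A.card := one_add_mul_le_pow (by linarith) _
  have h2 : 0 ≤ (1 - x) ^ A.card := pow_nonneg (by linarith) _
  have h3 : (1 + x) ^ A.card * (1 - x) ^ A.card ≤ 1 := by
    rw [← mul_pow]
    exact pow_le_one₀ (mul_nonneg (by linarith) (by linarith)) (by nlinarith)
  nlinarith

/-- The probability that a random subset meets a set all of whose rates equal `x`. -/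
theorem bernoulliSet_not_disjoint_le {r : ι → ℝ} (hr : ∀ i, 0 ≤ r i ∧ r i ≤ 1)
    (A : Finset ι) {x : ℝ} (hA : ∀ i ∈ A, r i = x) :
    bernoulliSet r (fun S => if Disjoint A S then 0 else 1) ≤ A.card * x := by
  have h : bernoulliSet r (fun S => if Disjoint A S then (0 : ℝ) else 1) ≤
      bernoulliSet r (fun S => ∑ i ∈ A, if i ∈ S then 1 else 0) := by
    refine Expectation.mono _ fun S => ?_
    split_ifs with hd
    · exact Finset.sum_nonneg fun i _ => by split_ifs <;> norm_num
    · obtain ⟨i, hiA, hiS⟩ := Finset.not_disjoint_iff.1 hd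
      calc (1 : ℝ) = if i ∈ S then 1 else 0 := by simp [hiS]
        _ ≤ _ := Finset.single_le_sum
          (f := fun i => if i ∈ S then (1 : ℝ) else 0)
          (fun i _ => by split_ifs <;> norm_num) hiA
  refine h.trans ?_
  rw [Expectation.sum, Finset.sum_congr rfl fun i hi => by rw [bernoulliSet_mem hr, hA i hi]]
  simp

end Bernoulli

/-! ### Counting edges and triangles by sums of indicators -/

section Counting

variable {n : ℕ} (G : SimpleGraph (Fin n)) [DecidableRel G.Adj]

/-- The indicator of adjacency. -/
def adjInd (u v : Fin n) : ℝ := if G.Adj u v then 1 else 0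

theorem adjInd_comm (u v : Fin n) : adjInd G u v = adjInd G v u := by
  simp only [adjInd, G.adj_comm]

theorem adjInd_nonneg (u v : Fin n) : 0 ≤ adjInd G u v := by
  unfold adjInd; split_ifs <;> norm_num

theorem adjInd_le_one (u v : Fin n) : adjInd G u v ≤ 1 := by
  unfold adjInd; split_ifs <;> norm_num

theorem adjInd_mul_self (u v : Fin n) : adjInd G u v * adjInd G u v = adjInd G u v := by
  unfold adjInd; split_ifs <;> norm_num

/-- The degree of a vertex as a real number. -/
def degR (u : Fin n) : ℝ := ∑ v, adjInd G u v

theorem degR_nonneg (u : Fin n) : 0 ≤ degR G u := Finset.sum_nonneg fun v _ => adjInd_nonneg G u v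

theorem degR_eq_card (u : Fin n) : degR G u = (G.neighborFinset u).card := by
  simp only [degR, adjInd, Finset.sum_boole]
  congr 2
  ext v; simp

theorem degR_le (u : Fin n) : degR G u ≤ n := by
  calc degR G u ≤ ∑ _v : Fin n, (1 : ℝ) := Finset.sum_le_sum fun v _ => adjInd_le_one G u v
    _ = n := by simp

theorem adjInd_le_degR (u v : Fin n) : adjInd G u v ≤ degR G u :=
  Finset.single_le_sum (f := adjInd G u) (fun v _ => adjInd_nonneg G u v) (Finset.mem_univ v)

theorem one_le_degR {u v : Fin n} (h : G.Adj u v) : 1 ≤ degR G u := by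
  simpa [adjInd, h] using adjInd_le_degR G u v

theorem sum_degR : ∑ u, degR G u = 2 * edgeCount G := by
  simp only [degR_eq_card, SimpleGraph.card_neighborFinset_eq_degree]
  exact_mod_cast G.sum_degrees_eq_twice_card_edges

/-- The indicator of an ordered triangle. -/
def triInd (u v w : Fin n) : ℝ := adjInd G u v * adjInd G u w * adjInd G v w

theorem triInd_nonneg (u v w : Fin n) : 0 ≤ triInd G u v w :=
  mul_nonneg (mul_nonneg (adjInd_nonneg _ _ _) (adjInd_nonneg _ _ _)) (adjInd_nonneg _ _ _)

theorem triInd_le_one (u v w : Fin n) : triInd G u v w ≤ 1 := by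
  unfold triInd adjInd; split_ifs <;> norm_num

theorem triInd_mul_self (u v w : Fin n) : triInd G u v w * triInd G u v w = triInd G u v w := by
  unfold triInd adjInd; split_ifs <;> norm_num

theorem triInd_swap_left (u v w : Fin n) : triInd G v u w = triInd G u v w := by
  simp only [triInd, adjInd_comm G v u]; ring

theorem triInd_swap_right (u v w : Fin n) : triInd G u w v = triInd G u v w := by
  simp only [triInd, adjInd_comm G w v]; ring

theorem triInd_rotate (u v w : Fin n) : triInd G v w u = triInd G u v w := by
  rw [triInd_swap_right, triInd_swap_left]

/-- The set of ordered triangles. -/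
def orderedTriangles : Finset (Fin n × Fin n × Fin n) :=
  Finset.univ.filter fun t => G.Adj t.1 t.2.1 ∧ G.Adj t.1 t.2.2 ∧ G.Adj t.2.1 t.2.2

/-- Every 3-clique is the underlying set of exactly six ordered triples. -/
theorem card_orderedTriangles : (orderedTriangles G).card = 6 * triangleCount G := by
  classical
  have hmap : ∀ t ∈ orderedTriangles G,
      ({t.1, t.2.1, t.2.2} : Finset (Fin n)) ∈ G.cliqueFinset 3 := by
    rintro ⟨a, b, c⟩ ht
    simp only [orderedTriangles, Finset.mem_filter, Finset.mem_univ, true_and] at ht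
    rw [SimpleGraph.mem_cliqueFinset_iff]
    exact SimpleGraph.is3Clique_triple_iff.2 ht
  rw [Finset.card_eq_sum_card_fiberwise hmap, triangleCount, mul_comm]
  refine Finset.sum_const_nat fun s hs => ?_
  rw [SimpleGraph.mem_cliqueFinset_iff, SimpleGraph.is3Clique_iff] at hs
  obtain ⟨a, b, c, hab, hac, hbc, rfl⟩ := hs
  have hab' := hab.ne
  have hac' := hac.ne
  have hbc' := hbc.ne
  have : (orderedTriangles G).filter (fun t => ({t.1, t.2.1, t.2.2} : Finset (Fin n)) = {a, b, c}) =
      {(a, b, c), (a, c, b), (b, a, c), (b, c, a), (c, a, b), (c, b, a)} := by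
    ext ⟨x, y, z⟩
    simp only [orderedTriangles, Finset.mem_filter, Finset.mem_univ, true_and, Finset.mem_insert,
      Finset.mem_singleton, Prod.mk.injEq]
    constructor
    · rintro ⟨⟨hxy, hxz, hyz⟩, h⟩
      have hx : x ∈ ({a, b, c} : Finset (Fin n)) := h ▸ by simp
      have hy : y ∈ ({a, b, c} : Finset (Fin n)) := h ▸ by simp
      have hz : z ∈ ({a, b, c} : Finset (Fin n)) := h ▸ by simp
      simp only [Finset.mem_insert, Finset.mem_singleton] at hx hy hz
      have := hxy.ne
      have := hxz.ne
      have := hyz.ne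
      grind
    · have e1 := hab.symm
      have e2 := hac.symm
      have e3 := hbc.symm
      rintro (⟨rfl, rfl, rfl⟩ | ⟨rfl, rfl, rfl⟩ | ⟨rfl, rfl, rfl⟩ | ⟨rfl, rfl, rfl⟩ |
        ⟨rfl, rfl, rfl⟩ | ⟨rfl, rfl, rfl⟩) <;>
      refine ⟨⟨by assumption, by assumption, by assumption⟩, ?_⟩ <;>
      grind
  rw [this]
  repeat rw [Finset.card_insert_of_notMem]
  · simp
  all_goals
    simp only [Finset.mem_insert, Finset.mem_singleton, Prod.mk.injEq]
    grind

theorem sum_triInd : ∑ u, ∑ v, ∑ w, triInd G u v w = 6 * triangleCount G := by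
  have h : ((orderedTriangles G).card : ℝ) = 6 * triangleCount G := by
    exact_mod_cast card_orderedTriangles G
  rw [← h, orderedTriangles, ← Finset.sum_boole]
  rw [Fintype.sum_prod_type]
  refine Finset.sum_congr rfl fun u _ => ?_
  rw [Fintype.sum_prod_type]
  refine Finset.sum_congr rfl fun v _ => Finset.sum_congr rfl fun w _ => ?_
  unfold triInd adjInd
  by_cases h1 : G.Adj u v <;> by_cases h2 : G.Adj u w <;> by_cases h3 : G.Adj v w <;>
    simp [h1, h2, h3]

/-- The number of common neighbours is at most either degree, hence at most their geometric mean. -/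
theorem sum_triInd_le_sqrt (u v : Fin n) :
    ∑ w, triInd G u v w ≤ adjInd G u v * √(degR G u * degR G v) := by
  have h : ∑ w, triInd G u v w = adjInd G u v * ∑ w, adjInd G u w * adjInd G v w := by
    rw [Finset.mul_sum]; exact Finset.sum_congr rfl fun w _ => by rw [triInd]; ring
  rw [h]
  refine mul_le_mul_of_nonneg_left ?_ (adjInd_nonneg G u v)
  refine Real.le_sqrt_of_sq_le ?_
  have h1 : ∑ w, adjInd G u w * adjInd G v w ≤ degR G u := Finset.sum_le_sum fun w _ =>
    mul_le_of_le_one_right (adjInd_nonneg _ _ _) (adjInd_le_one _ _ _)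
  have h2 : ∑ w, adjInd G u w * adjInd G v w ≤ degR G v := Finset.sum_le_sum fun w _ =>
    mul_le_of_le_one_left (adjInd_nonneg _ _ _) (adjInd_le_one _ _ _)
  have h0 : 0 ≤ ∑ w, adjInd G u w * adjInd G v w := Finset.sum_nonneg fun w _ =>
    mul_nonneg (adjInd_nonneg _ _ _) (adjInd_nonneg _ _ _)
  rw [sq]
  exact mul_le_mul h1 h2 h0 (degR_nonneg G u)

/-- The number of triangles is at most `m ^ (3/2)`, in squared form. -/
theorem triangleCount_sq_le : (triangleCount G : ℝ) ^ 2 ≤ (edgeCount G : ℝ) ^ 3 := by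
  have h1 : (6 : ℝ) * triangleCount G ≤
      ∑ e : Fin n × Fin n, adjInd G e.1 e.2 * √(degR G e.1 * degR G e.2) := by
    rw [← sum_triInd, Fintype.sum_prod_type]
    exact Finset.sum_le_sum fun u _ => Finset.sum_le_sum fun v _ => sum_triInd_le_sqrt G u v
  -- Cauchy–Schwarz over all ordered pairs: extending the sum of `d_u d_v` from edges to all pairs
  -- makes it factor as `(2m)²`, and `36 T² ≤ 8 m³` results.
  have h2 := Finset.sum_mul_sq_le_sq_mul_sq Finset.univ
    (fun e : Fin n × Fin n => adjInd G e.1 e.2) (fun e => √(degR G e.1 * degR G e.2))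
  have h3 : ∑ e : Fin n × Fin n, adjInd G e.1 e.2 ^ 2 = 2 * edgeCount G := by
    simp only [sq, adjInd_mul_self]
    rw [Fintype.sum_prod_type, ← sum_degR]
    rfl
  have h4 : ∑ e : Fin n × Fin n, √(degR G e.1 * degR G e.2) ^ 2 = (2 * edgeCount G) ^ 2 := by
    simp only [Real.sq_sqrt (mul_nonneg (degR_nonneg G _) (degR_nonneg G _))]
    rw [Fintype.sum_prod_type, sq, ← sum_degR, Finset.sum_mul_sum]
  rw [h3, h4] at h2
  have h5 : ((6 : ℝ) * triangleCount G) ^ 2 ≤ 2 * edgeCount G * (2 * edgeCount G) ^ 2 :=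
    (pow_le_pow_left₀ (by positivity) h1 2).trans h2
  have h6 : (0 : ℝ) ≤ (edgeCount G : ℝ) ^ 3 := by positivity
  nlinarith

end Counting

/-! ### Listing edges -/

section Listing

variable {n : ℕ}

/-- The ordered pairs in `A × B` that are edges. -/
def edgesIn (G : SimpleGraph (Fin n)) [DecidableRel G.Adj] (A B : Finset (Fin n)) :
    Finset (Fin n × Fin n) :=
  (A ×ˢ B).filter fun e => G.Adj e.1 e.2

/-- Half of the elements of a finite set. -/
noncomputable def halfOf (A : Finset (Fin n)) : Finset (Fin n) :=
  Classical.choose (Finset.exists_subset_card_eq (Nat.div_le_self A.card 2))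

theorem halfOf_subset (A : Finset (Fin n)) : halfOf A ⊆ A :=
  (Classical.choose_spec (Finset.exists_subset_card_eq (Nat.div_le_self A.card 2))).1

theorem card_halfOf (A : Finset (Fin n)) : (halfOf A).card = A.card / 2 :=
  (Classical.choose_spec (Finset.exists_subset_card_eq (Nat.div_le_self A.card 2))).2

theorem card_sdiff_halfOf (A : Finset (Fin n)) : (A \ halfOf A).card = A.card - A.card / 2 := by
  rw [Finset.card_sdiff_of_subset (halfOf_subset A), card_halfOf]

/-- Lists the edges between two disjoint sets with at most `2 ^ k` elements by recursive
bisection. -/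
noncomputable def listDisjoint : (k : ℕ) → (A B : Finset (Fin n)) → Disjoint A B →
    QueryTree n (Finset (Fin n × Fin n))
  | 0, A, B, h => .query A B h fun b => .ret (if b then A ×ˢ B else ∅)
  | k + 1, A, B, h => .query A B h fun b =>
      if b then
        (listDisjoint k (halfOf A) (halfOf B)
          (h.mono (halfOf_subset A) (halfOf_subset B))).bind fun D₁ =>
        (listDisjoint k (halfOf A) (B \ halfOf B)
          (h.mono (halfOf_subset A) Finset.sdiff_subset)).bind fun D₂ =>
        (listDisjoint k (A \ halfOf A) (halfOf B)
          (h.mono Finset.sdiff_subset (halfOf_subset B))).bind fun D₃ =>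
        (listDisjoint k (A \ halfOf A) (B \ halfOf B)
          (h.mono Finset.sdiff_subset Finset.sdiff_subset)).map fun D₄ => D₁ ∪ D₂ ∪ (D₃ ∪ D₄)
      else .ret ∅

variable (G : SimpleGraph (Fin n)) [DecidableRel G.Adj]

theorem mem_edgesIn {A B : Finset (Fin n)} {e : Fin n × Fin n} :
    e ∈ edgesIn G A B ↔ e.1 ∈ A ∧ e.2 ∈ B ∧ G.Adj e.1 e.2 := by
  simp [edgesIn, and_assoc]

theorem card_edgesIn (A B : Finset (Fin n)) :
    ((edgesIn G A B).card : ℝ) =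
      ∑ u, ∑ v, adjInd G u v * ((if u ∈ A then 1 else 0) * if v ∈ B then 1 else 0) := by
  rw [edgesIn, ← Finset.sum_boole, Finset.sum_product,
    ← Finset.sum_subset (Finset.subset_univ A)]
  · refine Finset.sum_congr rfl fun u hu => ?_
    rw [← Finset.sum_subset (Finset.subset_univ B)]
    · exact Finset.sum_congr rfl fun v hv => by simp [adjInd, hu, hv]
    · intro v _ hv; simp [hv]
  · intro u _ hu; simp [hu]

theorem bisAnswer_eq_true_iff (A B : Finset (Fin n)) :
    bisAnswer G A B = true ↔ (edgesIn G A B).Nonempty := by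
  simp only [bisAnswer, decide_eq_true_eq, Finset.Nonempty, mem_edgesIn, Prod.exists]
  grind

theorem bisAnswer_eq_false_iff (A B : Finset (Fin n)) :
    bisAnswer G A B = false ↔ edgesIn G A B = ∅ := by
  rw [← Finset.not_nonempty_iff_eq_empty, ← bisAnswer_eq_true_iff, Bool.not_eq_true]

theorem edgesIn_eq_union (A B A' B' : Finset (Fin n)) (hA : A' ⊆ A) (hB : B' ⊆ B) :
    edgesIn G A B = edgesIn G A' B' ∪ edgesIn G A' (B \ B') ∪
      (edgesIn G (A \ A') B' ∪ edgesIn G (A \ A') (B \ B')) := by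
  ext e
  simp only [Finset.mem_union, mem_edgesIn, Finset.mem_sdiff]
  have := @hA e.1
  have := @hB e.2
  tauto

theorem card_edgesIn_split (A B A' B' : Finset (Fin n)) (hA : A' ⊆ A) (hB : B' ⊆ B) :
    (edgesIn G A B).card = (edgesIn G A' B').card + (edgesIn G A' (B \ B')).card +
      ((edgesIn G (A \ A') B').card + (edgesIn G (A \ A') (B \ B')).card) := by
  rw [edgesIn_eq_union G A B A' B' hA hB]
  rw [Finset.card_union_of_disjoint, Finset.card_union_of_disjoint, Finset.card_union_of_disjoint]
  all_goals
    rw [Finset.disjoint_left]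
    intro e
    simp only [Finset.mem_union, mem_edgesIn, Finset.mem_sdiff]
    tauto

theorem eval_listDisjoint (k : ℕ) : ∀ (A B : Finset (Fin n)) (h : Disjoint A B),
    A.card ≤ 2 ^ k → B.card ≤ 2 ^ k → (listDisjoint k A B h).eval G = edgesIn G A B := by
  induction k with
  | zero =>
    intro A B h hA hB
    simp only [listDisjoint, QueryTree.eval]
    -- Both sets have at most one element, so a positive answer identifies the product with the edge
    -- set.
    by_cases hb : bisAnswer G A B = true
    · rw [hb, if_pos rfl]
      obtain ⟨e, he⟩ := (bisAnswer_eq_true_iff G A B).1 hb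
      rw [mem_edgesIn] at he
      rw [edgesIn, Finset.filter_true_of_mem]
      rintro ⟨a, b⟩ hab
      rw [Finset.mem_product] at hab
      rw [Finset.card_le_one.1 (by simpa using hA) _ hab.1 _ he.1,
        Finset.card_le_one.1 (by simpa using hB) _ hab.2 _ he.2.1]
      exact he.2.2
    · rw [Bool.not_eq_true] at hb
      rw [hb, (bisAnswer_eq_false_iff G A B).1 hb]
      rfl
  | succ k ih =>
    intro A B h hA hB
    simp only [listDisjoint, QueryTree.eval]
    by_cases hb : bisAnswer G A B = true
    · have h2 : 2 ^ (k + 1) = 2 * 2 ^ k := by ring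
      have a1 : (halfOf A).card ≤ 2 ^ k := by rw [card_halfOf]; omega
      have a2 : (A \ halfOf A).card ≤ 2 ^ k := by rw [card_sdiff_halfOf]; omega
      have b1 : (halfOf B).card ≤ 2 ^ k := by rw [card_halfOf]; omega
      have b2 : (B \ halfOf B).card ≤ 2 ^ k := by rw [card_sdiff_halfOf]; omega
      rw [hb, if_pos rfl]
      simp only [QueryTree.eval_bind, QueryTree.eval_map]
      rw [ih _ _ _ a1 b1, ih _ _ _ a1 b2, ih _ _ _ a2 b1, ih _ _ _ a2 b2]
      exact (edgesIn_eq_union G A B _ _ (halfOf_subset A) (halfOf_subset B)).symm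
    · rw [Bool.not_eq_true] at hb
      rw [hb, (bisAnswer_eq_false_iff G A B).1 hb]
      rfl

/-- A call branches only if its pair of sets contains an edge. The calls of a fixed depth split the
edges among themselves, so each depth has at most as many branching calls as edges, and each causes
four further queries. -/
theorem cost_listDisjoint (k : ℕ) : ∀ (A B : Finset (Fin n)) (h : Disjoint A B),
    (listDisjoint k A B h).cost G ≤ 1 + 4 * k * (edgesIn G A B).card := by
  induction k with
  | zero => intro A B h; simp [listDisjoint, QueryTree.cost]
  | succ k ih =>
    intro A B h
    simp only [listDisjoint, QueryTree.cost]
    by_cases hb : bisAnswer G A B = true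
    · rw [hb, if_pos rfl]
      simp only [QueryTree.cost_bind, QueryTree.cost_map]
      have h1 := ih (halfOf A) (halfOf B) (h.mono (halfOf_subset A) (halfOf_subset B))
      have h2 := ih (halfOf A) (B \ halfOf B) (h.mono (halfOf_subset A) Finset.sdiff_subset)
      have h3 := ih (A \ halfOf A) (halfOf B) (h.mono Finset.sdiff_subset (halfOf_subset B))
      have h4 := ih (A \ halfOf A) (B \ halfOf B)
        (h.mono Finset.sdiff_subset Finset.sdiff_subset)
      have hc := card_edgesIn_split G A B _ _ (halfOf_subset A) (halfOf_subset B)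
      -- The four additive ones of the recursive calls are paid for by the edge that this pair
      -- contains.
      have hpos := Finset.card_pos.2 ((bisAnswer_eq_true_iff G A B).1 hb)
      have hc' : ((edgesIn G A B).card : ℝ) = _ := congrArg (Nat.cast : ℕ → ℝ) hc
      have hpos' : (1 : ℝ) ≤ (edgesIn G A B).card := by exact_mod_cast hpos
      push_cast at hc' ⊢
      have h5 : 4 * (k : ℝ) * (edgesIn G A B).card = 4 * k * _ := congrArg _ hc'
      linarith
    · rw [Bool.not_eq_true] at hb
      simp only [hb, Bool.false_eq_true, if_false, QueryTree.cost_ret]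
      have : (0 : ℝ) ≤ 4 * ((k + 1 : ℕ) : ℝ) * (edgesIn G A B).card := by positivity
      linarith

/-- The number of bits of a vertex. -/
def bits (n : ℕ) : ℕ := Nat.clog 2 n

/-- One more than the number of bits of a vertex, as a real number. -/
def logSize (n : ℕ) : ℝ := bits n + 1

theorem one_le_logSize (n : ℕ) : 1 ≤ logSize n := by simp [logSize]

theorem le_two_pow_bits (n : ℕ) : n ≤ 2 ^ bits n := Nat.le_pow_clog (by norm_num) n

/-- The vertices of `A` whose `b`-th bit is `x`. -/
def bitPart (A : Finset (Fin n)) (b : ℕ) (x : Bool) : Finset (Fin n) :=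
  A.filter fun v => v.val.testBit b = x

theorem disjoint_bitPart (A B : Finset (Fin n)) (b : ℕ) (x : Bool) :
    Disjoint (bitPart A b x) (bitPart B b (!x)) := by
  rw [Finset.disjoint_left]
  intro v hv hv'
  simp only [bitPart, Finset.mem_filter] at hv hv'
  simp [hv.2] at hv'

/-- Lists the edges in `A × B`. -/
noncomputable def listEdges (A B : Finset (Fin n)) : QueryTree n (Finset (Fin n × Fin n)) :=
  QueryTree.supOver (Finset.univ : Finset (Fin (bits n) × Bool)) fun i =>
    listDisjoint (bits n) (bitPart A i.1 i.2) (bitPart B i.1 (!i.2)) (disjoint_bitPart A B i.1 i.2)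

-- Queries require disjoint sets, while `A` and `B` may overlap. Adjacent vertices are distinct and
-- so differ in some bit, hence every edge goes from a vertex with bit value `x` to one with the
-- opposite value for some position.
@[simp] theorem eval_listEdges (A B : Finset (Fin n)) :
    (listEdges A B).eval G = edgesIn G A B := by
  have hc : ∀ A : Finset (Fin n), A.card ≤ 2 ^ bits n := fun A =>
    (A.card_le_univ.trans_eq (Fintype.card_fin n)).trans (le_two_pow_bits n)
  simp only [listEdges, QueryTree.eval_supOver, eval_listDisjoint G _ _ _ _ (hc _) (hc _)]
  ext e
  simp only [Finset.mem_sup, Finset.mem_univ, true_and, mem_edgesIn, bitPart, Finset.mem_filter,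
    Prod.exists]
  constructor
  · rintro ⟨b, x, h⟩; tauto
  · rintro ⟨h1, h2, h3⟩
    have hne : e.1.val ≠ e.2.val := fun h => h3.ne (Fin.ext h)
    obtain ⟨b, hb⟩ := Nat.exists_testBit_ne_of_ne hne
    -- All vertex names are below `2 ^ bits n`, so names agree, with value zero, in every higher
    -- bit.
    have hlt : b < bits n := by
      by_contra hge
      rw [not_lt] at hge
      have hz : ∀ v : Fin n, v.val.testBit b = false := fun v =>
        Nat.testBit_lt_two_pow ((v.2.trans_le (le_two_pow_bits n)).trans_le
          (Nat.pow_le_pow_right (by norm_num) hge))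
      exact hb ((hz _).trans (hz _).symm)
    refine ⟨⟨b, hlt⟩, e.1.val.testBit b, ⟨h1, rfl⟩, ⟨h2, ?_⟩, h3⟩
    revert hb
    cases e.1.val.testBit b <;> cases e.2.val.testBit b <;> simp

/-- The number of queries that suffices for listing, per edge. -/
noncomputable def listFactor (n : ℕ) : ℝ := 8 * logSize n ^ 2

theorem one_le_listFactor (n : ℕ) : 1 ≤ listFactor n := by
  have := one_le_logSize n
  unfold listFactor; nlinarith

theorem cost_listEdges (A B : Finset (Fin n)) :
    (listEdges A B).cost G ≤ listFactor n * (1 + (edgesIn G A B).card) := by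
  have hsub : ∀ (b : ℕ) (x : Bool),
      ((edgesIn G (bitPart A b x) (bitPart B b (!x))).card : ℝ) ≤ (edgesIn G A B).card := by
    intro b x
    refine Nat.cast_le.2 (Finset.card_le_card fun e he => ?_)
    simp only [mem_edgesIn, bitPart, Finset.mem_filter] at he ⊢
    tauto
  have h : (listEdges A B).cost G ≤
      ∑ _i : Fin (bits n) × Bool, (1 + 4 * bits n * ((edgesIn G A B).card : ℝ)) := by
    rw [listEdges, QueryTree.cost_supOver]
    refine Finset.sum_le_sum fun i _ => (cost_listDisjoint G _ _ _ _).trans ?_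
    have := mul_le_mul_of_nonneg_left (hsub i.1 i.2) (by positivity : (0 : ℝ) ≤ 4 * bits n)
    linarith
  refine h.trans ?_
  simp only [Finset.sum_const, Finset.card_univ, Fintype.card_prod, Fintype.card_fin,
    Fintype.card_bool, nsmul_eq_mul, listFactor, logSize]
  push_cast
  have hb : (0 : ℝ) ≤ bits n := by positivity
  have he : (0 : ℝ) ≤ (edgesIn G A B).card := by positivity
  nlinarith [mul_nonneg hb he]

/-- Decides adjacency of two vertices. -/
def askAdj (u v : Fin n) : QueryTree n Bool :=
  if h : u = v then .ret false
  else .query {u} {v} (Finset.disjoint_singleton.2 h) .ret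

@[simp] theorem eval_askAdj (u v : Fin n) : (askAdj u v).eval G = decide (G.Adj u v) := by
  unfold askAdj
  split_ifs with h
  · simp [h]
  · simp [QueryTree.eval, bisAnswer]

theorem cost_askAdj (u v : Fin n) : (askAdj u v).cost G ≤ 1 := by
  unfold askAdj
  split_ifs with h <;> simp [QueryTree.cost]

/-- Decides whether `u` has a neighbour in `B`. -/
def askNeighbor (u : Fin n) (B : Finset (Fin n)) : QueryTree n Bool :=
  .query {u} (B.erase u) (by simp) .ret

-- Removing `u` from `B` makes the query legal and loses nothing, as the graph has no loops.
@[simp] theorem eval_askNeighbor (u : Fin n) (B : Finset (Fin n)) :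
    (askNeighbor u B).eval G = decide (∃ v ∈ B, G.Adj u v) := by
  simp only [askNeighbor, QueryTree.eval, bisAnswer, Finset.mem_singleton, exists_eq_left,
    Finset.mem_erase]
  congr 1
  refine propext ⟨fun ⟨v, h, h'⟩ => ⟨v, h.2, h'⟩, fun ⟨v, h, h'⟩ => ⟨v, ⟨h'.ne', h⟩, h'⟩⟩

@[simp] theorem cost_askNeighbor (u : Fin n) (B : Finset (Fin n)) :
    (askNeighbor u B).cost G = 1 := by
  simp [askNeighbor, QueryTree.cost]

end Listing

/-! ### Random levels -/

section Levels

variable {n : ℕ}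

/-- The type of levels. -/
abbrev Level (n : ℕ) : Type := Fin (bits n + 1)

/-- The test set of a level; level `0` tests against all vertices. -/
def levelSet (S : Finset (Level n × Fin n)) (j : Level n) : Finset (Fin n) :=
  Finset.univ.filter fun v => j = 0 ∨ (j, v) ∈ S

/-- The highest level whose test set contains a neighbour of `u`. -/
noncomputable def level (G : SimpleGraph (Fin n)) [DecidableRel G.Adj] (S : Finset (Level n × Fin n))
    (u : Fin n) : Level n :=
  Finset.univ.sup fun j => if ∃ v ∈ levelSet S j, G.Adj u v then j else ⊥

/-- Computes the level of a vertex. -/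
noncomputable def askLevel (S : Finset (Level n × Fin n)) (u : Fin n) : QueryTree n (Level n) :=
  QueryTree.supOver Finset.univ fun j =>
    (askNeighbor u (levelSet S j)).map fun b => if b then j else ⊥

/-- The inclusion rates of the test sets. -/
noncomputable def levelRate (x : Level n × Fin n) : ℝ := (1 / 2) ^ x.1.val

theorem levelRate_mem (x : Level n × Fin n) : 0 ≤ levelRate x ∧ levelRate x ≤ 1 :=
  ⟨by unfold levelRate; positivity, pow_le_one₀ (by norm_num) (by norm_num)⟩

variable (G : SimpleGraph (Fin n)) [DecidableRel G.Adj]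

@[simp] theorem eval_askLevel (S : Finset (Level n × Fin n)) (u : Fin n) :
    (askLevel S u).eval G = level G S u := by
  simp [askLevel, level]

@[simp] theorem cost_askLevel (S : Finset (Level n × Fin n)) (u : Fin n) :
    (askLevel S u).cost G = logSize n := by
  simp [askLevel, logSize]

theorem le_level {S : Finset (Level n × Fin n)} {u v : Fin n} {j : Level n}
    (hv : v ∈ levelSet S j) (h : G.Adj u v) : j ≤ level G S u := by
  have h1 := Finset.le_sup (f := fun j => if ∃ v ∈ levelSet S j, G.Adj u v then j else ⊥)
    (Finset.mem_univ j)
  rwa [if_pos ⟨v, hv, h⟩] at h1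

/-- The test set of level `0` is the whole vertex set, so for a vertex with a neighbour the supremum
is attained by a successful test rather than by the default value. -/
theorem exists_mem_levelSet_level (S : Finset (Level n × Fin n)) {u v : Fin n} (h : G.Adj u v) :
    ∃ w ∈ levelSet S (level G S u), G.Adj u w := by
  obtain ⟨j, -, hj⟩ := Finset.exists_mem_eq_sup (Finset.univ : Finset (Level n))
    Finset.univ_nonempty (fun j => if ∃ v ∈ levelSet S j, G.Adj u v then j else ⊥)
  change level G S u = _ at hj
  split_ifs at hj with hc
  · rwa [hj]
  · rw [hj]
    exact ⟨v, Finset.mem_filter.2 ⟨Finset.mem_univ v, Or.inl rfl⟩, h⟩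

theorem card_image_neighbor (u : Fin n) (j : Level n) :
    (((G.neighborFinset u).image fun v => (j, v)).card : ℝ) = degR G u := by
  rw [degR_eq_card, Finset.card_image_of_injective _ (Prod.mk_right_injective j)]

/-- A level of at most `j` forces the random set of index `j + 1` to miss all `d` neighbours of `u`,
which has probability `(1 - 2^{-(j+1)})^d ≤ 2^{j+1}/d`. So levels are unlikely to be much below the
logarithm of the degree. -/
theorem degR_mul_level_le (u : Fin n) (j : Level n) :
    degR G u * bernoulliSet levelRate (fun S => if level G S u ≤ j then 1 else 0) ≤
      2 ^ (j.val + 1) := by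
  by_cases hj : j.val < bits n
  · set i : Level n := ⟨j.val + 1, by omega⟩ with hi
    have hA : ∀ x ∈ (G.neighborFinset u).image fun v => (i, v),
        levelRate x = (1 / 2) ^ (j.val + 1) := by
      intro x hx
      obtain ⟨v, -, rfl⟩ := Finset.mem_image.1 hx
      rfl
    have h := bernoulliSet_disjoint_le levelRate_mem _ hA (by positivity)
      (pow_le_one₀ (by norm_num) (by norm_num))
    rw [card_image_neighbor] at h
    have h2 : bernoulliSet levelRate (fun S => if level G S u ≤ j then 1 else 0) ≤
        bernoulliSet levelRate (fun S =>
          if Disjoint ((G.neighborFinset u).image fun v => (i, v)) S then 1 else 0) := by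
      refine Expectation.mono _ fun S => ?_
      by_cases hl : level G S u ≤ j
      · have hd : Disjoint ((G.neighborFinset u).image fun v => (i, v)) S := by
          rw [Finset.disjoint_left]
          intro x hx hxS
          obtain ⟨v, hv, rfl⟩ := Finset.mem_image.1 hx
          have := le_level G (S := S) (j := i) (v := v) (by simp [levelSet, hxS])
            ((G.mem_neighborFinset u v).1 hv)
          have h3 : i ≤ j := this.trans hl
          rw [Fin.le_def, hi] at h3
          simp at h3
        simp [hl, hd]
      · simp only [hl, if_false]
        split_ifs <;> norm_num
    have h4 := mul_le_mul_of_nonneg_left h2 (degR_nonneg G u)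
    refine h4.trans ?_
    have h5 : (2 : ℝ) ^ (j.val + 1) * (1 / 2) ^ (j.val + 1) = 1 := by
      rw [← mul_pow]; norm_num
    have h6 : (0 : ℝ) < 2 ^ (j.val + 1) := by positivity
    set P := bernoulliSet levelRate (fun S =>
          if Disjoint ((G.neighborFinset u).image fun v => (i, v)) S then 1 else 0)
    calc degR G u * P = 2 ^ (j.val + 1) * (degR G u * (1 / 2) ^ (j.val + 1) * P) := by
          linear_combination (-degR G u * P) * h5
      _ ≤ 2 ^ (j.val + 1) * 1 := mul_le_mul_of_nonneg_left h h6.le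
      _ = _ := mul_one _
  -- At the top level there is no next test set; there the trivial bounds `deg u ≤ n ≤ 2 ^ bits n`
  -- suffice.
  · have h1 : bernoulliSet levelRate (fun S => if level G S u ≤ j then 1 else 0) ≤ 1 :=
      Expectation.le_const _ fun S => by split_ifs <;> norm_num
    have hj' : bits n ≤ j.val := by omega
    calc _ ≤ degR G u * 1 := mul_le_mul_of_nonneg_left h1 (degR_nonneg G u)
      _ ≤ n := by rw [mul_one]; exact degR_le G u
      _ ≤ 2 ^ bits n := by exact_mod_cast le_two_pow_bits n
      _ ≤ 2 ^ (j.val + 1) := pow_le_pow_right₀ (by norm_num) (by omega)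

/-- A union bound over the neighbours. Index `0` is separate because its test set is not random;
there a success means that the degree is at least one. -/
theorem neighbor_in_levelSet_le (u : Fin n) (j : Level n) :
    bernoulliSet levelRate (fun S => if ∃ v ∈ levelSet S j, G.Adj u v then 1 else 0) ≤
      degR G u * (1 / 2) ^ j.val := by
  by_cases hj : j = 0
  · subst hj
    refine Expectation.le_const _ fun S => ?_
    split_ifs with h
    · obtain ⟨v, -, h⟩ := h
      simpa using one_le_degR G h
    · simpa using degR_nonneg G u
  · have hA : ∀ x ∈ (G.neighborFinset u).image fun v => (j, v), levelRate x = (1 / 2) ^ j.val := by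
      intro x hx
      obtain ⟨v, -, rfl⟩ := Finset.mem_image.1 hx
      rfl
    have h := bernoulliSet_not_disjoint_le levelRate_mem _ hA
    rw [card_image_neighbor] at h
    refine le_trans (Expectation.mono _ fun S => ?_) h
    by_cases hc : ∃ v ∈ levelSet S j, G.Adj u v
    · obtain ⟨v, hv, hadj⟩ := hc
      have hd : ¬ Disjoint ((G.neighborFinset u).image fun v => (j, v)) S := by
        rw [Finset.not_disjoint_iff]
        refine ⟨(j, v), Finset.mem_image.2 ⟨v, (G.mem_neighborFinset u v).2 hadj, rfl⟩, ?_⟩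
        simpa [levelSet, hj] using hv
      rw [if_neg hd]
      split_ifs <;> norm_num
    · rw [if_neg hc]
      split_ifs <;> norm_num

/-- Bound `2^{-level}` by the sum of `2^{-j}` over all `j` at or above the level. By the tail bound
for low levels, each index contributes at most `2` after multiplication by the degree, and there are
`logSize n` indices. -/
theorem degR_mul_half_pow_level_le (u : Fin n) :
    degR G u * bernoulliSet levelRate (fun S => (1 / 2) ^ (level G S u).val) ≤ 2 * logSize n := by
  have h1 : bernoulliSet levelRate (fun S => (1 / 2 : ℝ) ^ (level G S u).val) ≤
      ∑ j : Level n, (1 / 2) ^ j.val *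
        bernoulliSet levelRate (fun S => if level G S u ≤ j then 1 else 0) := by
    simp only [← Expectation.const_mul]
    rw [← Expectation.sum]
    refine Expectation.mono _ fun S => ?_
    have := Finset.single_le_sum
      (f := fun j : Level n => (1 / 2 : ℝ) ^ j.val * if level G S u ≤ j then 1 else 0)
      (fun j _ => by split_ifs <;> simp) (Finset.mem_univ (level G S u))
    simpa using this
  calc _ ≤ degR G u * ∑ j : Level n, (1 / 2) ^ j.val *
        bernoulliSet levelRate (fun S => if level G S u ≤ j then 1 else 0) :=
        mul_le_mul_of_nonneg_left h1 (degR_nonneg G u)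
    _ = ∑ j : Level n, (1 / 2) ^ j.val * (degR G u *
        bernoulliSet levelRate (fun S => if level G S u ≤ j then 1 else 0)) := by
        rw [Finset.mul_sum]; exact Finset.sum_congr rfl fun j _ => by ring
    _ ≤ ∑ _j : Level n, 2 := by
        refine Finset.sum_le_sum fun j _ => ?_
        refine (mul_le_mul_of_nonneg_left (degR_mul_level_le G u j) (by positivity)).trans_eq ?_
        rw [pow_succ, ← mul_assoc, ← mul_pow]; norm_num
    _ = 2 * logSize n := by simp [logSize]; ring

/-- Let `j` be the level of `v`. Then `u` has level at most `j` and `v` has a neighbour in the test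
set of `j`. The two events have probabilities at most `2^{j+1}/d_u` and `d_v 2^{-j}`, so their
intersection has at most the geometric mean, in which `j` cancels. No independence is needed; the
events are summed over `j`. -/
theorem level_le_level_le {u v : Fin n} (h : G.Adj u v) :
    bernoulliSet levelRate (fun S => if level G S u ≤ level G S v then 1 else 0) ≤
      logSize n * √(2 * degR G v / degR G u) := by
  have hu : 0 < degR G u := zero_lt_one.trans_le (one_le_degR G h)
  have h1 : bernoulliSet levelRate (fun S => if level G S u ≤ level G S v then (1 : ℝ) else 0) ≤
      bernoulliSet levelRate (fun S => ∑ j : Level n,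
        (if level G S u ≤ j then 1 else 0) *
          if ∃ w ∈ levelSet S j, G.Adj v w then 1 else 0) := by
    refine Expectation.mono _ fun S => ?_
    have := Finset.single_le_sum
      (f := fun j : Level n => (if level G S u ≤ j then (1 : ℝ) else 0) *
          if ∃ w ∈ levelSet S j, G.Adj v w then 1 else 0)
      (fun j _ => by split_ifs <;> simp) (Finset.mem_univ (level G S v))
    rw [if_pos (exists_mem_levelSet_level G S h.symm), mul_one] at this
    exact this
  refine h1.trans ?_
  rw [Expectation.sum]
  calc _ ≤ ∑ _j : Level n, √(2 * degR G v / degR G u) := by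
        refine Finset.sum_le_sum fun j _ => Real.le_sqrt_of_sq_le ?_
        set x := bernoulliSet levelRate (fun S => (if level G S u ≤ j then (1 : ℝ) else 0) *
          if ∃ w ∈ levelSet S j, G.Adj v w then 1 else 0)
        have hx0 : 0 ≤ x := Expectation.nonneg _ fun S => by split_ifs <;> simp
        have hx1 : x ≤ 2 ^ (j.val + 1) / degR G u := by
          rw [le_div_iff₀ hu, mul_comm]
          refine le_trans (mul_le_mul_of_nonneg_left (Expectation.mono _ fun S => ?_) hu.le)
            (degR_mul_level_le G u j)
          split_ifs <;> simp
        have hx2 : x ≤ degR G v * (1 / 2) ^ j.val := by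
          refine le_trans (Expectation.mono _ fun S => ?_) (neighbor_in_levelSet_le G v j)
          split_ifs <;> simp
        calc x ^ 2 = x * x := sq x
          _ ≤ 2 ^ (j.val + 1) / degR G u * (degR G v * (1 / 2) ^ j.val) :=
            mul_le_mul hx1 hx2 hx0 (by positivity)
          _ = (2 * (1 / 2)) ^ j.val * (2 * degR G v / degR G u) := by rw [mul_pow]; ring
          _ = 2 * degR G v / degR G u := by norm_num
    _ = _ := by simp [logSize]

/-! ### Orientation by level and expected out-degrees. -/

/-- The order of the vertices by level, ties being broken by the vertex names. -/
def precedes (S : Finset (Level n × Fin n)) (u v : Fin n) : Prop :=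
  level G S u < level G S v ∨ level G S u = level G S v ∧ u < v

noncomputable instance (S : Finset (Level n × Fin n)) : DecidableRel (precedes G S) := fun u v => by
  unfold precedes; infer_instance

/-- The indicator of the order by level. -/
noncomputable def precInd (S : Finset (Level n × Fin n)) (u v : Fin n) : ℝ :=
  if precedes G S u v then 1 else 0

theorem precInd_nonneg (S : Finset (Level n × Fin n)) (u v : Fin n) : 0 ≤ precInd G S u v := by
  unfold precInd; split_ifs <;> norm_num

theorem precInd_le_one (S : Finset (Level n × Fin n)) (u v : Fin n) : precInd G S u v ≤ 1 := by
  unfold precInd; split_ifs <;> norm_num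

/-- The number of neighbours of `u` above `u`. -/
noncomputable def outDeg (S : Finset (Level n × Fin n)) (u : Fin n) : ℝ :=
  ∑ v, adjInd G u v * precInd G S u v

/-- An edge can be directed from `u` to `v` only if the level of `u` does not exceed that of `v`. By
Cauchy–Schwarz over the `d_u` neighbours, the sum of `√(2 d_v/d_u)` is at most `√(d_u · 4m/d_u) =
2√m`, since all degrees sum to `2m`. -/
theorem expect_outDeg_le (u : Fin n) :
    bernoulliSet levelRate (fun S => outDeg G S u) ≤ 2 * logSize n * √(edgeCount G) := by
  have hL := one_le_logSize n
  have h1 : bernoulliSet levelRate (fun S => outDeg G S u) ≤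
      logSize n * ∑ v, adjInd G u v * √(2 * degR G v / degR G u) := by
    simp only [outDeg]
    rw [Expectation.sum, Finset.mul_sum]
    refine Finset.sum_le_sum fun v _ => ?_
    rw [Expectation.const_mul]
    by_cases h : G.Adj u v
    · rw [adjInd, if_pos h, one_mul, one_mul]
      refine le_trans (Expectation.mono _ fun S => ?_) (level_le_level_le G h)
      unfold precInd
      by_cases hp : precedes G S u v
      · have : level G S u ≤ level G S v := by
          rcases hp with hp | hp
          · exact hp.le
          · exact hp.1.le
        rw [if_pos this, if_pos hp]
      · simp only [hp, if_false]
        split_ifs <;> norm_num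
    · simp [adjInd, h]
  have h2 : ∑ v, adjInd G u v * √(2 * degR G v / degR G u) ≤ 2 * √(edgeCount G) := by
    rcases (degR_nonneg G u).eq_or_lt with hu | hu
    · rw [Finset.sum_eq_zero]
      · positivity
      · intro v _
        have := adjInd_le_degR G u v
        rw [← hu] at this
        rw [le_antisymm this (adjInd_nonneg G u v), zero_mul]
    · have hcs := Finset.sum_mul_sq_le_sq_mul_sq Finset.univ (adjInd G u)
        (fun v => √(2 * degR G v / degR G u))
      have e1 : ∑ v, adjInd G u v ^ 2 = degR G u := by simp only [sq, adjInd_mul_self]; rfl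
      have e2 : ∑ v, √(2 * degR G v / degR G u) ^ 2 = 4 * edgeCount G / degR G u := by
        have : ∀ v, √(2 * degR G v / degR G u) ^ 2 = degR G v * (2 / degR G u) := fun v => by
          rw [Real.sq_sqrt (div_nonneg (mul_nonneg zero_le_two (degR_nonneg G v)) hu.le)]; ring
        simp only [this]
        rw [← Finset.sum_mul, sum_degR]; ring
      rw [e1, e2, mul_div_cancel₀ _ hu.ne'] at hcs
      refine (Real.le_sqrt_of_sq_le hcs).trans_eq ?_
      rw [Real.sqrt_mul (by norm_num), show (4 : ℝ) = 2 ^ 2 by norm_num,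
        Real.sqrt_sq (by norm_num)]
  calc _ ≤ _ := h1
    _ ≤ logSize n * (2 * √(edgeCount G)) := mul_le_mul_of_nonneg_left h2 (by linarith)
    _ = _ := by ring

/-! ### Uniform sampling of directed edges -/

/-- The rate at which the neighbours of a vertex of level `i` are sampled. -/
noncomputable def nbrRate (p : ℝ) (i : Level n) : ℝ := max ((1 / 2) ^ i.val) p

/-- The rate at which the vertices of level `i` are sampled. -/
noncomputable def vtxRate (p : ℝ) (i : Level n) : ℝ := p / nbrRate p i

variable {p : ℝ}

theorem nbrRate_pos (i : Level n) : 0 < nbrRate p i :=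
  lt_of_lt_of_le (by positivity) (le_max_left _ _)

theorem nbrRate_mem (hp1 : p ≤ 1) (i : Level n) : 0 ≤ nbrRate p i ∧ nbrRate p i ≤ 1 :=
  ⟨(nbrRate_pos i).le, max_le (pow_le_one₀ (by norm_num) (by norm_num)) hp1⟩

theorem vtxRate_mem (hp0 : 0 ≤ p) (i : Level n) : 0 ≤ vtxRate p i ∧ vtxRate p i ≤ 1 :=
  ⟨div_nonneg hp0 (nbrRate_pos i).le, (div_le_one (nbrRate_pos i)).2 (le_max_right _ _)⟩

theorem vtxRate_mul_nbrRate (i : Level n) : vtxRate p i * nbrRate p i = p :=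
  div_mul_cancel₀ _ (nbrRate_pos i).ne'

theorem vtxRate_mul_half_pow_le (hp0 : 0 ≤ p) (i : Level n) :
    vtxRate p i * (1 / 2) ^ i.val ≤ p := by
  calc _ ≤ vtxRate p i * nbrRate p i :=
        mul_le_mul_of_nonneg_left (le_max_left _ _) (vtxRate_mem hp0 i).1
    _ = p := vtxRate_mul_nbrRate i

/-- The left side is `max(2^{-i} - p, 0)`. This is the factor through which the randomness of the
vertex stage enters the variance; it vanishes when `p ≥ 2^{-i}`. -/
theorem nbrRate_mul_sub_le (hp0 : 0 ≤ p) (i : Level n) :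
    nbrRate p i * (1 - vtxRate p i) ≤ (1 / 2) ^ i.val := by
  have h : nbrRate p i * (1 - vtxRate p i) = nbrRate p i - p := by
    linear_combination -(vtxRate_mul_nbrRate (p := p) i)
  rw [h, nbrRate, sub_le_iff_le_add]
  have : (0 : ℝ) ≤ (1 / 2) ^ i.val := by positivity
  exact max_le (by linarith) (by linarith)

/-- The vertices sampled for level `i`. -/
def vtxSet (R : Finset (Level n × Fin n)) (i : Level n) : Finset (Fin n) :=
  Finset.univ.filter fun u => (i, u) ∈ R

/-- The potential neighbours sampled for `u` at level `i`. -/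
def nbrSet (Q : Finset (Level n × Fin n × Fin n)) (i : Level n) (u : Fin n) : Finset (Fin n) :=
  Finset.univ.filter fun v => (i, u, v) ∈ Q

/-- The sum of `φ u v` over the sampled directed edges `(u, v)`. -/
noncomputable def edgeSum (S R : Finset (Level n × Fin n)) (Q : Finset (Level n × Fin n × Fin n))
    (φ : Fin n → Fin n → QueryTree n ℝ) : QueryTree n ℝ :=
  .sumOver Finset.univ fun i : Level n =>
    (listEdges (vtxSet R i) (levelSet S i)).bind fun D =>
      .sumOver (D.image Prod.fst) fun u =>
        (askLevel S u).bind fun l =>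
          -- Edges into the test set of `i` reveal every sampled vertex of level `i`, but also
          -- vertices of higher level and unlucky lower ones with no such role here; comparing with
          -- the true level makes each vertex count at exactly one index.
          if l = i then
            (listEdges {u} (nbrSet Q i u)).bind fun D' => .sumOver (D'.image Prod.snd) fun v => φ u v
          else .ret 0

/-- The indicator that `u` is sampled. -/
noncomputable def vtxInd (S R : Finset (Level n × Fin n)) (u : Fin n) : ℝ :=
  if (level G S u, u) ∈ R then 1 else 0

/-- The indicator that `v` is sampled as a potential neighbour of `u`. -/
noncomputable def nbrInd (S : Finset (Level n × Fin n))
    (Q : Finset (Level n × Fin n × Fin n)) (u v : Fin n) : ℝ :=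
  if (level G S u, u, v) ∈ Q then 1 else 0

theorem vtxInd_nonneg (S R : Finset (Level n × Fin n)) (u : Fin n) : 0 ≤ vtxInd G S R u := by
  unfold vtxInd; split_ifs <;> norm_num

theorem nbrInd_nonneg (S : Finset (Level n × Fin n)) (Q : Finset (Level n × Fin n × Fin n))
    (u v : Fin n) : 0 ≤ nbrInd G S Q u v := by
  unfold nbrInd; split_ifs <;> norm_num

theorem sum_image_snd_edgesIn (u : Fin n) (B : Finset (Fin n)) (F : Fin n → ℝ) :
    ∑ v ∈ (edgesIn G {u} B).image Prod.snd, F v =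
      ∑ v, adjInd G u v * (if v ∈ B then 1 else 0) * F v := by
  rw [← Finset.sum_subset (Finset.subset_univ ((edgesIn G {u} B).image Prod.snd))]
  · refine Finset.sum_congr rfl fun v hv => ?_
    simp only [Finset.mem_image, mem_edgesIn, Finset.mem_singleton, Prod.exists] at hv
    obtain ⟨a, b, ⟨rfl, hb, hab⟩, rfl⟩ := hv
    simp [adjInd, hab, hb]
  · intro v _ hv
    by_cases h1 : G.Adj u v
    · by_cases h2 : v ∈ B
      · exact absurd (Finset.mem_image.2 ⟨(u, v), (mem_edgesIn G).2 ⟨by simp, h2, h1⟩, rfl⟩) hv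
      · simp [h2]
    · simp [adjInd, h1]

/-- A non-isolated vertex of level `i` has a neighbour in the test set of `i`, so it occurs in the
listed edges as soon as it is sampled. The nested loops therefore visit each selected directed edge
exactly once, with isolated vertices contributing nothing. -/
theorem sum_sampled (S R : Finset (Level n × Fin n)) (Q : Finset (Level n × Fin n × Fin n))
    (F : Fin n → Fin n → ℝ) :
    ∑ i : Level n, ∑ u ∈ (edgesIn G (vtxSet R i) (levelSet S i)).image Prod.fst,
      (if level G S u = i then ∑ v ∈ (edgesIn G {u} (nbrSet Q i u)).image Prod.snd, F u v else 0) =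
    ∑ u, ∑ v, adjInd G u v * vtxInd G S R u * nbrInd G S Q u v * F u v := by
  have h1 : ∀ i : Level n, ∑ u ∈ (edgesIn G (vtxSet R i) (levelSet S i)).image Prod.fst,
      (if level G S u = i then
        ∑ v ∈ (edgesIn G {u} (nbrSet Q i u)).image Prod.snd, F u v else 0) =
      ∑ u, if level G S u = i then
        ∑ v, adjInd G u v * vtxInd G S R u * nbrInd G S Q u v * F u v else 0 := by
    intro i
    rw [← Finset.sum_subset (Finset.subset_univ
      ((edgesIn G (vtxSet R i) (levelSet S i)).image Prod.fst))]
    · refine Finset.sum_congr rfl fun u hu => ?_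
      split_ifs with hl
      · rw [sum_image_snd_edgesIn]
        refine Finset.sum_congr rfl fun v _ => ?_
        obtain ⟨e, he, rfl⟩ := Finset.mem_image.1 hu
        have hR : (level G S e.1, e.1) ∈ R := by
          simpa [vtxSet, hl] using ((mem_edgesIn G).1 he).1
        simp [vtxInd, nbrInd, nbrSet, hl, hl ▸ hR]
      · rfl
    · intro u _ hu
      split_ifs with hl
      · refine Finset.sum_eq_zero fun v _ => ?_
        by_cases hadj : G.Adj u v
        · by_cases hR : (level G S u, u) ∈ R
          · obtain ⟨w, hw, huw⟩ := exists_mem_levelSet_level G S hadj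
            refine absurd (Finset.mem_image.2 ⟨(u, w), (mem_edgesIn G).2 ⟨?_, hl ▸ hw, huw⟩, rfl⟩) hu
            simpa [vtxSet, ← hl] using hR
          · simp [vtxInd, hR]
        · simp [adjInd, hadj]
      · rfl
  simp only [h1]
  rw [Finset.sum_comm]
  exact Finset.sum_congr rfl fun u _ => by simp

theorem eval_edgeSum (S R : Finset (Level n × Fin n)) (Q : Finset (Level n × Fin n × Fin n))
    (φ : Fin n → Fin n → QueryTree n ℝ) :
    (edgeSum S R Q φ).eval G =
      ∑ u, ∑ v, adjInd G u v * vtxInd G S R u * nbrInd G S Q u v * (φ u v).eval G := by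
  rw [← sum_sampled]
  simp only [edgeSum, QueryTree.eval_sumOver, QueryTree.eval_bind, eval_listEdges, eval_askLevel]
  refine Finset.sum_congr rfl fun i _ => Finset.sum_congr rfl fun u _ => ?_
  split_ifs <;> simp

/-- Each edge listed for a level is charged three times `listFactor n`: once for listing it, and
twice for its tail, covering the level computation and the fixed part of listing the sampled
neighbours. -/
theorem cost_edgeSum_le (S R : Finset (Level n × Fin n)) (Q : Finset (Level n × Fin n × Fin n))
    (φ : Fin n → Fin n → QueryTree n ℝ) :
    (edgeSum S R Q φ).cost G ≤
      ∑ i : Level n, (listFactor n + 3 * listFactor n *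
        (edgesIn G (vtxSet R i) (levelSet S i)).card) +
      ∑ u, ∑ v, adjInd G u v * vtxInd G S R u * nbrInd G S Q u v *
        (listFactor n + (φ u v).cost G) := by
  have hΛ := one_le_listFactor n
  have hLΛ : logSize n ≤ listFactor n := by
    have := one_le_logSize n
    unfold listFactor; nlinarith
  rw [← sum_sampled, ← Finset.sum_add_distrib]
  simp only [edgeSum, QueryTree.cost_sumOver, QueryTree.cost_bind, eval_listEdges, eval_askLevel,
    cost_askLevel]
  refine Finset.sum_le_sum fun i _ => ?_
  set D := edgesIn G (vtxSet R i) (levelSet S i) with hD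
  have hcard : ((D.image Prod.fst).card : ℝ) ≤ D.card := by exact_mod_cast Finset.card_image_le
  have h1 : ∑ u ∈ D.image Prod.fst, (logSize n + QueryTree.cost G
      (if level G S u = i then
        (listEdges {u} (nbrSet Q i u)).bind fun D' => .sumOver (D'.image Prod.snd) fun v => φ u v
      else .ret 0)) ≤
      ∑ u ∈ D.image Prod.fst, (2 * listFactor n + if level G S u = i then
        ∑ v ∈ (edgesIn G {u} (nbrSet Q i u)).image Prod.snd, (listFactor n + (φ u v).cost G)
        else 0) := by
    refine Finset.sum_le_sum fun u _ => ?_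
    split_ifs with hl
    · simp only [QueryTree.cost_bind, eval_listEdges, QueryTree.cost_sumOver]
      have h2 := cost_listEdges G {u} (nbrSet Q i u)
      -- With a single tail, an edge is determined by its head, so the list cost can be distributed
      -- over the heads.
      have h3 : (edgesIn G {u} (nbrSet Q i u)).card =
          ((edgesIn G {u} (nbrSet Q i u)).image Prod.snd).card := by
        rw [Finset.card_image_of_injOn]
        intro a ha b hb hab
        have ha' := ((mem_edgesIn G).1 (Finset.mem_coe.1 ha)).1
        have hb' := ((mem_edgesIn G).1 (Finset.mem_coe.1 hb)).1
        rw [Finset.mem_singleton] at ha' hb'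
        exact Prod.ext (ha'.trans hb'.symm) hab
      rw [h3] at h2
      rw [Finset.sum_add_distrib, Finset.sum_const, nsmul_eq_mul]
      linarith
    · simp only [QueryTree.cost_ret]; linarith
  rw [Finset.sum_add_distrib (f := fun _ => 2 * listFactor n), Finset.sum_const,
    nsmul_eq_mul] at h1
  have h4 := cost_listEdges G (vtxSet R i) (levelSet S i)
  rw [← hD] at h4
  have h5 := mul_le_mul_of_nonneg_right hcard (by linarith : (0 : ℝ) ≤ 2 * listFactor n)
  linarith

/-- The sum of `φ u v` over a random set of directed edges `(u, v)`, each of which is present with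
probability `p`. -/
noncomputable def sampleEdges (p : ℝ) (φ : Fin n → Fin n → QueryTree n ℝ) : RandTree n ℝ :=
  (RandTree.bern (levelRate (n := n))).bind fun S =>
  (RandTree.bern fun x : Level n × Fin n => vtxRate p x.1).bind fun R =>
  (RandTree.bern fun x : Level n × Fin n × Fin n => nbrRate p x.1).bind fun Q =>
  RandTree.ofQueryTree (edgeSum S R Q φ)

/-- For any fixed test sets, the vertex and neighbour stages are independent and their rates
multiply to `p` at every level, so the levels do not affect the mean. -/
theorem expect_nbrInd_vtxInd (hp0 : 0 ≤ p) (hp1 : p ≤ 1) (S : Finset (Level n × Fin n))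
    (F : Fin n → Fin n → ℝ) :
    (bernoulliSet fun x : Level n × Fin n => vtxRate p x.1) (fun R =>
      (bernoulliSet fun x : Level n × Fin n × Fin n => nbrRate p x.1) (fun Q =>
        ∑ u, ∑ v, adjInd G u v * vtxInd G S R u * nbrInd G S Q u v * F u v)) =
    p * ∑ u, ∑ v, adjInd G u v * F u v := by
  have hV : ∀ u, (bernoulliSet fun x : Level n × Fin n => vtxRate p x.1)
      (fun R => vtxInd G S R u) = vtxRate p (level G S u) := fun u =>
    bernoulliSet_mem (r := fun x : Level n × Fin n => vtxRate p x.1)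
      (fun x => vtxRate_mem hp0 x.1) (level G S u, u)
  have hN : ∀ u v, (bernoulliSet fun x : Level n × Fin n × Fin n => nbrRate p x.1)
      (fun Q => nbrInd G S Q u v) = nbrRate p (level G S u) := fun u v =>
    bernoulliSet_mem (r := fun x : Level n × Fin n × Fin n => nbrRate p x.1)
      (fun x => nbrRate_mem hp1 x.1) (level G S u, u, v)
  simp only [Expectation.sum, Expectation.mul_const, Expectation.const_mul, hV, hN,
    Finset.mul_sum]
  refine Finset.sum_congr rfl fun u _ => Finset.sum_congr rfl fun v _ => ?_
  linear_combination (adjInd G u v * F u v) * vtxRate_mul_nbrRate (p := p) (level G S u)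

/-- The mean of the sum over the sampled edges. -/
theorem exp_sampleEdges (hp0 : 0 ≤ p) (hp1 : p ≤ 1) (φ : Fin n → Fin n → QueryTree n ℝ) :
    (sampleEdges p φ).exp G (fun x => x) = p * ∑ u, ∑ v, adjInd G u v * (φ u v).eval G := by
  simp only [sampleEdges, RandTree.exp_bind, RandTree.exp_bern, RandTree.exp_ofQueryTree,
    eval_edgeSum, expect_nbrInd_vtxInd G hp0 hp1, Expectation.const]

/-- Second moment over the neighbour stage alone: the conditional mean squared plus the variance of
independent memberships, of which only `nbrRate (1 - nbrRate) ≤ nbrRate` is used. -/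
theorem expect_sq_nbrInd (hp1 : p ≤ 1) (S R : Finset (Level n × Fin n))
    (F : Fin n → Fin n → ℝ) :
    (bernoulliSet fun x : Level n × Fin n × Fin n => nbrRate p x.1) (fun Q =>
        (∑ u, ∑ v, adjInd G u v * vtxInd G S R u * nbrInd G S Q u v * F u v) ^ 2) ≤
    (∑ u, vtxInd G S R u * (nbrRate p (level G S u) * ∑ v, adjInd G u v * F u v)) ^ 2 +
      ∑ u, vtxInd G S R u * (nbrRate p (level G S u) * ∑ v, adjInd G u v * F u v ^ 2) := by
  -- The random set has a coordinate for every possible level of the tail; the coefficients are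
  -- supported on the actual level.
  set c : Level n × Fin n × Fin n → ℝ := fun x =>
    if x.1 = level G S x.2.1 then adjInd G x.2.1 x.2.2 * vtxInd G S R x.2.1 * F x.2.1 x.2.2 else 0
    with hc
  have hsum : ∀ g : Level n × Fin n × Fin n → ℝ, (∀ x, x.1 ≠ level G S x.2.1 → g x = 0) →
      ∑ x, g x = ∑ u, ∑ v, g (level G S u, u, v) := by
    intro g hg
    rw [Fintype.sum_prod_type, Finset.sum_comm, Fintype.sum_prod_type]
    refine Finset.sum_congr rfl fun u _ => Finset.sum_congr rfl fun v _ => ?_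
    rw [Finset.sum_eq_single (level G S u)]
    · intro i _ hi
      exact hg (i, u, v) hi
    · simp
  have h := bernoulliSet_sum_sq (r := fun x : Level n × Fin n × Fin n => nbrRate p x.1)
      (fun x => nbrRate_mem hp1 x.1) c
  have e1 : ∀ Q : Finset (Level n × Fin n × Fin n), (∑ x, c x * if x ∈ Q then (1 : ℝ) else 0) =
      ∑ u, ∑ v, adjInd G u v * vtxInd G S R u * nbrInd G S Q u v * F u v := by
    intro Q
    rw [hsum]
    · refine Finset.sum_congr rfl fun u _ => Finset.sum_congr rfl fun v _ => ?_
      simp only [hc, if_true, nbrInd]; ring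
    · intro x hx; simp [hc, hx]
  simp only [e1] at h
  rw [h, hsum _ (by intro x hx; simp [hc, hx]), hsum _ (by intro x hx; simp [hc, hx])]
  refine add_le_add (le_of_eq ?_) ?_
  · congr 1
    refine Finset.sum_congr rfl fun u _ => ?_
    rw [Finset.mul_sum, Finset.mul_sum]
    refine Finset.sum_congr rfl fun v _ => ?_
    simp only [hc, if_true]; ring
  · refine Finset.sum_le_sum fun u _ => ?_
    rw [Finset.mul_sum, Finset.mul_sum]
    refine Finset.sum_le_sum fun v _ => ?_
    simp only [hc, if_true]
    have hA := adjInd_mul_self G u v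
    have hV : vtxInd G S R u * vtxInd G S R u = vtxInd G S R u := by
      unfold vtxInd; split_ifs <;> norm_num
    have h0 : 0 ≤ adjInd G u v * vtxInd G S R u * F u v ^ 2 * nbrRate p (level G S u) :=
      mul_nonneg (mul_nonneg (mul_nonneg (adjInd_nonneg G u v) (vtxInd_nonneg G S R u))
        (sq_nonneg _)) (nbrRate_pos _).le
    have h1 : (adjInd G u v * vtxInd G S R u * F u v) ^ 2 =
        adjInd G u v * vtxInd G S R u * F u v ^ 2 := by
      linear_combination (vtxInd G S R u ^ 2 * F u v ^ 2) * hA + adjInd G u v * F u v ^ 2 * hV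
    rw [h1]
    have h2 := mul_nonneg h0 (nbrRate_pos (p := p) (level G S u)).le
    nlinarith

/-- The second moment of the sum over the sampled edges. -/
theorem exp_sampleEdges_sq (hp0 : 0 ≤ p) (hp1 : p ≤ 1) (φ : Fin n → Fin n → QueryTree n ℝ) :
    (sampleEdges p φ).exp G (fun x => x ^ 2) ≤
      p ^ 2 * (∑ u, ∑ v, adjInd G u v * (φ u v).eval G) ^ 2 +
      3 * logSize n * p * ∑ u, ∑ v, adjInd G u v * (φ u v).eval G ^ 2 := by
  set F : Fin n → Fin n → ℝ := fun u v => (φ u v).eval G with hF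
  have hL := one_le_logSize n
  have hR : ∀ S : Finset (Level n × Fin n),
      (bernoulliSet fun x : Level n × Fin n => vtxRate p x.1) (fun R =>
      (bernoulliSet fun x : Level n × Fin n × Fin n => nbrRate p x.1) (fun Q =>
        (∑ u, ∑ v, adjInd G u v * vtxInd G S R u * nbrInd G S Q u v * F u v) ^ 2)) ≤
      p ^ 2 * (∑ u, ∑ v, adjInd G u v * F u v) ^ 2 +
        ∑ u, p * (degR G u * (1 / 2) ^ (level G S u).val + 1) * ∑ v, adjInd G u v * F u v ^ 2 := by
    intro S
    refine (Expectation.mono _ fun R => expect_sq_nbrInd G hp1 S R F).trans ?_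
    set c : Level n × Fin n → ℝ := fun x => if x.1 = level G S x.2 then
      nbrRate p (level G S x.2) * ∑ v, adjInd G x.2 v * F x.2 v else 0 with hc
    have hsum : ∀ g : Level n × Fin n → ℝ, (∀ x, x.1 ≠ level G S x.2 → g x = 0) →
        ∑ x, g x = ∑ u, g (level G S u, u) := by
      intro g hg
      rw [Fintype.sum_prod_type, Finset.sum_comm]
      refine Finset.sum_congr rfl fun u _ => ?_
      rw [Finset.sum_eq_single (level G S u)]
      · intro i _ hi
        exact hg (i, u) hi
      · simp
    have h := bernoulliSet_sum_sq (r := fun x : Level n × Fin n => vtxRate p x.1)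
      (fun x => vtxRate_mem hp0 x.1) c
    have e1 : ∀ R : Finset (Level n × Fin n), (∑ x, c x * if x ∈ R then (1 : ℝ) else 0) =
        ∑ u, vtxInd G S R u * (nbrRate p (level G S u) * ∑ v, adjInd G u v * F u v) := by
      intro R
      rw [hsum]
      · refine Finset.sum_congr rfl fun u _ => ?_
        simp only [hc, if_true, vtxInd]; ring
      · intro x hx; simp [hc, hx]
    simp only [e1] at h
    have hV : ∀ u, (bernoulliSet fun x : Level n × Fin n => vtxRate p x.1)
        (fun R => vtxInd G S R u) = vtxRate p (level G S u) := fun u =>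
      bernoulliSet_mem (r := fun x : Level n × Fin n => vtxRate p x.1)
        (fun x => vtxRate_mem hp0 x.1) (level G S u, u)
    rw [Expectation.add, h, hsum _ (by intro x hx; simp [hc, hx]),
      hsum _ (by intro x hx; simp [hc, hx])]
    simp only [Expectation.sum, Expectation.mul_const, hV]
    rw [add_assoc, ← Finset.sum_add_distrib]
    refine add_le_add (le_of_eq ?_) (Finset.sum_le_sum fun u _ => ?_)
    · rw [← mul_pow, Finset.mul_sum]
      congr 1
      refine Finset.sum_congr rfl fun u _ => ?_
      simp only [hc, if_true]
      linear_combination (∑ v, adjInd G u v * F u v) *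
        vtxRate_mul_nbrRate (p := p) (level G S u)
    · simp only [hc, if_true]
      -- The vertex stage correlates all edges at `u`. Cauchy–Schwarz turns the square of the sum at
      -- `u` into the degree times a sum of squares; the degree will be cancelled by `2^{-level}`.
      have hcs : (∑ v, adjInd G u v * F u v) ^ 2 ≤
          degR G u * ∑ v, adjInd G u v * F u v ^ 2 := by
        have h1 := Finset.sum_mul_sq_le_sq_mul_sq Finset.univ (adjInd G u)
          (fun v => adjInd G u v * F u v)
        have e2 : ∀ v, adjInd G u v * (adjInd G u v * F u v) = adjInd G u v * F u v := fun v => by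
          linear_combination F u v * adjInd_mul_self G u v
        have e3 : ∑ v, adjInd G u v ^ 2 = degR G u := by simp only [sq, adjInd_mul_self]; rfl
        have e4 : ∀ v, (adjInd G u v * F u v) ^ 2 = adjInd G u v * F u v ^ 2 := fun v => by
          linear_combination F u v ^ 2 * adjInd_mul_self G u v
        simpa only [e2, e3, e4] using h1
      have hvn := vtxRate_mul_nbrRate (p := p) (level G S u)
      have hle := nbrRate_mul_sub_le hp0 (level G S u)
      set a := vtxRate p (level G S u)
      set b := nbrRate p (level G S u)
      set x := ∑ v, adjInd G u v * F u v
      set y := ∑ v, adjInd G u v * F u v ^ 2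
      have k1 : (b * x) ^ 2 * (a * (1 - a)) = p * (b * (1 - a)) * x ^ 2 := by
        linear_combination (b * (1 - a) * x ^ 2) * hvn
      have k2 : a * (b * y) = p * y := by linear_combination y * hvn
      rw [k1, k2]
      have k3 : p * (b * (1 - a)) * x ^ 2 ≤ p * (1 / 2) ^ (level G S u).val * x ^ 2 :=
        mul_le_mul_of_nonneg_right (mul_le_mul_of_nonneg_left hle hp0) (sq_nonneg _)
      have k4 : p * (1 / 2) ^ (level G S u).val * x ^ 2 ≤
          p * (1 / 2) ^ (level G S u).val * (degR G u * y) :=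
        mul_le_mul_of_nonneg_left hcs (by positivity)
      nlinarith
  simp only [sampleEdges, RandTree.exp_bind, RandTree.exp_bern, RandTree.exp_ofQueryTree,
    eval_edgeSum]
  refine (Expectation.mono _ hR).trans ?_
  rw [Expectation.add, Expectation.const, Expectation.sum]
  simp only [Expectation.mul_const, Expectation.const_mul, Expectation.add, Expectation.const]
  rw [Finset.mul_sum]
  refine add_le_add le_rfl (Finset.sum_le_sum fun u _ => ?_)
  -- On average over the test sets, `deg u · 2^{-level} + 1` is at most `2L + 1 ≤ 3L`, with `L =
  -- logSize n`.
  have h1 := degR_mul_half_pow_level_le G u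
  have h2 : 0 ≤ ∑ v, adjInd G u v * F u v ^ 2 := Finset.sum_nonneg fun v _ =>
    mul_nonneg (adjInd_nonneg G u v) (sq_nonneg _)
  refine mul_le_mul_of_nonneg_right ?_ h2
  nlinarith

/-- Tails and test sets are drawn independently, so a directed edge is listed with probability at
most `vtxRate p i · 2^{-i} ≤ p`, whatever the true levels are. -/
theorem expect_card_edgesIn_le (hp0 : 0 ≤ p) (i : Level n) :
    bernoulliSet levelRate (fun S =>
      (bernoulliSet fun x : Level n × Fin n => vtxRate p x.1) (fun R =>
        ((edgesIn G (vtxSet R i) (levelSet S i)).card : ℝ))) ≤ 2 * edgeCount G * p := by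
  have hV : ∀ u, (bernoulliSet fun x : Level n × Fin n => vtxRate p x.1)
      (fun R => if u ∈ vtxSet R i then 1 else 0) = vtxRate p i := fun u => by
    have := bernoulliSet_mem (r := fun x : Level n × Fin n => vtxRate p x.1)
      (fun x => vtxRate_mem hp0 x.1) (i, u)
    simpa [vtxSet] using this
  have hS : ∀ v, bernoulliSet levelRate (fun S => if v ∈ levelSet S i then (1 : ℝ) else 0) ≤
      (1 / 2) ^ i.val := fun v => by
    by_cases hi : i = 0
    · subst hi
      refine Expectation.le_const _ fun S => ?_
      split_ifs <;> simp
    · have := bernoulliSet_mem levelRate_mem (i, v)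
      simp only [levelSet, hi, false_or, Finset.mem_filter, Finset.mem_univ, true_and]
      exact this.le
  simp only [card_edgesIn, Expectation.sum, Expectation.const_mul, Expectation.mul_const, hV]
  have h1 : ∀ u v, adjInd G u v * (vtxRate p i *
      bernoulliSet levelRate (fun S => if v ∈ levelSet S i then (1 : ℝ) else 0)) ≤
      adjInd G u v * p := fun u v => by
    refine mul_le_mul_of_nonneg_left ?_ (adjInd_nonneg G u v)
    exact (mul_le_mul_of_nonneg_left (hS v) (vtxRate_mem hp0 i).1).trans
      (vtxRate_mul_half_pow_le hp0 i)
  refine (Finset.sum_le_sum fun u _ => Finset.sum_le_sum fun v _ => h1 u v).trans_eq ?_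
  simp only [← Finset.sum_mul]
  rw [← sum_degR]
  rfl

/-- The expected number of queries made in sampling edges. -/
theorem cost_sampleEdges_le (hp0 : 0 ≤ p) (hp1 : p ≤ 1) (φ : Fin n → Fin n → QueryTree n ℝ) :
    (sampleEdges p φ).cost G ≤ 8 * logSize n * listFactor n * (1 + edgeCount G * p) +
      p * ∑ u, ∑ v, adjInd G u v * (φ u v).cost G := by
  have hL := one_le_logSize n
  have hΛ := one_le_listFactor n
  simp only [sampleEdges, RandTree.cost_bind, RandTree.cost_bern, RandTree.cost_ofQueryTree,
    RandTree.exp_bern, zero_add]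
  refine (Expectation.mono _ fun S => Expectation.mono _ fun R => Expectation.mono _ fun Q =>
    cost_edgeSum_le G S R Q φ).trans ?_
  simp only [Expectation.add, expect_nbrInd_vtxInd G hp0 hp1, Expectation.const]
  simp only [Expectation.sum, Expectation.add, Expectation.const, Expectation.const_mul]
  have h1 : ∑ i : Level n, (listFactor n + 3 * listFactor n * bernoulliSet levelRate (fun S =>
      (bernoulliSet fun x : Level n × Fin n => vtxRate p x.1) (fun R =>
        ((edgesIn G (vtxSet R i) (levelSet S i)).card : ℝ)))) ≤
      ∑ _i : Level n, (listFactor n + 3 * listFactor n * (2 * edgeCount G * p)) :=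
    Finset.sum_le_sum fun i _ => by
      have := expect_card_edgesIn_le G hp0 i
      have := mul_le_mul_of_nonneg_left this (by linarith : 0 ≤ 3 * listFactor n)
      linarith
  rw [Finset.sum_const, Finset.card_univ, Fintype.card_fin, nsmul_eq_mul] at h1
  have h2 : ∑ u, ∑ v, adjInd G u v * (listFactor n + (φ u v).cost G) =
      2 * edgeCount G * listFactor n + ∑ u, ∑ v, adjInd G u v * (φ u v).cost G := by
    simp only [mul_add, Finset.sum_add_distrib, ← Finset.sum_mul]
    rw [← sum_degR]; rfl
  rw [h2]
  refine (add_le_add h1 le_rfl).trans ?_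
  push_cast
  change logSize n * _ + _ ≤ _
  have hx : 0 ≤ listFactor n * (edgeCount G * p) := by positivity
  nlinarith [mul_nonneg (sub_nonneg.2 hL) hx, mul_nonneg (sub_nonneg.2 hL) (by linarith : 0 ≤ listFactor n)]

end Levels

/-! ### Estimating triangles by sampling edges and apexes -/

section EdgeApex

variable {n : ℕ}

/-- The potential apexes sampled for the edge `(u, v)`. -/
def apexSet (W : Finset (Fin n × Fin n × Fin n)) (u v : Fin n) : Finset (Fin n) :=
  Finset.univ.filter fun w => (u, v, w) ∈ W

/-- The number of sampled apexes `w` of triangles `u v w` whose lowest vertex is `u`. -/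
noncomputable def apexCount (S : Finset (Level n × Fin n)) (W : Finset (Fin n × Fin n × Fin n))
    (u v : Fin n) : QueryTree n ℝ :=
  (askLevel S u).bind fun lu => (askLevel S v).bind fun lv =>
    if lu < lv ∨ lu = lv ∧ u < v then
      (listEdges {u} (apexSet W u v)).bind fun D => .sumOver (D.image Prod.snd) fun w =>
        (askLevel S w).bind fun lw =>
          if lu < lw ∨ lu = lw ∧ u < w then (askAdj v w).map fun b => if b then 1 else 0
          else .ret 0
    else .ret 0

/-- Estimates the number of triangles, with edges sampled at rate `p` and apexes at rate `q`. -/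
noncomputable def edgeApexEstimate (n : ℕ) (p q : ℝ) : RandTree n ℝ :=
  (RandTree.bern (levelRate (n := n))).bind fun S =>
  (RandTree.bern fun _ : Fin n × Fin n × Fin n => q).bind fun W =>
  -- The edge sampler draws its own test sets, independent of the `S` that orients the edges. The
  -- `2` in the divisor accounts for the two orders of the vertices above the lowest one.
  (sampleEdges p (apexCount S W)).map fun x => x / (2 * p * q)

variable (G : SimpleGraph (Fin n)) [DecidableRel G.Adj]

theorem eval_apexCount (S : Finset (Level n × Fin n)) (W : Finset (Fin n × Fin n × Fin n))
    (u v : Fin n) : (apexCount S W u v).eval G = precInd G S u v *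
      ∑ w, adjInd G u w * (if (u, v, w) ∈ W then 1 else 0) *
        (precInd G S u w * adjInd G v w) := by
  simp only [apexCount, QueryTree.eval_bind, eval_askLevel]
  by_cases h : precedes G S u v
  · have h₀ : level G S u < level G S v ∨ level G S u = level G S v ∧ u < v := h
    rw [if_pos h₀, QueryTree.eval_bind, eval_listEdges, QueryTree.eval_sumOver,
      sum_image_snd_edgesIn, precInd, if_pos h, one_mul]
    refine Finset.sum_congr rfl fun w _ => ?_
    rw [QueryTree.eval_bind, eval_askLevel]
    congr 1
    · simp [apexSet]
    · by_cases h' : precedes G S u w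
      · have h₁ : level G S u < level G S w ∨ level G S u = level G S w ∧ u < w := h'
        rw [if_pos h₁, QueryTree.eval_map, eval_askAdj, precInd, if_pos h', one_mul, adjInd]
        simp
      · have h₁ : ¬ (level G S u < level G S w ∨ level G S u = level G S w ∧ u < w) := h'
        rw [if_neg h₁, precInd, if_neg h', zero_mul, QueryTree.eval_ret]
  · have h₀ : ¬ (level G S u < level G S v ∨ level G S u = level G S v ∧ u < v) := h
    rw [if_neg h₀, precInd, if_neg h, zero_mul, QueryTree.eval_ret]

theorem cost_apexCount_le (S : Finset (Level n × Fin n)) (W : Finset (Fin n × Fin n × Fin n))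
    (u v : Fin n) : (apexCount S W u v).cost G ≤ 3 * listFactor n +
      3 * listFactor n * (precInd G S u v *
        ∑ w, adjInd G u w * (if (u, v, w) ∈ W then 1 else 0)) := by
  have hL := one_le_logSize n
  have hLΛ : logSize n ≤ listFactor n := by unfold listFactor; nlinarith
  simp only [apexCount, QueryTree.cost_bind, eval_askLevel, cost_askLevel]
  by_cases h : precedes G S u v
  · have h₀ : level G S u < level G S v ∨ level G S u = level G S v ∧ u < v := h
    rw [if_pos h₀, QueryTree.cost_bind, eval_listEdges, QueryTree.cost_sumOver,
      sum_image_snd_edgesIn, precInd, if_pos h, one_mul]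
    have h1 := cost_listEdges G {u} (apexSet W u v)
    have h2 : ((edgesIn G {u} (apexSet W u v)).card : ℝ) =
        ∑ w, adjInd G u w * (if (u, v, w) ∈ W then 1 else 0) := by
      rw [card_edgesIn, Finset.sum_eq_single u]
      · simp [apexSet]
      · intro b _ hb; simp [hb]
      · simp
    rw [h2] at h1
    have h3 : ∑ w, adjInd G u w * (if w ∈ apexSet W u v then 1 else 0) *
        QueryTree.cost G ((askLevel S w).bind fun lw =>
          if level G S u < lw ∨ level G S u = lw ∧ u < w then
            (askAdj v w).map fun b => if b then (1 : ℝ) else 0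
          else .ret 0) ≤
        (∑ w, adjInd G u w * (if (u, v, w) ∈ W then 1 else 0)) * (2 * listFactor n) := by
      rw [Finset.sum_mul]
      refine Finset.sum_le_sum fun w _ => ?_
      have e : (if w ∈ apexSet W u v then (1 : ℝ) else 0) = if (u, v, w) ∈ W then 1 else 0 := by
        simp [apexSet]
      rw [e]
      refine mul_le_mul_of_nonneg_left ?_
        (mul_nonneg (adjInd_nonneg G u w) (by split_ifs <;> norm_num))
      rw [QueryTree.cost_bind, cost_askLevel, eval_askLevel]
      split_ifs
      · rw [QueryTree.cost_map]; linarith [cost_askAdj G v w]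
      · rw [QueryTree.cost_ret]; linarith
    linarith
  · have h₀ : ¬ (level G S u < level G S v ∨ level G S u = level G S v ∧ u < v) := h
    rw [if_neg h₀, precInd, if_neg h, zero_mul, QueryTree.cost_ret]
    linarith

/-- The indicator of an ordered triangle whose first vertex is its lowest one. -/
noncomputable def lowTri (S : Finset (Level n × Fin n)) (u v w : Fin n) : ℝ :=
  triInd G u v w * (precInd G S u v * precInd G S u w)

theorem lowTri_nonneg (S : Finset (Level n × Fin n)) (u v w : Fin n) : 0 ≤ lowTri G S u v w :=
  mul_nonneg (triInd_nonneg G u v w) (mul_nonneg (precInd_nonneg G S u v) (precInd_nonneg G S u w))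

theorem lowTri_sq (S : Finset (Level n × Fin n)) (u v w : Fin n) :
    lowTri G S u v w ^ 2 = lowTri G S u v w := by
  unfold lowTri triInd adjInd precInd; split_ifs <;> norm_num

theorem lowTri_le_triInd (S : Finset (Level n × Fin n)) (u v w : Fin n) :
    lowTri G S u v w ≤ triInd G u v w :=
  mul_le_of_le_one_right (triInd_nonneg G u v w)
    (mul_le_one₀ (precInd_le_one G S u v) (precInd_nonneg G S u w) (precInd_le_one G S u w))

theorem precedes_iff (S : Finset (Level n × Fin n)) (u v : Fin n) :
    precedes G S u v ↔ toLex (level G S u, u) < toLex (level G S v, v) := by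
  rw [Prod.Lex.toLex_lt_toLex]; rfl

/-- The order is strict and total, being lexicographic in level and name, so exactly one vertex of a
triangle precedes the other two. -/
theorem lowTri_rotate_sum (S : Finset (Level n × Fin n)) (u v w : Fin n) :
    lowTri G S u v w + lowTri G S v w u + lowTri G S w u v = triInd G u v w := by
  unfold lowTri
  rw [triInd_rotate G u v w, ← triInd_rotate G w u v]
  by_cases ht : G.Adj u v ∧ G.Adj u w ∧ G.Adj v w
  · obtain ⟨huv, huw, hvw⟩ := ht
    have key : ∀ {a b : Fin n}, G.Adj a b →
        toLex (level G S a, a) ≠ toLex (level G S b, b) := by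
      intro a b h e
      exact h.ne (congrArg (fun x => (ofLex x).2) e)
    have h1 := key huv
    have h2 := key huw
    have h3 := key hvw
    have : triInd G u v w = 1 := by simp [triInd, adjInd, huv, huw, hvw]
    rw [this]
    simp only [precInd, precedes_iff]
    generalize toLex (level G S u, u) = x at *
    generalize toLex (level G S v, v) = y at *
    generalize toLex (level G S w, w) = z at *
    -- Of the eight sign patterns, two are cyclic and contradict transitivity; in each of the others
    -- exactly one summand is one.
    rcases lt_or_gt_of_ne h1 with h1 | h1 <;> rcases lt_or_gt_of_ne h2 with h2 | h2 <;>
      rcases lt_or_gt_of_ne h3 with h3 | h3 <;>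
      simp only [h1, h2, h3, h1.not_gt, h2.not_gt, h3.not_gt, if_true, if_false] <;>
      first
      | exact absurd (h1.trans (h3.trans h2)) (lt_irrefl _)
      | exact absurd (h1.trans (h2.trans h3)) (lt_irrefl _)
      | norm_num
  · have : triInd G u v w = 0 := by
      unfold triInd adjInd
      by_cases h1 : G.Adj u v <;> by_cases h2 : G.Adj u w <;> by_cases h3 : G.Adj v w <;>
        simp_all
    rw [this]; ring

theorem sum_lowTri (S : Finset (Level n × Fin n)) :
    ∑ u, ∑ v, ∑ w, lowTri G S u v w = 2 * triangleCount G := by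
  have h := sum_triInd G
  simp only [← lowTri_rotate_sum G S, Finset.sum_add_distrib] at h
  have e1 : ∑ u, ∑ v, ∑ w, lowTri G S v w u = ∑ u, ∑ v, ∑ w, lowTri G S u v w := by
    rw [Finset.sum_comm]
    exact Finset.sum_congr rfl fun v _ => Finset.sum_comm
  have e2 : ∑ u, ∑ v, ∑ w, lowTri G S w u v = ∑ u, ∑ v, ∑ w, lowTri G S u v w := by
    simp only [Finset.sum_comm (γ := Fin n) (f := fun v w => lowTri G S w _ v)]
    rw [Finset.sum_comm]
  rw [e1, e2] at h
  linarith

/-- Every apex counted at the edge `(u, v)` is itself an out-neighbour of `u`. -/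
theorem sum_lowTri_le_outDeg (S : Finset (Level n × Fin n)) (u v : Fin n) :
    ∑ w, lowTri G S u v w ≤ outDeg G S u := by
  refine Finset.sum_le_sum fun w _ => ?_
  unfold lowTri triInd adjInd precInd
  split_ifs <;> norm_num

theorem adjInd_mul_eval_apexCount (S : Finset (Level n × Fin n))
    (W : Finset (Fin n × Fin n × Fin n)) (u v : Fin n) :
    adjInd G u v * (apexCount S W u v).eval G =
      ∑ w, lowTri G S u v w * if (u, v, w) ∈ W then 1 else 0 := by
  rw [eval_apexCount, Finset.mul_sum, Finset.mul_sum]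
  refine Finset.sum_congr rfl fun w _ => ?_
  unfold lowTri triInd; ring

variable {p q : ℝ}

theorem expect_sum_sq_apexCount_le (hq0 : 0 ≤ q) (hq1 : q ≤ 1) (S : Finset (Level n × Fin n)) :
    (bernoulliSet fun _ : Fin n × Fin n × Fin n => q) (fun W =>
      (∑ u, ∑ v, adjInd G u v * (apexCount S W u v).eval G) ^ 2) ≤
      q ^ 2 * (2 * triangleCount G) ^ 2 + q * (2 * triangleCount G) := by
  have h := bernoulliSet_sum_sq (r := fun _ : Fin n × Fin n × Fin n => q)
    (fun _ => ⟨hq0, hq1⟩) (fun x => lowTri G S x.1 x.2.1 x.2.2)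
  simp only [Fintype.sum_prod_type, lowTri_sq] at h
  simp only [adjInd_mul_eval_apexCount]
  rw [h]
  simp only [← Finset.sum_mul]
  rw [sum_lowTri]
  have : (0 : ℝ) ≤ triangleCount G := by positivity
  nlinarith [mul_nonneg this (sq_nonneg q)]

/-- If the edge has `f` counted apexes, the second moment is at most `q² f² + q f`. One factor of
`f²` is bounded by the number of all triangles at the edge, which does not involve `S`, and the
other by the out-degree; averaging over `S` then only requires the expected out-degree. -/
theorem expect_sq_apexCount_le (hq0 : 0 ≤ q) (hq1 : q ≤ 1) (S : Finset (Level n × Fin n))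
    (u v : Fin n) :
    (bernoulliSet fun _ : Fin n × Fin n × Fin n => q) (fun W =>
      adjInd G u v * (apexCount S W u v).eval G ^ 2) ≤
      q ^ 2 * (∑ w, triInd G u v w * outDeg G S u) + q * ∑ w, lowTri G S u v w := by
  have e0 : ∀ W, adjInd G u v * (apexCount S W u v).eval G ^ 2 =
      (∑ w, lowTri G S u v w * if (u, v, w) ∈ W then 1 else 0) ^ 2 := fun W => by
    rw [← adjInd_mul_eval_apexCount, mul_pow, sq (adjInd G u v), adjInd_mul_self]
  have h := bernoulliSet_sum_sq (r := fun _ : Fin n × Fin n × Fin n => q)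
    (fun _ => ⟨hq0, hq1⟩)
    (fun x => if x.1 = u ∧ x.2.1 = v then lowTri G S x.1 x.2.1 x.2.2 else 0)
  have hsum : ∀ g : Fin n → Fin n → Fin n → ℝ, (∀ a b c, ¬ (a = u ∧ b = v) → g a b c = 0) →
      ∑ a, ∑ b, ∑ c, g a b c = ∑ c, g u v c := by
    intro g hg
    rw [Finset.sum_eq_single u, Finset.sum_eq_single v]
    · intro b _ hb; exact Finset.sum_eq_zero fun c _ => hg _ _ _ (by tauto)
    · simp
    · intro a _ ha
      exact Finset.sum_eq_zero fun b _ => Finset.sum_eq_zero fun c _ => hg _ _ _ (by tauto)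
    · simp
  simp only [Fintype.sum_prod_type] at h
  rw [hsum _ (by intro a b c hab; simp [hab]), hsum _ (by intro a b c hab; simp [hab])] at h
  have e1 : ∀ W : Finset (Fin n × Fin n × Fin n), (∑ a, ∑ b, ∑ c,
      (if a = u ∧ b = v then lowTri G S a b c else 0) * if (a, b, c) ∈ W then (1 : ℝ) else 0) =
      ∑ w, lowTri G S u v w * if (u, v, w) ∈ W then 1 else 0 := fun W => by
    rw [hsum _ (by intro a b c hab; simp [hab])]; simp
  simp only [e1, and_self, if_true, lowTri_sq] at h
  simp only [e0]
  rw [h, ← Finset.sum_mul, ← Finset.sum_mul, ← Finset.sum_mul]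
  set f := ∑ w, lowTri G S u v w with hf
  have hf0 : 0 ≤ f := Finset.sum_nonneg fun w _ => lowTri_nonneg G S u v w
  have hf1 : f ≤ outDeg G S u := sum_lowTri_le_outDeg G S u v
  have hf2 : f ≤ ∑ w, triInd G u v w := Finset.sum_le_sum fun w _ => lowTri_le_triInd G S u v w
  have h1 : f * f ≤ (∑ w, triInd G u v w) * outDeg G S u :=
    mul_le_mul hf2 hf1 hf0 (hf0.trans hf2)
  nlinarith [sq_nonneg q, mul_nonneg hf0 (sq_nonneg q)]

theorem expect_triInd_outDeg_le :
    bernoulliSet levelRate (fun S => ∑ u, ∑ v, ∑ w, triInd G u v w * outDeg G S u) ≤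
      12 * logSize n * triangleCount G * √(edgeCount G) := by
  simp only [Expectation.sum, Expectation.const_mul]
  calc _ ≤ ∑ u, ∑ v, ∑ w, triInd G u v w * (2 * logSize n * √(edgeCount G)) :=
        Finset.sum_le_sum fun u _ => Finset.sum_le_sum fun v _ => Finset.sum_le_sum fun w _ =>
          mul_le_mul_of_nonneg_left (expect_outDeg_le G u) (triInd_nonneg G u v w)
    _ = _ := by simp only [← Finset.sum_mul]; rw [sum_triInd]; ring

/-- The estimate is unbiased. -/
theorem exp_edgeApexEstimate (hp0 : 0 < p) (hp1 : p ≤ 1) (hq0 : 0 < q) (hq1 : q ≤ 1) :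
    (edgeApexEstimate n p q).exp G (fun x => x) = triangleCount G := by
  have hW : ∀ x, (bernoulliSet fun _ : Fin n × Fin n × Fin n => q)
      (fun W => if x ∈ W then 1 else 0) = q := fun x =>
    bernoulliSet_mem (fun _ => ⟨hq0.le, hq1⟩) x
  simp only [edgeApexEstimate, RandTree.exp_bind, RandTree.exp_bern, RandTree.exp_map,
    div_eq_mul_inv, Expectation.mul_const, exp_sampleEdges G hp0.le hp1,
    adjInd_mul_eval_apexCount, Expectation.const_mul, Expectation.sum, hW]
  have := sum_lowTri G
  simp only [← Expectation.sum, ← Finset.sum_mul, Expectation.mul_const, this,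
    Expectation.const]
  field_simp

/-- The variance of the estimate. -/
theorem variance_edgeApexEstimate_le (hp0 : 0 < p) (hp1 : p ≤ 1) (hq0 : 0 < q) (hq1 : q ≤ 1) :
    (edgeApexEstimate n p q).exp G (fun x => (x - triangleCount G) ^ 2) ≤
      2 * logSize n * triangleCount G / (p * q) +
      9 * logSize n ^ 2 * triangleCount G * √(edgeCount G) / p := by
  set T : ℝ := (triangleCount G : ℝ) with hT
  set s : ℝ := √(edgeCount G : ℝ) with hs
  have hT0 : 0 ≤ T := by positivity
  have hL := one_le_logSize n
  have e1 : ∀ x : ℝ, (x - T) ^ 2 = x ^ 2 - 2 * T * x + T ^ 2 := fun x => by ring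
  simp only [e1]
  rw [Expectation.add, Expectation.sub, Expectation.const_mul, Expectation.const,
    exp_edgeApexEstimate G hp0 hp1 hq0 hq1, ← hT]
  have hW : ∀ S : Finset (Level n × Fin n),
      (bernoulliSet fun _ : Fin n × Fin n × Fin n => q) (fun W =>
      p ^ 2 * (∑ u, ∑ v, adjInd G u v * (apexCount S W u v).eval G) ^ 2 +
      3 * logSize n * p * ∑ u, ∑ v, adjInd G u v * (apexCount S W u v).eval G ^ 2) ≤
      p ^ 2 * (q ^ 2 * (2 * T) ^ 2 + q * (2 * T)) + 3 * logSize n * p *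
        (q ^ 2 * (∑ u, ∑ v, ∑ w, triInd G u v w * outDeg G S u) + q * (2 * T)) := by
    intro S
    rw [Expectation.add, Expectation.const_mul, Expectation.const_mul, Expectation.sum]
    simp only [Expectation.sum]
    refine add_le_add (mul_le_mul_of_nonneg_left
      (expect_sum_sq_apexCount_le G hq0.le hq1 S) (by positivity)) ?_
    refine mul_le_mul_of_nonneg_left ?_ (by positivity)
    refine (Finset.sum_le_sum fun u _ => Finset.sum_le_sum fun v _ =>
      expect_sq_apexCount_le G hq0.le hq1 S u v).trans_eq ?_
    simp only [Finset.sum_add_distrib, ← Finset.mul_sum]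
    rw [sum_lowTri]
  have h2 : (edgeApexEstimate n p q).exp G (fun x => x ^ 2) ≤
      (p ^ 2 * (q ^ 2 * (2 * T) ^ 2 + q * (2 * T)) + 3 * logSize n * p *
        (q ^ 2 * (12 * logSize n * T * s) + q * (2 * T))) * ((2 * p * q) ^ 2)⁻¹ := by
    simp only [edgeApexEstimate, RandTree.exp_bind, RandTree.exp_bern, RandTree.exp_map,
      div_eq_mul_inv, mul_pow _ ((2 * p * q)⁻¹), Expectation.mul_const, inv_pow]
    refine mul_le_mul_of_nonneg_right ?_ (by positivity)
    refine (Expectation.mono _ fun S => (Expectation.mono _ fun W =>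
      exp_sampleEdges_sq G hp0.le hp1 (apexCount S W)).trans (hW S)).trans ?_
    simp only [Expectation.add, Expectation.const, Expectation.const_mul]
    have := expect_triInd_outDeg_le G
    gcongr
  have h3 : (p ^ 2 * (q ^ 2 * (2 * T) ^ 2 + q * (2 * T)) + 3 * logSize n * p *
        (q ^ 2 * (12 * logSize n * T * s) + q * (2 * T))) * ((2 * p * q) ^ 2)⁻¹ =
      T ^ 2 + T / (2 * q) + 9 * logSize n ^ 2 * T * s / p + 3 / 2 * logSize n * T / (p * q) := by
    field_simp; ring
  -- The variance caused by the apex choice alone is absorbed in the `1/(pq)` term, using `p ≤ 1 ≤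
  -- logSize n`.
  have h4 : T / (2 * q) ≤ 1 / 2 * logSize n * T / (p * q) := by
    have e : T / (2 * q) = 1 / 2 * p * T / (p * q) := by field_simp
    rw [e]
    gcongr
    linarith
  have h5 : 2 * logSize n * T / (p * q) =
      1 / 2 * logSize n * T / (p * q) + 3 / 2 * logSize n * T / (p * q) := by ring
  linarith

/-- The expected number of queries made for the estimate. -/
theorem cost_edgeApexEstimate_le (hp0 : 0 ≤ p) (hp1 : p ≤ 1) (hq0 : 0 ≤ q) (hq1 : q ≤ 1) :
    (edgeApexEstimate n p q).cost G ≤ 14 * logSize n * listFactor n *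
      (1 + edgeCount G * p + p * q * (edgeCount G * √(edgeCount G))) := by
  have hL := one_le_logSize n
  have hΛ := one_le_listFactor n
  set m : ℝ := (edgeCount G : ℝ) with hm
  have hm0 : 0 ≤ m := by positivity
  have hW : ∀ x, (bernoulliSet fun _ : Fin n × Fin n × Fin n => q)
      (fun W => if x ∈ W then 1 else 0) = q := fun x =>
    bernoulliSet_mem (fun _ => ⟨hq0, hq1⟩) x
  simp only [edgeApexEstimate, RandTree.cost_bind, RandTree.cost_bern, RandTree.exp_bern,
    RandTree.cost_map, zero_add]
  have h1 : ∀ (S : Finset (Level n × Fin n)) (W : Finset (Fin n × Fin n × Fin n)),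
      (sampleEdges p (apexCount S W)).cost G ≤ 8 * logSize n * listFactor n * (1 + m * p) +
        p * ∑ u, ∑ v, adjInd G u v * (3 * listFactor n + 3 * listFactor n * (precInd G S u v *
        ∑ w, adjInd G u w * (if (u, v, w) ∈ W then 1 else 0))) := fun S W => by
    refine (cost_sampleEdges_le G hp0 hp1 _).trans (add_le_add le_rfl ?_)
    refine mul_le_mul_of_nonneg_left ?_ hp0
    exact Finset.sum_le_sum fun u _ => Finset.sum_le_sum fun v _ =>
      mul_le_mul_of_nonneg_left (cost_apexCount_le G S W u v) (adjInd_nonneg G u v)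
  refine (Expectation.mono _ fun S => Expectation.mono _ fun W => h1 S W).trans ?_
  simp only [Expectation.add, Expectation.const, Expectation.const_mul, Expectation.sum, hW]
  have h2 : ∑ u, ∑ v, adjInd G u v * (3 * listFactor n + 3 * listFactor n *
      (bernoulliSet levelRate (fun S => precInd G S u v * ∑ w, adjInd G u w * q))) =
      6 * m * listFactor n + 3 * listFactor n * q *
        ∑ u, degR G u * bernoulliSet levelRate (fun S => outDeg G S u) := by
    have e : ∀ u, ∑ v, adjInd G u v * (3 * listFactor n + 3 * listFactor n *
      (bernoulliSet levelRate (fun S => precInd G S u v * ∑ w, adjInd G u w * q))) =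
      degR G u * (3 * listFactor n) + 3 * listFactor n * q *
        (degR G u * bernoulliSet levelRate (fun S => outDeg G S u)) := by
      intro u
      simp only [outDeg, Expectation.sum, Expectation.const_mul, Expectation.mul_const,
        ← Finset.sum_mul]
      simp only [mul_add, Finset.sum_add_distrib, ← Finset.sum_mul, Finset.mul_sum]
      congr 1
      refine Finset.sum_congr rfl fun v _ => ?_
      change _ * (_ * (_ * (degR G u * q))) = _
      ring
    rw [Finset.sum_congr rfl fun u _ => e u]
    simp only [Finset.sum_add_distrib, ← Finset.sum_mul, ← Finset.mul_sum]
    rw [sum_degR]; ring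
  -- Apexes are listed among all neighbours of `u`, so an out-edge at `u` costs about `q · deg u`.
  -- The expected out-degree bound is uniform in `u`, leaving the sum of the degrees.
  have h3 : ∑ u, degR G u * bernoulliSet levelRate (fun S => outDeg G S u) ≤
      4 * logSize n * (m * √m) := by
    refine (Finset.sum_le_sum fun u _ => mul_le_mul_of_nonneg_left (expect_outDeg_le G u)
      (degR_nonneg G u)).trans_eq ?_
    rw [← Finset.sum_mul, sum_degR]; ring
  have h4 : ∀ u v, bernoulliSet levelRate (fun S => precInd G S u v * ∑ w, adjInd G u w * q) =
      bernoulliSet levelRate (fun S => precInd G S u v) * ∑ w, adjInd G u w * q := fun u v => by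
    rw [Expectation.mul_const]
  simp only [h4] at h2
  simp only [Expectation.mul_const]
  rw [h2]
  have h5 := mul_le_mul_of_nonneg_left h3 (by positivity : 0 ≤ 3 * listFactor n * q)
  have h6 := mul_le_mul_of_nonneg_left (add_le_add (le_refl (6 * m * listFactor n)) h5) hp0
  refine (add_le_add le_rfl h6).trans ?_
  have k1 : 0 ≤ listFactor n * (m * p) := by positivity
  have k2 : 0 ≤ logSize n * listFactor n * (p * q * (m * √m)) := by positivity
  have k3 : 0 ≤ logSize n * listFactor n := by positivity
  nlinarith [mul_nonneg (sub_nonneg.2 hL) k1]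

end EdgeApex

/-! ### Averages of independent copies -/

section Average

variable {n : ℕ}

/-- The sum of `k` independent copies. -/
noncomputable def sumCopies (t : RandTree n ℝ) : ℕ → RandTree n ℝ
  | 0 => .ret 0
  | k + 1 => t.bind fun x => (sumCopies t k).map fun y => x + y

/-- The average of `k` independent copies. -/
noncomputable def average (k : ℕ) (t : RandTree n ℝ) : RandTree n ℝ :=
  (sumCopies t k).map fun x => x / k

variable (G : SimpleGraph (Fin n)) [DecidableRel G.Adj]

theorem exp_sumCopies (t : RandTree n ℝ) (k : ℕ) :
    (sumCopies t k).exp G (fun x => x) = k * t.exp G (fun x => x) := by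
  induction k with
  | zero => simp [sumCopies]
  | succ k ih =>
    have h : ∀ a : ℝ, (sumCopies t k).exp G (fun y => a + y) = a + k * t.exp G (fun x => x) :=
      fun a => ((Expectation.add _ (fun _ => a) fun y => y).trans (by rw [Expectation.const, ih]))
    simp only [sumCopies, RandTree.exp_bind, RandTree.exp_map, h]
    refine (Expectation.add _ (fun x => x) _).trans ?_
    rw [Expectation.const]
    push_cast; ring

theorem variance_sumCopies {t : RandTree n ℝ} {μ : ℝ} (hμ : t.exp G (fun x => x) = μ) (k : ℕ) :
    (sumCopies t k).exp G (fun x => (x - k * μ) ^ 2) = k * t.exp G (fun x => (x - μ) ^ 2) := by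
  induction k with
  | zero => simp [sumCopies]
  | succ k ih =>
    have e : ∀ x y : ℝ, (x + y - ((k + 1 : ℕ) : ℝ) * μ) ^ 2 =
        (x - μ) ^ 2 + (2 * (x - μ)) * (y - k * μ) + (y - k * μ) ^ 2 := fun x y => by
      push_cast; ring
    have h0 : (sumCopies t k).exp G (fun y => y - k * μ) = 0 := by
      rw [Expectation.sub, Expectation.const, exp_sumCopies, hμ, sub_self]
    simp only [sumCopies, RandTree.exp_bind, RandTree.exp_map, e, Expectation.add,
      Expectation.const, Expectation.const_mul, h0, ih, mul_zero]
    push_cast; ring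

theorem cost_sumCopies (t : RandTree n ℝ) (k : ℕ) : (sumCopies t k).cost G = k * t.cost G := by
  induction k with
  | zero => simp [sumCopies]
  | succ k ih =>
    simp only [sumCopies, RandTree.cost_bind, RandTree.cost_map, Expectation.const, ih]
    push_cast; ring

theorem exp_average (t : RandTree n ℝ) {k : ℕ} (hk : 0 < k) :
    (average k t).exp G (fun x => x) = t.exp G (fun x => x) := by
  have : (k : ℝ) ≠ 0 := by positivity
  simp only [average, RandTree.exp_map, div_eq_mul_inv, Expectation.mul_const, exp_sumCopies]
  field_simp

theorem variance_average {t : RandTree n ℝ} {μ : ℝ} (hμ : t.exp G (fun x => x) = μ) {k : ℕ}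
    (hk : 0 < k) :
    (average k t).exp G (fun x => (x - μ) ^ 2) = t.exp G (fun x => (x - μ) ^ 2) / k := by
  have hk' : (k : ℝ) ≠ 0 := by positivity
  have e : ∀ x : ℝ, (x / k - μ) ^ 2 = (x - k * μ) ^ 2 * ((k : ℝ) ^ 2)⁻¹ := fun x => by
    field_simp
  simp only [average, RandTree.exp_map, e, Expectation.mul_const, variance_sumCopies G hμ]
  field_simp

theorem cost_average (t : RandTree n ℝ) (k : ℕ) : (average k t).cost G = k * t.cost G := by
  simp [average, cost_sumCopies]

end Average

/-! ### Multilinear statistics of random subsets -/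

section Multilinear

/-- The indicator of membership. -/
def memInd {ι : Type} [DecidableEq ι] (S : Finset ι) (i : ι) : ℝ := if i ∈ S then 1 else 0

theorem memInd_nonneg {ι : Type} [DecidableEq ι] (S : Finset ι) (i : ι) : 0 ≤ memInd S i := by
  unfold memInd; split_ifs <;> norm_num

variable {ι : Type} [Fintype ι] [DecidableEq ι] {p : ℝ}

theorem expect_memInd (hp0 : 0 ≤ p) (hp1 : p ≤ 1) (i : ι) :
    (bernoulliSet fun _ : ι => p) (fun S => memInd S i) = p :=
  bernoulliSet_mem (r := fun _ : ι => p) (fun _ => ⟨hp0, hp1⟩) i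

theorem expect_linear_sq_le (hp0 : 0 ≤ p) (hp1 : p ≤ 1) (a : ι → ℝ) :
    (bernoulliSet fun _ : ι => p) (fun S => (∑ i, a i * memInd S i) ^ 2) ≤
      p ^ 2 * (∑ i, a i) ^ 2 + p * ∑ i, a i ^ 2 := by
  have h := bernoulliSet_sum_sq (r := fun _ : ι => p) (fun _ => ⟨hp0, hp1⟩) a
  change (bernoulliSet fun _ : ι => p) (fun S => (∑ i, a i * memInd S i) ^ 2) = _ at h
  rw [h, ← Finset.sum_mul, ← Finset.sum_mul]
  have : 0 ≤ ∑ i, a i ^ 2 := Finset.sum_nonneg fun i _ => sq_nonneg _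
  nlinarith [mul_nonneg this (sq_nonneg p)]

theorem expect_bilinear_sq_le (hp0 : 0 ≤ p) (hp1 : p ≤ 1) (a : ι → ι → ℝ) :
    (bernoulliSet fun _ : ι => p) (fun S => (bernoulliSet fun _ : ι => p) (fun S' =>
      (∑ i, ∑ j, a i j * (memInd S i * memInd S' j)) ^ 2)) ≤
      p ^ 4 * (∑ i, ∑ j, a i j) ^ 2 +
      p ^ 3 * (∑ i, (∑ j, a i j) ^ 2 + ∑ j, (∑ i, a i j) ^ 2) + p ^ 2 * ∑ i, ∑ j, a i j ^ 2 := by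
  have h1 : ∀ S : Finset ι, (bernoulliSet fun _ : ι => p) (fun S' =>
      (∑ i, ∑ j, a i j * (memInd S i * memInd S' j)) ^ 2) ≤
      p ^ 2 * (∑ i, (∑ j, a i j) * memInd S i) ^ 2 +
        p * ∑ j, (∑ i, a i j * memInd S i) ^ 2 := by
    intro S
    have e : ∀ S' : Finset ι, ∑ i, ∑ j, a i j * (memInd S i * memInd S' j) =
        ∑ j, (∑ i, a i j * memInd S i) * memInd S' j := fun S' => by
      rw [Finset.sum_comm]
      refine Finset.sum_congr rfl fun j _ => ?_
      rw [Finset.sum_mul]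
      exact Finset.sum_congr rfl fun i _ => by ring
    simp only [e]
    refine (expect_linear_sq_le hp0 hp1 _).trans_eq ?_
    rw [Finset.sum_comm]
    simp only [Finset.sum_mul]
  refine (Expectation.mono _ h1).trans ?_
  rw [Expectation.add, Expectation.const_mul, Expectation.const_mul, Expectation.sum]
  have h2 := mul_le_mul_of_nonneg_left
    (expect_linear_sq_le hp0 hp1 fun i => ∑ j, a i j) (sq_nonneg p)
  have h3 := mul_le_mul_of_nonneg_left (Finset.sum_le_sum fun j (_ : j ∈ Finset.univ) =>
    expect_linear_sq_le hp0 hp1 fun i => a i j) hp0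
  rw [Finset.sum_add_distrib, ← Finset.mul_sum, ← Finset.mul_sum,
    Finset.sum_comm (f := fun j i => a i j ^ 2)] at h3
  linarith

/-- The three sets are integrated out one at a time, each time by `expect_linear_sq_le`. The eight
resulting terms correspond to the set of indices that the two copies in the square share; each
shared index saves one factor `p`. -/
theorem expect_trilinear_sq_le (hp0 : 0 ≤ p) (hp1 : p ≤ 1) (a : ι → ι → ι → ℝ) :
    (bernoulliSet fun _ : ι => p) (fun S => (bernoulliSet fun _ : ι => p) (fun S' =>
      (bernoulliSet fun _ : ι => p) (fun S'' =>
        (∑ i, ∑ j, ∑ k, a i j k * (memInd S i * memInd S' j * memInd S'' k)) ^ 2))) ≤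
      p ^ 6 * (∑ i, ∑ j, ∑ k, a i j k) ^ 2 +
      p ^ 5 * (∑ i, (∑ j, ∑ k, a i j k) ^ 2 + ∑ j, (∑ i, ∑ k, a i j k) ^ 2 +
        ∑ k, (∑ i, ∑ j, a i j k) ^ 2) +
      p ^ 4 * (∑ i, ∑ j, (∑ k, a i j k) ^ 2 + ∑ k, ∑ i, (∑ j, a i j k) ^ 2 +
        ∑ k, ∑ j, (∑ i, a i j k) ^ 2) +
      p ^ 3 * ∑ k, ∑ i, ∑ j, a i j k ^ 2 := by
  have h1 : ∀ S S' : Finset ι, (bernoulliSet fun _ : ι => p) (fun S'' =>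
      (∑ i, ∑ j, ∑ k, a i j k * (memInd S i * memInd S' j * memInd S'' k)) ^ 2) ≤
      p ^ 2 * (∑ i, ∑ j, (∑ k, a i j k) * (memInd S i * memInd S' j)) ^ 2 +
        p * ∑ k, (∑ i, ∑ j, a i j k * (memInd S i * memInd S' j)) ^ 2 := by
    intro S S'
    have e : ∀ b : ι → ℝ, ∑ i, ∑ j, ∑ k, a i j k * (memInd S i * memInd S' j * b k) =
        ∑ k, (∑ i, ∑ j, a i j k * (memInd S i * memInd S' j)) * b k := fun b => by
      simp only [Finset.sum_mul]
      refine Eq.trans (Finset.sum_congr rfl fun i _ => Finset.sum_comm) ?_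
      rw [Finset.sum_comm]
      exact Finset.sum_congr rfl fun k _ => Finset.sum_congr rfl fun i _ =>
        Finset.sum_congr rfl fun j _ => by ring
    simp only [e]
    refine (expect_linear_sq_le hp0 hp1 _).trans_eq ?_
    have e1 := e fun _ => 1
    simp only [mul_one] at e1
    rw [← e1]
    simp only [Finset.sum_mul]
  refine (Expectation.mono _ fun S => Expectation.mono _ fun S' => h1 S S').trans ?_
  simp only [Expectation.add, Expectation.const_mul, Expectation.sum]
  have h2 := mul_le_mul_of_nonneg_left
    (expect_bilinear_sq_le hp0 hp1 fun i j => ∑ k, a i j k) (sq_nonneg p)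
  have h3 := mul_le_mul_of_nonneg_left (Finset.sum_le_sum fun k (_ : k ∈ Finset.univ) =>
    expect_bilinear_sq_le hp0 hp1 fun i j => a i j k) hp0
  rw [Finset.sum_add_distrib, Finset.sum_add_distrib, ← Finset.mul_sum, ← Finset.mul_sum,
    ← Finset.mul_sum, Finset.sum_add_distrib] at h3
  have e2 : ∑ j, (∑ i, ∑ k, a i j k) ^ 2 = ∑ j, (∑ i, (∑ k, a i j k)) ^ 2 := rfl
  linarith

end Multilinear

/-! ### Estimating triangles by sampling vertices -/

section VertexSampling

variable {n : ℕ}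

/-- The indicator that two vertices have a common neighbour among the first components of `D`. -/
def commonInd (D : Finset (Fin n × Fin n)) (u v : Fin n) : ℝ :=
  if ∃ s, (s, u) ∈ D ∧ (s, v) ∈ D then 1 else 0

theorem commonInd_zero_or_one (D : Finset (Fin n × Fin n)) (u v : Fin n) :
    commonInd D u v = 0 ∨ commonInd D u v = 1 := by
  unfold commonInd; split_ifs <;> simp

theorem commonInd_comm (D : Finset (Fin n × Fin n)) (u v : Fin n) :
    commonInd D u v = commonInd D v u := by
  simp only [commonInd, and_comm]

/-- The part of a triangle that is charged to its edge `u v`. -/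
noncomputable def heavyShare (h : Fin n → Fin n → ℝ) (u v w : Fin n) : ℝ :=
  -- For a triangle with no mark this is `0 / 0 = 0`, so it carries no charge; otherwise the marked
  -- edges share the triangle equally.
  h u v / (h u v + h u w + h v w)

/-- The indicator that no edge of a triangle is marked. -/
def lightInd (h : Fin n → Fin n → ℝ) (u v w : Fin n) : ℝ :=
  (1 - h u v) * (1 - h u w) * (1 - h v w)

/-- The neighbours of `w` according to the list `D`. -/
def nbrsIn (D : Finset (Fin n × Fin n)) (w : Fin n) : Finset (Fin n) :=
  Finset.univ.filter fun u => (w, u) ∈ D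

/-- The charges of the triangles at the vertices whose incident edges are listed in `D`. -/
noncomputable def heavyPart (h : Fin n → Fin n → ℝ) (D : Finset (Fin n × Fin n)) :
    QueryTree n ℝ :=
  .sumOver (D.image Prod.fst) fun w =>
    (listEdges (nbrsIn D w) (nbrsIn D w)).map fun D' =>
      ∑ u, ∑ v, memInd D' (u, v) * heavyShare h u v w

/-- The number of ordered triangles in `A × B × C` without marked edges. -/
noncomputable def lightCount (h : Fin n → Fin n → ℝ) (A B C : Finset (Fin n)) : QueryTree n ℝ :=
  (listEdges A B).bind fun D₁ => (listEdges A C).bind fun D₂ => (listEdges B C).map fun D₃ =>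
    ∑ u, ∑ v, ∑ w, memInd D₁ (u, v) * memInd D₂ (u, w) * memInd D₃ (v, w) * lightInd h u v w

/-- Estimates the number of ordered triangles without marked edges. -/
noncomputable def lightSample (p : ℝ) (h : Fin n → Fin n → ℝ) : RandTree n ℝ :=
  (RandTree.bern fun _ : Fin n => p).bind fun A =>
  (RandTree.bern fun _ : Fin n => p).bind fun B =>
  (RandTree.bern fun _ : Fin n => p).bind fun C =>
  (RandTree.ofQueryTree (lightCount h A B C)).map fun x => x / p ^ 3

/-- Estimates the number of triangles, with vertices sampled at rate `p`. -/
noncomputable def vertexEstimate (n : ℕ) (p : ℝ) : RandTree n ℝ :=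
  (RandTree.bern fun _ : Fin n => p).bind fun S' =>
  (RandTree.bern fun _ : Fin n => p).bind fun S =>
  (RandTree.ofQueryTree (listEdges S' Finset.univ)).bind fun D' =>
  (RandTree.ofQueryTree (listEdges S Finset.univ)).bind fun D =>
  (RandTree.ofQueryTree (heavyPart (commonInd D') D)).bind fun x =>
  -- The weights follow `sum_heavyLoad`. Averaging about `1/p` light samples removes one factor
  -- `1/p` from their variance; one sample lists only about `m p²` edges, so the total stays near `m
  -- p`.
  (average ⌈1 / p⌉₊ (lightSample p (commonInd D'))).map fun y => (3 * (x / p) + y) / 6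

variable (G : SimpleGraph (Fin n)) [DecidableRel G.Adj]

theorem memInd_edgesIn (A B : Finset (Fin n)) (u v : Fin n) :
    memInd (edgesIn G A B) (u, v) = adjInd G u v * memInd A u * memInd B v := by
  unfold memInd adjInd
  by_cases h1 : u ∈ A <;> by_cases h2 : v ∈ B <;> by_cases h3 : G.Adj u v <;>
    simp [mem_edgesIn, h1, h2, h3]

theorem memInd_mul_self {ι : Type} [DecidableEq ι] (S : Finset ι) (i : ι) :
    memInd S i * memInd S i = memInd S i := by
  unfold memInd; split_ifs <;> norm_num

/-- The indicator of an unmarked ordered triangle. -/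
def lightTri (h : Fin n → Fin n → ℝ) (u v w : Fin n) : ℝ := triInd G u v w * lightInd h u v w

theorem eval_lightCount (h : Fin n → Fin n → ℝ) (A B C : Finset (Fin n)) :
    (lightCount h A B C).eval G =
      ∑ u, ∑ v, ∑ w, lightTri G h u v w * (memInd A u * memInd B v * memInd C w) := by
  simp only [lightCount, QueryTree.eval_bind, QueryTree.eval_map, eval_listEdges, memInd_edgesIn]
  refine Finset.sum_congr rfl fun u _ => Finset.sum_congr rfl fun v _ =>
    Finset.sum_congr rfl fun w _ => ?_
  have hA := memInd_mul_self A u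
  have hB := memInd_mul_self B v
  have hC := memInd_mul_self C w
  unfold lightTri triInd
  set a := memInd A u
  set b := memInd B v
  set c := memInd C w
  set t := adjInd G u v * adjInd G u w * adjInd G v w * lightInd h u v w
  linear_combination (t * b * b * c * c) * hA + (t * a * c * c) * hB + (t * a * b) * hC

theorem cost_lightCount_le (h : Fin n → Fin n → ℝ) (A B C : Finset (Fin n)) :
    (lightCount h A B C).cost G ≤ listFactor n * (3 + ∑ u, ∑ v, adjInd G u v *
      (memInd A u * memInd B v + memInd A u * memInd C v + memInd B u * memInd C v)) := by
  simp only [lightCount, QueryTree.cost_bind, QueryTree.cost_map, eval_listEdges]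
  have h1 := cost_listEdges G A B
  have h2 := cost_listEdges G A C
  have h3 := cost_listEdges G B C
  rw [card_edgesIn] at h1 h2 h3
  simp only [mul_add (adjInd G _ _), Finset.sum_add_distrib]
  simp only [memInd]
  linarith

/-! ### Splitting triangles into charges at marked edges and unmarked triangles. -/

section Marking

variable {h : Fin n → Fin n → ℝ}

theorem heavyShare_nonneg (h01 : ∀ u v, h u v = 0 ∨ h u v = 1) (u v w : Fin n) :
    0 ≤ heavyShare h u v w := by
  have h0 : ∀ u v, 0 ≤ h u v := fun u v => by rcases h01 u v with e | e <;> simp [e]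
  exact div_nonneg (h0 u v) (add_nonneg (add_nonneg (h0 u v) (h0 u w)) (h0 v w))

theorem heavyShare_le (h01 : ∀ u v, h u v = 0 ∨ h u v = 1) (u v w : Fin n) :
    heavyShare h u v w ≤ h u v := by
  unfold heavyShare
  rcases h01 u v with e | e <;> rcases h01 u w with e' | e' <;> rcases h01 v w with e'' | e'' <;>
    rw [e, e', e''] <;> norm_num

/-- The three shares add up to one if some edge is marked and to zero otherwise. -/
theorem heavyShare_rotate_sum (h01 : ∀ u v, h u v = 0 ∨ h u v = 1) (hs : ∀ u v, h u v = h v u)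
    (u v w : Fin n) :
    heavyShare h u v w + heavyShare h v w u + heavyShare h w u v = 1 - lightInd h u v w := by
  unfold heavyShare lightInd
  rw [hs w u, hs v u, hs w v]
  rcases h01 u v with e | e <;> rcases h01 u w with e' | e' <;> rcases h01 v w with e'' | e'' <;>
    rw [e, e', e''] <;> norm_num

theorem lightTri_nonneg (h01 : ∀ u v, h u v = 0 ∨ h u v = 1) (u v w : Fin n) :
    0 ≤ lightTri G h u v w := by
  refine mul_nonneg (triInd_nonneg G u v w) ?_
  unfold lightInd
  rcases h01 u v with e | e <;> rcases h01 u w with e' | e' <;> rcases h01 v w with e'' | e'' <;>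
    rw [e, e', e''] <;> norm_num

theorem lightTri_le (h01 : ∀ u v, h u v = 0 ∨ h u v = 1) (u v w : Fin n) :
    lightTri G h u v w ≤ triInd G u v w * (1 - h u v) := by
  refine mul_le_mul_of_nonneg_left ?_ (triInd_nonneg G u v w)
  unfold lightInd
  rcases h01 u v with e | e <;> rcases h01 u w with e' | e' <;> rcases h01 v w with e'' | e'' <;>
    rw [e, e', e''] <;> norm_num

theorem lightTri_sq (h01 : ∀ u v, h u v = 0 ∨ h u v = 1) (u v w : Fin n) :
    lightTri G h u v w ^ 2 = lightTri G h u v w := by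
  unfold lightTri
  rw [mul_pow, sq (triInd G u v w), triInd_mul_self]
  congr 1
  unfold lightInd
  rcases h01 u v with e | e <;> rcases h01 u w with e' | e' <;> rcases h01 v w with e'' | e'' <;>
    rw [e, e', e''] <;> norm_num

theorem lightTri_swap_left (hs : ∀ u v, h u v = h v u) (u v w : Fin n) :
    lightTri G h v u w = lightTri G h u v w := by
  unfold lightTri lightInd
  rw [triInd_swap_left, hs v u]; ring

theorem lightTri_swap_right (hs : ∀ u v, h u v = h v u) (u v w : Fin n) :
    lightTri G h u w v = lightTri G h u v w := by
  unfold lightTri lightInd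
  rw [triInd_swap_right, hs w v]; ring

/-- The number of unmarked ordered triangles. -/
def lightTotal (h : Fin n → Fin n → ℝ) : ℝ := ∑ u, ∑ v, ∑ w, lightTri G h u v w

/-- The charge of a vertex. -/
noncomputable def heavyLoad (h : Fin n → Fin n → ℝ) (w : Fin n) : ℝ :=
  ∑ u, ∑ v, triInd G u v w * heavyShare h u v w

theorem heavyLoad_nonneg (h01 : ∀ u v, h u v = 0 ∨ h u v = 1) (w : Fin n) :
    0 ≤ heavyLoad G h w :=
  Finset.sum_nonneg fun u _ => Finset.sum_nonneg fun v _ =>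
    mul_nonneg (triInd_nonneg G u v w) (heavyShare_nonneg h01 u v w)

/-- A vertex forms at most one triangle with a given ordered pair, and the share is at most the
mark. This maximum bound on the loads is what makes uniform vertex sampling work despite vertices in
very many triangles. -/
theorem heavyLoad_le (h01 : ∀ u v, h u v = 0 ∨ h u v = 1) (w : Fin n) :
    heavyLoad G h w ≤ ∑ u, ∑ v, adjInd G u v * h u v := by
  refine Finset.sum_le_sum fun u _ => Finset.sum_le_sum fun v _ => ?_
  refine mul_le_mul ?_ (heavyShare_le h01 u v w) (heavyShare_nonneg h01 u v w)
    (adjInd_nonneg G u v)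
  unfold triInd
  rw [mul_assoc]
  exact mul_le_of_le_one_right (adjInd_nonneg _ _ _)
    (mul_le_one₀ (adjInd_le_one _ _ _) (adjInd_nonneg _ _ _) (adjInd_le_one _ _ _))

/-- Rotating an ordered triangle moves the charge through its three edges. After relabelling, the
three rotated sums equal the total load, and the uncharged remainder is the unmarked count. -/
theorem sum_heavyLoad (h01 : ∀ u v, h u v = 0 ∨ h u v = 1) (hs : ∀ u v, h u v = h v u) :
    3 * ∑ w, heavyLoad G h w + lightTotal G h = 6 * triangleCount G := by
  set f : Fin n → Fin n → Fin n → ℝ := fun u v w => triInd G u v w * heavyShare h u v w with hf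
  have e0 : ∑ w, heavyLoad G h w = ∑ u, ∑ v, ∑ w, f u v w := by
    unfold heavyLoad
    rw [Finset.sum_comm]
    exact Finset.sum_congr rfl fun u _ => Finset.sum_comm
  have e1 : ∑ u, ∑ v, ∑ w, f v w u = ∑ u, ∑ v, ∑ w, f u v w := by
    rw [Finset.sum_comm]
    exact Finset.sum_congr rfl fun v _ => Finset.sum_comm
  have e2 : ∑ u, ∑ v, ∑ w, f w u v = ∑ u, ∑ v, ∑ w, f u v w := by
    simp only [Finset.sum_comm (γ := Fin n) (f := fun v w => f w _ v)]
    rw [Finset.sum_comm]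
  have h1 : ∀ u v w, f u v w + f v w u + f w u v + lightTri G h u v w = triInd G u v w := by
    intro u v w
    simp only [hf, lightTri]
    rw [triInd_rotate G u v w, ← triInd_rotate G w u v]
    linear_combination triInd G u v w * heavyShare_rotate_sum h01 hs u v w
  have h2 := sum_triInd G
  simp only [← h1, Finset.sum_add_distrib] at h2
  rw [e1, e2, ← e0] at h2
  rw [← h2, lightTotal]; ring

theorem lightTotal_nonneg (h01 : ∀ u v, h u v = 0 ∨ h u v = 1) : 0 ≤ lightTotal G h :=
  Finset.sum_nonneg fun u _ => Finset.sum_nonneg fun v _ => Finset.sum_nonneg fun w _ =>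
    lightTri_nonneg G h01 u v w

variable {p : ℝ}

theorem exp_lightSample (hp0 : 0 < p) (hp1 : p ≤ 1) :
    (lightSample p h).exp G (fun x => x) = lightTotal G h := by
  simp only [lightSample, RandTree.exp_bind, RandTree.exp_bern, RandTree.exp_map,
    RandTree.exp_ofQueryTree, eval_lightCount, div_eq_mul_inv, Expectation.mul_const,
    Expectation.sum, Expectation.const_mul, expect_memInd hp0.le hp1, ← Finset.sum_mul]
  rw [lightTotal]
  field_simp

/-- The sum of the squares of the numbers of unmarked triangles at the ordered edges. -/
def lightSq (h : Fin n → Fin n → ℝ) : ℝ := ∑ u, ∑ v, (∑ w, lightTri G h u v w) ^ 2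

/-- The trilinear bound for a symmetric 0-1 array: sums with one shared index are crudely at most
the square of the total, those with two shared indices all equal `lightSq`, and those with three
equal the total. Dividing by `p^6` leaves the three error terms. -/
theorem variance_lightSample_le (h01 : ∀ u v, h u v = 0 ∨ h u v = 1) (hs : ∀ u v, h u v = h v u)
    (hp0 : 0 < p) (hp1 : p ≤ 1) :
    (lightSample p h).exp G (fun x => (x - lightTotal G h) ^ 2) ≤
      3 * lightTotal G h ^ 2 / p + 3 * lightSq G h / p ^ 2 + lightTotal G h / p ^ 3 := by
  set Y := lightTotal G h with hY
  set b := lightTri G h with hb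
  have hb0 : ∀ u v w, 0 ≤ b u v w := lightTri_nonneg G h01
  have e1 : ∀ x : ℝ, (x - Y) ^ 2 = x ^ 2 - 2 * Y * x + Y ^ 2 := fun x => by ring
  simp only [e1]
  rw [Expectation.add, Expectation.sub, Expectation.const_mul, Expectation.const,
    exp_lightSample G hp0 hp1, ← hY]
  have h1 := expect_trilinear_sq_le (p := p) hp0.le hp1 b
  have s1 : ∑ i, (∑ j, ∑ k, b i j k) ^ 2 ≤ Y ^ 2 :=
    Finset.sum_sq_le_sq_sum_of_nonneg fun i _ => Finset.sum_nonneg fun j _ => Finset.sum_nonneg fun k _ =>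
      hb0 i j k
  have s2 : ∑ j, (∑ i, ∑ k, b i j k) ^ 2 ≤ Y ^ 2 := by
    refine (Finset.sum_sq_le_sq_sum_of_nonneg fun j _ => Finset.sum_nonneg fun i _ =>
      Finset.sum_nonneg fun k _ => hb0 i j k).trans_eq ?_
    rw [Finset.sum_comm]; rfl
  have s3 : ∑ k, (∑ i, ∑ j, b i j k) ^ 2 ≤ Y ^ 2 := by
    refine (Finset.sum_sq_le_sq_sum_of_nonneg fun k _ => Finset.sum_nonneg fun i _ =>
      Finset.sum_nonneg fun j _ => hb0 i j k).trans_eq ?_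
    rw [Finset.sum_comm]
    congr 1
    exact Finset.sum_congr rfl fun i _ => Finset.sum_comm
  have f1 : ∑ i, ∑ j, (∑ k, b i j k) ^ 2 = lightSq G h := rfl
  have f2 : ∑ k, ∑ i, (∑ j, b i j k) ^ 2 = lightSq G h := by
    refine Finset.sum_congr rfl fun k _ => Finset.sum_congr rfl fun i _ => ?_
    congr 1
    refine Finset.sum_congr rfl fun j _ => ?_
    rw [hb, ← lightTri_swap_right G hs, lightTri_swap_left G hs]
  have f3 : ∑ k, ∑ j, (∑ i, b i j k) ^ 2 = lightSq G h := by
    refine Finset.sum_congr rfl fun k _ => Finset.sum_congr rfl fun j _ => ?_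
    congr 1
    refine Finset.sum_congr rfl fun i _ => ?_
    rw [hb, lightTri_swap_left G hs, lightTri_swap_right G hs, lightTri_swap_left G hs]
  have f4 : ∑ k, ∑ i, ∑ j, b i j k ^ 2 = Y := by
    simp only [hb, lightTri_sq G h01]
    rw [Finset.sum_comm]
    exact Finset.sum_congr rfl fun i _ => Finset.sum_comm
  rw [f1, f2, f3, f4] at h1
  have h2 : (lightSample p h).exp G (fun x => x ^ 2) ≤
      (p ^ 6 * Y ^ 2 + p ^ 5 * (3 * Y ^ 2) + p ^ 4 * (3 * lightSq G h) + p ^ 3 * Y) *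
        ((p ^ 3) ^ 2)⁻¹ := by
    simp only [lightSample, RandTree.exp_bind, RandTree.exp_bern, RandTree.exp_map,
      RandTree.exp_ofQueryTree, eval_lightCount, div_eq_mul_inv, mul_pow _ ((p ^ 3)⁻¹),
      Expectation.mul_const, inv_pow]
    refine mul_le_mul_of_nonneg_right (h1.trans ?_) (by positivity)
    have : p ^ 5 * (∑ i, (∑ j, ∑ k, b i j k) ^ 2 + ∑ j, (∑ i, ∑ k, b i j k) ^ 2 +
        ∑ k, (∑ i, ∑ j, b i j k) ^ 2) ≤ p ^ 5 * (3 * Y ^ 2) :=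
      mul_le_mul_of_nonneg_left (by linarith) (by positivity)
    have hYe : ∑ i, ∑ j, ∑ k, b i j k = Y := rfl
    rw [hYe]
    linarith
  have h3 : (p ^ 6 * Y ^ 2 + p ^ 5 * (3 * Y ^ 2) + p ^ 4 * (3 * lightSq G h) + p ^ 3 * Y) *
        ((p ^ 3) ^ 2)⁻¹ = Y ^ 2 + 3 * Y ^ 2 / p + 3 * lightSq G h / p ^ 2 + Y / p ^ 3 := by
    field_simp
  linarith

theorem cost_lightSample_le (hp0 : 0 < p) (hp1 : p ≤ 1) :
    (lightSample p h).cost G ≤ listFactor n * (3 + 6 * edgeCount G * p ^ 2) := by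
  simp only [lightSample, RandTree.cost_bind, RandTree.cost_bern, RandTree.exp_bern,
    RandTree.cost_map, RandTree.cost_ofQueryTree, zero_add]
  refine (Expectation.mono _ fun A => Expectation.mono _ fun B => Expectation.mono _ fun C =>
    cost_lightCount_le G h A B C).trans_eq ?_
  simp only [Expectation.const_mul, Expectation.add, Expectation.const, Expectation.sum,
    Expectation.mul_const, expect_memInd hp0.le hp1, ← Finset.sum_mul]
  have := sum_degR G
  simp only [degR] at this
  rw [this]; ring

theorem eval_heavyPart (S : Finset (Fin n)) :
    (heavyPart h (edgesIn G S Finset.univ)).eval G = ∑ w, heavyLoad G h w * memInd S w := by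
  simp only [heavyPart, QueryTree.eval_sumOver, QueryTree.eval_map, eval_listEdges]
  rw [← Finset.sum_subset (Finset.subset_univ ((edgesIn G S Finset.univ).image Prod.fst))]
  · refine Finset.sum_congr rfl fun w hw => ?_
    obtain ⟨e, he, rfl⟩ := Finset.mem_image.1 hw
    have hS : e.1 ∈ S := ((mem_edgesIn G).1 he).1
    have h1 : memInd S e.1 = 1 := by simp [memInd, hS]
    have h2 : ∀ u, memInd (nbrsIn (edgesIn G S Finset.univ) e.1) u = adjInd G u e.1 := fun u => by
      simp [memInd, nbrsIn, mem_edgesIn, hS, adjInd, G.adj_comm]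
    rw [h1, mul_one, heavyLoad]
    refine Finset.sum_congr rfl fun u _ => Finset.sum_congr rfl fun v _ => ?_
    rw [memInd_edgesIn, h2, h2, triInd]
  · intro w _ hw
    by_cases hS : w ∈ S
    -- A sampled vertex missing from the edge list is isolated, hence has no load.
    · have h0 : ∀ u, adjInd G u w = 0 := fun u => by
        by_contra hne
        have hadj : G.Adj u w := by
          by_contra hna
          exact hne (by simp [adjInd, hna])
        exact hw (Finset.mem_image.2 ⟨(w, u), (mem_edgesIn G).2
          ⟨hS, Finset.mem_univ _, hadj.symm⟩, rfl⟩)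
      rw [heavyLoad, Finset.sum_eq_zero, zero_mul]
      intro u _
      refine Finset.sum_eq_zero fun v _ => ?_
      rw [triInd, h0 u]; ring
    · simp [memInd, hS]

/-- The edges inside the neighbourhood of `w` are the ordered triangles at `w`, and a listed vertex
has an incident edge, so its degree pays for the additive one. -/
theorem cost_heavyPart_le (S : Finset (Fin n)) :
    (heavyPart h (edgesIn G S Finset.univ)).cost G ≤
      listFactor n * ∑ w, (degR G w + ∑ u, ∑ v, triInd G u v w) * memInd S w := by
  simp only [heavyPart, QueryTree.cost_sumOver, QueryTree.cost_map]
  have hΛ : 0 ≤ listFactor n := by linarith [one_le_listFactor n]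
  have h0 : ∀ w, 0 ≤ (degR G w + ∑ u, ∑ v, triInd G u v w) * memInd S w := fun w =>
    mul_nonneg (add_nonneg (degR_nonneg G w) (Finset.sum_nonneg fun u _ =>
      Finset.sum_nonneg fun v _ => triInd_nonneg G u v w)) (memInd_nonneg S w)
  rw [Finset.mul_sum]
  refine le_trans ?_ (Finset.sum_le_sum_of_subset_of_nonneg
    (Finset.subset_univ ((edgesIn G S Finset.univ).image Prod.fst))
    fun w _ _ => mul_nonneg hΛ (h0 w))
  refine Finset.sum_le_sum fun w hw => (cost_listEdges G _ _).trans ?_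
  obtain ⟨e, he, rfl⟩ := Finset.mem_image.1 hw
  have he' := (mem_edgesIn G).1 he
  have h1 : memInd S e.1 = 1 := by simp [memInd, he'.1]
  refine mul_le_mul_of_nonneg_left ?_ hΛ
  rw [h1, mul_one]
  refine add_le_add (one_le_degR G he'.2.2) ?_
  have h2 : ∀ u, (if u ∈ nbrsIn (edgesIn G S Finset.univ) e.1 then (1 : ℝ) else 0) =
      adjInd G u e.1 := fun u => by
    simp [nbrsIn, mem_edgesIn, he'.1, adjInd, G.adj_comm]
  rw [card_edgesIn]
  refine le_of_eq (Finset.sum_congr rfl fun u _ => Finset.sum_congr rfl fun v _ => ?_)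
  rw [h2, h2, triInd]; ring

end Marking

end VertexSampling

/-! ### Random marks, and mean, variance and cost of the vertex estimator. -/

section VertexEstimate

variable {n : ℕ} (G : SimpleGraph (Fin n)) [DecidableRel G.Adj] {p : ℝ}

/-- The marks determined by the sampled vertices `S`. -/
def markInd (S : Finset (Fin n)) : Fin n → Fin n → ℝ := commonInd (edgesIn G S Finset.univ)

/-- The common neighbours of two vertices. -/
def commonNbrs (u v : Fin n) : Finset (Fin n) :=
  Finset.univ.filter fun s => G.Adj u s ∧ G.Adj v s

theorem markInd_eq (S : Finset (Fin n)) (u v : Fin n) :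
    markInd G S u v = if Disjoint (commonNbrs G u v) S then 0 else 1 := by
  have : (∃ s, (s, u) ∈ edgesIn G S Finset.univ ∧ (s, v) ∈ edgesIn G S Finset.univ) ↔
      ¬ Disjoint (commonNbrs G u v) S := by
    rw [Finset.not_disjoint_iff]
    simp only [mem_edgesIn, commonNbrs, Finset.mem_filter, Finset.mem_univ, true_and,
      G.adj_comm u, G.adj_comm v]
    grind
  rw [markInd, commonInd, if_congr this rfl rfl]
  split_ifs <;> simp_all

theorem markInd_zero_or_one (S : Finset (Fin n)) (u v : Fin n) :
    markInd G S u v = 0 ∨ markInd G S u v = 1 := commonInd_zero_or_one _ u v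

theorem markInd_comm (S : Finset (Fin n)) (u v : Fin n) :
    markInd G S u v = markInd G S v u := commonInd_comm _ u v

/-- The number of triangles at an ordered edge. -/
def edgeTri (u v : Fin n) : ℝ := ∑ w, triInd G u v w

theorem edgeTri_nonneg (u v : Fin n) : 0 ≤ edgeTri G u v :=
  Finset.sum_nonneg fun w _ => triInd_nonneg G u v w

theorem edgeTri_eq (u v : Fin n) : edgeTri G u v = adjInd G u v * (commonNbrs G u v).card := by
  rw [edgeTri, commonNbrs, ← Finset.sum_boole, Finset.mul_sum]
  refine Finset.sum_congr rfl fun w _ => ?_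
  unfold triInd adjInd
  by_cases h1 : G.Adj u v <;> by_cases h2 : G.Adj u w <;> by_cases h3 : G.Adj v w <;>
    simp [h1, h2, h3]

/-- An edge in `t` triangles has `t` common neighbours and is marked with probability at most `t p`;
summing `t` over ordered edges counts ordered triangles. -/
theorem expect_marks_le (hp0 : 0 ≤ p) (hp1 : p ≤ 1) :
    (bernoulliSet fun _ : Fin n => p) (fun S => ∑ u, ∑ v, adjInd G u v * markInd G S u v) ≤
      6 * triangleCount G * p := by
  simp only [Expectation.sum, Expectation.const_mul, markInd_eq]
  rw [← sum_triInd, Finset.sum_mul]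
  refine Finset.sum_le_sum fun u _ => ?_
  rw [Finset.sum_mul]
  refine Finset.sum_le_sum fun v _ => ?_
  refine (mul_le_mul_of_nonneg_left (bernoulliSet_not_disjoint_le (fun _ => ⟨hp0, hp1⟩)
    (commonNbrs G u v) fun _ _ => rfl) (adjInd_nonneg G u v)).trans_eq ?_
  rw [← mul_assoc, ← edgeTri_eq]
  rfl

theorem lightSq_le (S : Finset (Fin n)) :
    lightSq G (markInd G S) ≤ ∑ u, ∑ v, edgeTri G u v ^ 2 * (1 - markInd G S u v) := by
  refine Finset.sum_le_sum fun u _ => Finset.sum_le_sum fun v _ => ?_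
  have h1 : ∑ w, lightTri G (markInd G S) u v w ≤ edgeTri G u v * (1 - markInd G S u v) := by
    rw [edgeTri, Finset.sum_mul]
    exact Finset.sum_le_sum fun w _ => lightTri_le G (markInd_zero_or_one G S) u v w
  have h0 : 0 ≤ ∑ w, lightTri G (markInd G S) u v w := Finset.sum_nonneg fun w _ =>
    lightTri_nonneg G (markInd_zero_or_one G S) u v w
  refine (pow_le_pow_left₀ h0 h1 2).trans_eq ?_
  rcases markInd_zero_or_one G S u v with e | e <;> rw [e] <;> ring

/-- An edge in `t` triangles stays unmarked with probability at most `1/(t p)`, so its expected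
contribution `t² · P` is at most `t/p`. Edges in many triangles, which would ruin the variance, are
thus removed by their marks. -/
theorem expect_lightSq_le (hp0 : 0 < p) (hp1 : p ≤ 1) :
    (bernoulliSet fun _ : Fin n => p) (fun S => lightSq G (markInd G S)) ≤
      6 * triangleCount G / p := by
  refine (Expectation.mono _ (lightSq_le G)).trans ?_
  simp only [Expectation.sum, Expectation.const_mul]
  rw [← sum_triInd, Finset.sum_div]
  refine Finset.sum_le_sum fun u _ => ?_
  rw [Finset.sum_div]
  refine Finset.sum_le_sum fun v _ => ?_
  change _ ≤ edgeTri G u v / p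
  have h := bernoulliSet_disjoint_le (r := fun _ : Fin n => p) (fun _ => ⟨hp0.le, hp1⟩)
    (commonNbrs G u v) (fun _ _ => rfl) hp0.le hp1
  have e : (fun S : Finset (Fin n) => 1 - markInd G S u v) =
      fun S => if Disjoint (commonNbrs G u v) S then 1 else 0 := by
    funext S
    rw [markInd_eq]; split_ifs <;> norm_num
  rw [e]
  set P := (bernoulliSet fun _ : Fin n => p)
    fun S => if Disjoint (commonNbrs G u v) S then (1 : ℝ) else 0
  have hP : 0 ≤ P := Expectation.nonneg _ fun S => by split_ifs <;> norm_num
  have h2 : edgeTri G u v * p * P ≤ 1 := by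
    refine le_trans ?_ h
    gcongr
    rw [edgeTri_eq]
    exact mul_le_of_le_one_left (by positivity) (adjInd_le_one G u v)
  rw [le_div_iff₀ hp0]
  have h3 := mul_le_mul_of_nonneg_left h2 (edgeTri_nonneg G u v)
  linarith

theorem heavyLoad_sum_le (S : Finset (Fin n)) :
    ∑ w, heavyLoad G (markInd G S) w ≤ 2 * triangleCount G := by
  have h1 := sum_heavyLoad G (markInd_zero_or_one G S) (markInd_comm G S)
  have h2 := lightTotal_nonneg G (markInd_zero_or_one G S)
  linarith

theorem lightTotal_le (S : Finset (Fin n)) : lightTotal G (markInd G S) ≤ 6 * triangleCount G := by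
  have h1 := sum_heavyLoad G (markInd_zero_or_one G S) (markInd_comm G S)
  have h2 : 0 ≤ ∑ w, heavyLoad G (markInd G S) w := Finset.sum_nonneg fun w _ =>
    heavyLoad_nonneg G (markInd_zero_or_one G S) w
  linarith

theorem expect_heavy (hp0 : 0 < p) (hp1 : p ≤ 1) (a : Fin n → ℝ) :
    (bernoulliSet fun _ : Fin n => p) (fun S => (∑ w, a w * memInd S w) / p) = ∑ w, a w := by
  simp only [div_eq_mul_inv, Expectation.mul_const, Expectation.sum, Expectation.const_mul,
    expect_memInd hp0.le hp1, ← Finset.sum_mul]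
  field_simp

theorem variance_heavy_le (hp0 : 0 < p) (hp1 : p ≤ 1) (a : Fin n → ℝ) :
    (bernoulliSet fun _ : Fin n => p) (fun S => ((∑ w, a w * memInd S w) / p - ∑ w, a w) ^ 2) ≤
      (∑ w, a w ^ 2) / p := by
  set B := ∑ w, a w with hB
  have e1 : ∀ x : ℝ, (x / p - B) ^ 2 = x ^ 2 * (p ^ 2)⁻¹ - 2 * B * (x / p) + B ^ 2 := fun x => by
    field_simp; ring
  simp only [e1]
  rw [Expectation.add, Expectation.sub, Expectation.const, Expectation.const_mul,
    Expectation.mul_const, expect_heavy hp0 hp1]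
  have h := mul_le_mul_of_nonneg_right (expect_linear_sq_le hp0.le hp1 a)
    (by positivity : 0 ≤ (p ^ 2)⁻¹)
  have e2 : (p ^ 2 * (∑ i, a i) ^ 2 + p * ∑ i, a i ^ 2) * (p ^ 2)⁻¹ =
      B ^ 2 + (∑ w, a w ^ 2) / p := by
    rw [← hB]; field_simp
  rw [e2] at h
  rw [← hB]
  linarith

theorem ceil_pos (hp0 : 0 < p) : 0 < ⌈1 / p⌉₊ := Nat.ceil_pos.2 (by positivity)

/-- The estimate is unbiased. -/
theorem exp_vertexEstimate (hp0 : 0 < p) (hp1 : p ≤ 1) :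
    (vertexEstimate n p).exp G (fun x => x) = triangleCount G := by
  simp only [vertexEstimate, RandTree.exp_bind, RandTree.exp_bern, RandTree.exp_ofQueryTree,
    RandTree.exp_map, eval_listEdges, eval_heavyPart]
  have h1 : ∀ S' S : Finset (Fin n),
      (average ⌈1 / p⌉₊ (lightSample p (markInd G S'))).exp G (fun y =>
        (3 * ((∑ w, heavyLoad G (markInd G S') w * memInd S w) / p) + y) / 6) =
      (3 * ((∑ w, heavyLoad G (markInd G S') w * memInd S w) / p) +
        lightTotal G (markInd G S')) / 6 := fun S' S => by
    have := exp_average G (lightSample p (markInd G S')) (ceil_pos hp0)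
    rw [exp_lightSample G hp0 hp1] at this
    simp only [div_eq_mul_inv _ (6 : ℝ), Expectation.mul_const]
    refine congrArg (· * (6 : ℝ)⁻¹) ?_
    refine (Expectation.add _ (fun _ => _) fun y => y).trans ?_
    rw [this, Expectation.const]
  refine Eq.trans (congrArg _ (funext fun S' => congrArg _ (funext fun S => h1 S' S))) ?_
  have h2 : ∀ S' : Finset (Fin n), (bernoulliSet fun _ : Fin n => p) (fun S =>
      (3 * ((∑ w, heavyLoad G (markInd G S') w * memInd S w) / p) +
        lightTotal G (markInd G S')) / 6) = triangleCount G := fun S' => by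
    simp only [div_eq_mul_inv _ (6 : ℝ), Expectation.mul_const, Expectation.add,
      Expectation.const_mul, Expectation.const, expect_heavy hp0 hp1]
    linarith [sum_heavyLoad G (markInd_zero_or_one G S') (markInd_comm G S')]
  simp only [h2, Expectation.const]

/-- The variance of the estimate. -/
theorem variance_vertexEstimate_le (hp0 : 0 < p) (hp1 : p ≤ 1) :
    (vertexEstimate n p).exp G (fun x => (x - triangleCount G) ^ 2) ≤
      6 * (triangleCount G : ℝ) ^ 2 + triangleCount G / p ^ 2 := by
  set T : ℝ := (triangleCount G : ℝ) with hT
  have hT0 : 0 ≤ T := by positivity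
  simp only [vertexEstimate, RandTree.exp_bind, RandTree.exp_bern, RandTree.exp_ofQueryTree,
    RandTree.exp_map, eval_listEdges, eval_heavyPart]
  have h1 : ∀ S' : Finset (Fin n), (bernoulliSet fun _ : Fin n => p) (fun S =>
      (average ⌈1 / p⌉₊ (lightSample p (markInd G S'))).exp G (fun y =>
        ((3 * ((∑ w, heavyLoad G (markInd G S') w * memInd S w) / p) + y) / 6 - T) ^ 2)) ≤
      1 / 36 * (18 * T / p * (∑ u, ∑ v, adjInd G u v * markInd G S' u v) + 108 * T ^ 2 +
        3 / p * lightSq G (markInd G S') + 6 * T / p ^ 2) := by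
    intro S'
    have h01 := markInd_zero_or_one G S'
    have hsym := markInd_comm G S'
    set a := heavyLoad G (markInd G S') with ha
    set Y := lightTotal G (markInd G S') with hY
    set H := ∑ u, ∑ v, adjInd G u v * markInd G S' u v with hH
    have hsum : 3 * ∑ w, a w + Y = 6 * T := sum_heavyLoad G h01 hsym
    have hY0 : 0 ≤ Y := lightTotal_nonneg G h01
    have hY6 : Y ≤ 6 * T := lightTotal_le G S'
    have hB2 : ∑ w, a w ≤ 2 * T := heavyLoad_sum_le G S'
    have ha0 : ∀ w, 0 ≤ a w := heavyLoad_nonneg G h01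
    have hmean : (lightSample p (markInd G S')).exp G (fun x => x) = Y := exp_lightSample G hp0 hp1
    have hvar : (average ⌈1 / p⌉₊ (lightSample p (markInd G S'))).exp G (fun y => (y - Y) ^ 2) ≤
        108 * T ^ 2 + 3 / p * lightSq G (markInd G S') + 6 * T / p ^ 2 := by
      rw [variance_average G hmean (ceil_pos hp0)]
      have hv := variance_lightSample_le G h01 hsym hp0 hp1
      rw [← hY] at hv
      have hk : (0 : ℝ) < ⌈1 / p⌉₊ := by exact_mod_cast ceil_pos hp0
      rw [div_le_iff₀ hk]
      have hq0 : 0 ≤ lightSq G (markInd G S') := Finset.sum_nonneg fun u _ =>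
        Finset.sum_nonneg fun v _ => sq_nonneg _
      have e : 3 * Y ^ 2 / p + 3 * lightSq G (markInd G S') / p ^ 2 + Y / p ^ 3 =
          (3 * Y ^ 2 + 3 / p * lightSq G (markInd G S') + Y / p ^ 2) * (1 / p) := by
        field_simp
      rw [e] at hv
      refine hv.trans ?_
      have hY2 : Y ^ 2 ≤ 36 * T ^ 2 := by nlinarith
      have hY3 : Y / p ^ 2 ≤ 6 * T / p ^ 2 := by gcongr
      refine mul_le_mul (by linarith) (Nat.le_ceil _) (by positivity) (by positivity)
    have hy0 : (average ⌈1 / p⌉₊ (lightSample p (markInd G S'))).exp G (fun y => y - Y) = 0 := by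
      rw [Expectation.sub, Expectation.const, exp_average G _ (ceil_pos hp0), hmean, sub_self]
    -- Conditionally on the marks, `6T` is three times the total load plus the unmarked count. The
    -- error therefore splits into two centred parts whose cross term has mean zero.
    have e1 : ∀ x y : ℝ, ((3 * x + y) / 6 - T) ^ 2 = 1 / 36 * (9 * (x - ∑ w, a w) ^ 2 +
        6 * (x - ∑ w, a w) * (y - Y) + (y - Y) ^ 2) := fun x y => by
      have : T = (3 * ∑ w, a w + Y) / 6 := by linarith
      rw [this]; ring
    simp only [e1, Expectation.const_mul, Expectation.add, Expectation.const, hy0, mul_zero,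
      add_zero]
    have hvh := variance_heavy_le hp0 hp1 a
    -- Maximum load times total load; the expectation of `H` is of order `T p`.
    have hsq : ∑ w, a w ^ 2 ≤ H * (2 * T) := by
      have hH0 : 0 ≤ H := Finset.sum_nonneg fun u _ => Finset.sum_nonneg fun v _ =>
        mul_nonneg (adjInd_nonneg G u v) (by rcases h01 u v with e | e <;> rw [e]; exact zero_le_one)
      calc ∑ w, a w ^ 2 ≤ ∑ w, H * a w := Finset.sum_le_sum fun w _ => by
            rw [sq]; exact mul_le_mul_of_nonneg_right (heavyLoad_le G h01 w) (ha0 w)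
        _ = H * ∑ w, a w := by rw [Finset.mul_sum]
        _ ≤ _ := mul_le_mul_of_nonneg_left hB2 hH0
    have hsq' : (∑ w, a w ^ 2) / p ≤ 2 * T / p * H := by
      calc _ ≤ H * (2 * T) / p := by gcongr
        _ = _ := by ring
    have e3 : 18 * T / p * H = 9 * (2 * T / p * H) := by ring
    rw [e3]
    linarith
  refine (Expectation.mono _ h1).trans ?_
  simp only [Expectation.const_mul, Expectation.add, Expectation.const]
  have h2 := mul_le_mul_of_nonneg_left (expect_marks_le G hp0.le hp1)
    (by positivity : 0 ≤ 18 * T / p)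
  have h3 := mul_le_mul_of_nonneg_left (expect_lightSq_le G hp0 hp1)
    (by positivity : 0 ≤ 3 / p)
  rw [← hT] at h2 h3
  -- The final constants are `(108 + 108)/36 = 6` for `T²` and `(18 + 6)/36 ≤ 1` for `T/p²`.
  have e1 : 18 * T / p * (6 * T * p) = 108 * T ^ 2 := by field_simp; ring
  have e2 : 3 / p * (6 * T / p) = 18 * (T / p ^ 2) := by field_simp; ring
  have e3 : 6 * T / p ^ 2 = 6 * (T / p ^ 2) := by ring
  have h4 : 0 ≤ T / p ^ 2 := by positivity
  rw [e1] at h2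
  rw [e2] at h3
  rw [e3]
  linarith

/-- The expected number of queries made for the estimate. -/
theorem cost_vertexEstimate_le (hp0 : 0 < p) (hp1 : p ≤ 1) :
    (vertexEstimate n p).cost G ≤ 18 * listFactor n *
      (1 + edgeCount G * p + triangleCount G * p + 1 / p) := by
  set m : ℝ := (edgeCount G : ℝ) with hm
  set T : ℝ := (triangleCount G : ℝ) with hT
  have hΛ := one_le_listFactor n
  simp only [vertexEstimate, RandTree.cost_bind, RandTree.cost_bern, RandTree.exp_bern,
    RandTree.cost_map, RandTree.cost_ofQueryTree, RandTree.exp_ofQueryTree, eval_listEdges,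
    cost_average, zero_add]
  have hlist : ∀ S : Finset (Fin n), (listEdges S Finset.univ).cost G ≤
      listFactor n * (1 + ∑ u, degR G u * memInd S u) := fun S => by
    refine (cost_listEdges G S Finset.univ).trans_eq ?_
    rw [card_edgesIn]
    congr 2
    refine Finset.sum_congr rfl fun u _ => ?_
    rw [degR, Finset.sum_mul]
    exact Finset.sum_congr rfl fun v _ => by simp [memInd]
  have hk : (⌈1 / p⌉₊ : ℝ) ≤ 2 / p := by
    have h1 := (Nat.ceil_lt_add_one (by positivity : 0 ≤ 1 / p)).le
    have h2 : 1 ≤ 1 / p := (one_le_div hp0).2 hp1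
    have h3 : 2 / p = 1 / p + 1 / p := by ring
    linarith
  have h1 : ∀ S' S : Finset (Fin n),
      (listEdges S' Finset.univ).cost G + ((listEdges S Finset.univ).cost G +
        ((heavyPart (commonInd (edgesIn G S' Finset.univ)) (edgesIn G S Finset.univ)).cost G +
        ⌈1 / p⌉₊ * (lightSample p (commonInd (edgesIn G S' Finset.univ))).cost G)) ≤
      listFactor n * (1 + ∑ u, degR G u * memInd S' u) +
      (listFactor n * (1 + ∑ u, degR G u * memInd S u) +
      (listFactor n * ∑ w, (degR G w + ∑ u, ∑ v, triInd G u v w) * memInd S w +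
        2 / p * (listFactor n * (3 + 6 * m * p ^ 2)))) := fun S' S => by
    refine add_le_add (hlist S') (add_le_add (hlist S) (add_le_add
      (cost_heavyPart_le G S) ?_))
    exact mul_le_mul hk (cost_lightSample_le G hp0 hp1) (RandTree.cost_nonneg G _) (by positivity)
  refine (Expectation.mono _ fun S' => Expectation.mono _ fun S => h1 S' S).trans ?_
  simp only [Expectation.add, Expectation.const, Expectation.const_mul, Expectation.sum,
    expect_memInd hp0.le hp1, ← Finset.sum_mul, Finset.sum_add_distrib]
  have e1 : ∑ w, ∑ u, ∑ v, triInd G u v w = 6 * T := by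
    rw [hT, ← sum_triInd, Finset.sum_comm]
    exact Finset.sum_congr rfl fun u _ => Finset.sum_comm
  rw [sum_degR, e1, ← hm]
  have e2 : 2 / p * (listFactor n * (3 + 6 * m * p ^ 2)) =
      listFactor n * (6 * (1 / p) + 12 * m * p) := by field_simp; ring
  rw [e2]
  have k1 : 0 ≤ listFactor n * (m * p) := by positivity
  have k2 : 0 ≤ listFactor n * (T * p) := by positivity
  have k3 : 0 ≤ listFactor n * (1 / p) := by positivity
  nlinarith

end VertexEstimate

/-! ### A crude estimate of the number of edges -/

section EdgeEstimate

variable {n : ℕ}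

/-- The number of sampled directed edges. -/
noncomputable def edgeSample (n : ℕ) (p : ℝ) : RandTree n ℝ := sampleEdges p fun _ _ => .ret 1

/-- Tests whether each of `k` independent samples contains at least `c` edges. -/
noncomputable def manyEdges (n : ℕ) (p c : ℝ) : ℕ → RandTree n Bool
  | 0 => .ret true
  | k + 1 => (edgeSample n p).bind fun x => if c ≤ x then manyEdges n p c k else .ret false

/-- Searches for the largest exponent `i ≤ P` such that samples at rate `2 ^ (-i)` contain many
edges. -/
noncomputable def edgeExponent (n : ℕ) (c : ℝ) : ℕ → RandTree n ℕ
  | 0 => .ret 0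
  | P + 1 => (manyEdges n ((1 / 2) ^ (P + 1)) c 4).bind fun b =>
      if b then .ret (P + 1) else edgeExponent n c P

variable (G : SimpleGraph (Fin n)) [DecidableRel G.Adj] {p c : ℝ}

theorem sum_adjInd : ∑ u, ∑ v, adjInd G u v = 2 * edgeCount G := by
  rw [← sum_degR]; rfl

theorem exp_edgeSample (hp0 : 0 ≤ p) (hp1 : p ≤ 1) :
    (edgeSample n p).exp G (fun x => x) = 2 * (edgeCount G * p) := by
  rw [edgeSample, exp_sampleEdges G hp0 hp1]
  simp only [QueryTree.eval_ret, mul_one, sum_adjInd]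
  ring

theorem variance_edgeSample_le (hp0 : 0 ≤ p) (hp1 : p ≤ 1) :
    (edgeSample n p).exp G (fun x => (x - 2 * (edgeCount G * p)) ^ 2) ≤
      6 * logSize n * (edgeCount G * p) := by
  have h := exp_sampleEdges_sq G hp0 hp1 fun _ _ => .ret 1
  simp only [QueryTree.eval_ret, mul_one, one_pow, sum_adjInd] at h
  have e1 : ∀ x a : ℝ, (x - a) ^ 2 = x ^ 2 - 2 * a * x + a ^ 2 := fun x a => by ring
  simp only [e1]
  rw [Expectation.add, Expectation.sub, Expectation.const_mul, Expectation.const,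
    exp_edgeSample G hp0 hp1]
  change (edgeSample n p).exp G (fun x => x ^ 2) ≤ _ at h
  linarith

theorem cost_edgeSample_le (hp0 : 0 ≤ p) (hp1 : p ≤ 1) :
    (edgeSample n p).cost G ≤ 8 * logSize n * listFactor n * (1 + edgeCount G * p) := by
  refine (cost_sampleEdges_le G hp0 hp1 _).trans_eq ?_
  simp

/-- The indicator of `true`. -/
def boolInd (b : Bool) : ℝ := if b then 1 else 0

/-- Markov's inequality for each independent sample; the powers produced by repetition keep the
moments of an overestimate bounded. -/
theorem exp_manyEdges_le (hp0 : 0 ≤ p) (hp1 : p ≤ 1) (hc : 0 < c) (k : ℕ) :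
    (manyEdges n p c k).exp G boolInd ≤ (2 * (edgeCount G * p) / c) ^ k := by
  induction k with
  | zero => simp [manyEdges, boolInd]
  | succ k ih =>
    rw [manyEdges, RandTree.exp_bind, pow_succ']
    have hx : ∀ x : ℝ, (if c ≤ x then manyEdges n p c k else .ret false).exp G boolInd ≤
        (if c ≤ x then 1 else 0) * (2 * (edgeCount G * p) / c) ^ k := fun x => by
      split_ifs
      · rwa [one_mul]
      · simp [boolInd]
    refine (Expectation.mono _ hx).trans ?_
    rw [Expectation.mul_const]
    refine mul_le_mul_of_nonneg_right ?_ (by positivity)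
    rw [← exp_edgeSample G hp0 hp1, edgeSample, RandTree.exp]
    rw [le_div_iff₀ hc]
    change (sampleEdges p fun _ _ => .ret 1).exp G (fun x => if c ≤ x then 1 else 0) * c ≤
      (sampleEdges p fun _ _ => .ret 1).exp G fun x => x
    -- The sample value is nonnegative for every outcome, but not as a function on all of `ℝ`, so
    -- Markov's inequality is applied after unfolding to the random sets.
    simp only [sampleEdges, RandTree.exp_bind, RandTree.exp_bern, RandTree.exp_ofQueryTree,
      eval_edgeSum, ← Expectation.mul_const]
    refine Expectation.mono _ fun S => Expectation.mono _ fun R => Expectation.mono _ fun Q => ?_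
    have : 0 ≤ ∑ u, ∑ v, adjInd G u v * vtxInd G S R u * nbrInd G S Q u v *
        (QueryTree.ret 1 : QueryTree n ℝ).eval G := Finset.sum_nonneg fun u _ =>
      Finset.sum_nonneg fun v _ => mul_nonneg (mul_nonneg (mul_nonneg (adjInd_nonneg G u v)
        (vtxInd_nonneg G S R u)) (nbrInd_nonneg G S Q u v)) (by simp)
    split_ifs with h <;> linarith

/-- With `z = m p ≥ c`, a count below `c` is at distance more than `z` from its mean `2z`. Chebyshev
gives failure probability at most `6L/z ≤ 6L/c` per test, where `L = logSize n`, and a union bound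
covers the tests. -/
theorem exp_not_manyEdges_le (hp0 : 0 ≤ p) (hp1 : p ≤ 1) (hc : 0 < c) (hm : c ≤ edgeCount G * p)
    (k : ℕ) : (manyEdges n p c k).exp G (fun b => 1 - boolInd b) ≤ k * (6 * logSize n / c) := by
  have hL := one_le_logSize n
  induction k with
  | zero => simp [manyEdges, boolInd]
  | succ k ih =>
    rw [manyEdges, RandTree.exp_bind]
    set z : ℝ := edgeCount G * p with hz
    have hz0 : 0 < z := hc.trans_le hm
    have hx : ∀ x : ℝ, (if c ≤ x then manyEdges n p c k else .ret false).exp G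
        (fun b => 1 - boolInd b) ≤ (x - 2 * z) ^ 2 / z ^ 2 + k * (6 * logSize n / c) := fun x => by
      have h0 : 0 ≤ (x - 2 * z) ^ 2 / z ^ 2 := by positivity
      have h1 : 0 ≤ k * (6 * logSize n / c) := by positivity
      split_ifs with h
      · linarith
      · have : 1 ≤ (x - 2 * z) ^ 2 / z ^ 2 := by
          rw [one_le_div (by positivity)]
          nlinarith
        simp only [RandTree.exp_ret, boolInd]
        norm_num
        linarith
    refine (Expectation.mono _ hx).trans ?_
    simp only [Expectation.add, Expectation.const, div_eq_mul_inv _ (z ^ 2),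
      Expectation.mul_const]
    have h2 := mul_le_mul_of_nonneg_right (variance_edgeSample_le G hp0 hp1)
      (by positivity : 0 ≤ (z ^ 2)⁻¹)
    rw [← hz] at h2
    have h3 : 6 * logSize n * z * (z ^ 2)⁻¹ ≤ 6 * logSize n / c := by
      have : 6 * logSize n * z * (z ^ 2)⁻¹ = 6 * logSize n / z := by field_simp
      rw [this]
      gcongr
    push_cast
    linarith

theorem cost_manyEdges_le (hp0 : 0 ≤ p) (hp1 : p ≤ 1) (k : ℕ) :
    (manyEdges n p c k).cost G ≤
      k * (8 * logSize n * listFactor n * (1 + edgeCount G * p)) := by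
  have hL := one_le_logSize n
  have hΛ := one_le_listFactor n
  induction k with
  | zero => simp [manyEdges]
  | succ k ih =>
    rw [manyEdges, RandTree.cost_bind]
    have hx : ∀ x : ℝ, (if c ≤ x then manyEdges n p c k else .ret false).cost G ≤
        k * (8 * logSize n * listFactor n * (1 + edgeCount G * p)) := fun x => by
      split_ifs
      · exact ih
      · rw [RandTree.cost_ret]; positivity
    have h1 := Expectation.le_const ((edgeSample n p).exp G) hx
    have h2 := cost_edgeSample_le G hp0 hp1
    push_cast
    linarith

theorem exp_edgeExponent_succ (P : ℕ) (f : ℕ → ℝ) :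
    (edgeExponent n c (P + 1)).exp G f =
      (manyEdges n ((1 / 2) ^ (P + 1)) c 4).exp G boolInd * f (P + 1) +
      (manyEdges n ((1 / 2) ^ (P + 1)) c 4).exp G (fun b => 1 - boolInd b) *
        (edgeExponent n c P).exp G f := by
  rw [edgeExponent, RandTree.exp_bind, ← Expectation.mul_const, ← Expectation.mul_const,
    ← Expectation.add]
  congr 1
  funext b
  cases b <;> simp [boolInd]

theorem half_pow_mem (P : ℕ) : (0 : ℝ) ≤ (1 / 2) ^ P ∧ (1 / 2 : ℝ) ^ P ≤ 1 :=
  ⟨by positivity, pow_le_one₀ (by norm_num) (by norm_num)⟩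

theorem exp_manyEdges_mem (p : ℝ) (k : ℕ) :
    0 ≤ (manyEdges n p c k).exp G boolInd ∧ (manyEdges n p c k).exp G boolInd ≤ 1 :=
  ⟨Expectation.nonneg _ fun b => by cases b <;> simp [boolInd],
    Expectation.le_const _ fun b => by cases b <;> simp [boolInd]⟩

theorem exp_not_manyEdges_mem (p : ℝ) (k : ℕ) :
    0 ≤ (manyEdges n p c k).exp G (fun b => 1 - boolInd b) ∧
      (manyEdges n p c k).exp G (fun b => 1 - boolInd b) ≤ 1 :=
  ⟨Expectation.nonneg _ fun b => by cases b <;> simp [boolInd],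
    Expectation.le_const _ fun b => by cases b <;> simp [boolInd]⟩

/-- The probability that the number of edges is badly underestimated. -/
theorem prob_underestimate_le (hc : 0 < c) (P : ℕ)
    (hP : (edgeCount G : ℝ) ≤ 2 * c * 2 ^ P) :
    (edgeExponent n c P).exp G (fun i => if 2 * c * 2 ^ i < edgeCount G then 1 else 0) ≤
      24 * logSize n / c := by
  have hL := one_le_logSize n
  have hθ : 0 ≤ 24 * logSize n / c := by positivity
  induction P with
  | zero =>
    rw [edgeExponent, RandTree.exp_ret, if_neg (not_lt.2 hP)]
    exact hθ
  | succ P ih =>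
    rw [exp_edgeExponent_succ, if_neg (not_lt.2 hP), mul_zero, zero_add]
    have hmem := exp_not_manyEdges_mem G (c := c) ((1 / 2) ^ (P + 1)) 4
    have hE0 : 0 ≤ (edgeExponent n c P).exp G
        (fun i => if 2 * c * 2 ^ i < edgeCount G then 1 else 0) :=
      Expectation.nonneg _ fun i => by split_ifs <;> norm_num
    -- Only the first dangerous step is charged: if stopping at `P` would already be too low, the
    -- present tests have expected count above `2c` and must fail for the search to go on.
    by_cases h : (edgeCount G : ℝ) ≤ 2 * c * 2 ^ P
    · exact (mul_le_of_le_one_left hE0 hmem.2).trans (ih h)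
    · have hz : c ≤ edgeCount G * (1 / 2) ^ (P + 1) := by
        rw [one_div, inv_pow, ← div_eq_mul_inv, le_div_iff₀ (by positivity), pow_succ]
        linarith [not_le.1 h]
      have h1 := exp_not_manyEdges_le G (half_pow_mem (P + 1)).1 (half_pow_mem (P + 1)).2 hc hz 4
      have hE1 : (edgeExponent n c P).exp G
          (fun i => if 2 * c * 2 ^ i < edgeCount G then 1 else 0) ≤ 1 :=
        Expectation.le_const _ fun i => by split_ifs <;> norm_num
      refine (mul_le_of_le_one_right hmem.1 hE1).trans (h1.trans_eq ?_)
      push_cast; ring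

theorem mul_half_pow_succ (m : ℝ) (P : ℕ) : m * (1 / 2) ^ P = 2 * (m * (1 / 2) ^ (P + 1)) := by
  rw [pow_succ]; ring

/-- When the search should stop, it continues with probability at most `1/8`, while the square grows
by a factor four at each further step. The resulting geometric recursion keeps the second moment
bounded up to `c²` per level. -/
theorem exp_underestimate_le (hc : 192 * logSize n ≤ c) (P : ℕ) :
    (edgeExponent n c P).exp G (fun i => (edgeCount G * (1 / 2) ^ i) ^ 2) ≤
      2 * (edgeCount G * (1 / 2) ^ P) ^ 2 + 7 * c ^ 2 * (P + 1) := by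
  have hL := one_le_logSize n
  have hc0 : 0 < c := by linarith
  induction P with
  | zero =>
    rw [edgeExponent, RandTree.exp_ret]
    norm_num
    nlinarith [sq_nonneg (edgeCount G : ℝ), sq_nonneg c]
  | succ P ih =>
    rw [exp_edgeExponent_succ]
    rw [mul_half_pow_succ] at ih
    set z : ℝ := edgeCount G * (1 / 2) ^ (P + 1) with hz
    set x := (edgeExponent n c P).exp G (fun i => (edgeCount G * (1 / 2) ^ i) ^ 2)
    have hx0 : 0 ≤ x := Expectation.nonneg _ fun i => sq_nonneg _
    have ht := exp_manyEdges_mem G (c := c) ((1 / 2) ^ (P + 1)) 4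
    have hf := exp_not_manyEdges_mem G (c := c) ((1 / 2) ^ (P + 1)) 4
    set a := (manyEdges n ((1 / 2) ^ (P + 1)) c 4).exp G boolInd
    have hz0 : 0 ≤ z := by positivity
    have h1 : a * z ^ 2 ≤ z ^ 2 := mul_le_of_le_one_left (sq_nonneg z) ht.2
    push_cast
    by_cases h : c ≤ z
    · have h2 := exp_not_manyEdges_le G (half_pow_mem (P + 1)).1 (half_pow_mem (P + 1)).2 hc0 h 4
      -- The constant `192 = 24 · 8` in the hypothesis on `c` is used here.
      have h3 : ((4 : ℕ) : ℝ) * (6 * logSize n / c) ≤ 1 / 8 := by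
        rw [← mul_div_assoc, div_le_div_iff₀ hc0 (by norm_num)]
        push_cast; linarith
      have h4 := mul_le_mul_of_nonneg_right (h2.trans h3) hx0
      have : 0 ≤ c ^ 2 * ((P : ℝ) + 1) := by positivity
      nlinarith [sq_nonneg c]
    -- Below the threshold there is no gain from the tests: the loss is `z² + 8z² - 2z² ≤ 7c²`,
    -- whence the constant `7`.
    · have h4 := mul_le_of_le_one_left hx0 hf.2
      have : z ^ 2 ≤ c ^ 2 := pow_le_pow_left₀ hz0 (not_le.1 h).le 2
      nlinarith

/-- With `y = 2^i/m`, passing four tests has probability at most `y^{-4}`, so stopping at `i`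
contributes at most `min(y², y^{-2}) ≤ 1` to the second moment. -/
theorem exp_overestimate_le (hc : 2 ≤ c) (hm : 1 ≤ edgeCount G) (P : ℕ) :
    (edgeExponent n c P).exp G (fun i => (2 ^ i / edgeCount G) ^ 2) ≤ P + 1 := by
  have hm' : (1 : ℝ) ≤ edgeCount G := by exact_mod_cast hm
  have hm0 : (0 : ℝ) < edgeCount G := by linarith
  induction P with
  | zero =>
    rw [edgeExponent, RandTree.exp_ret]
    norm_num
    rw [inv_le_one₀ (by positivity)]
    nlinarith
  | succ P ih =>
    rw [exp_edgeExponent_succ]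
    have ht := exp_manyEdges_mem G (c := c) ((1 / 2) ^ (P + 1)) 4
    have hf := exp_not_manyEdges_mem G (c := c) ((1 / 2) ^ (P + 1)) 4
    have hle := exp_manyEdges_le G (half_pow_mem (P + 1)).1 (half_pow_mem (P + 1)).2
      (by linarith : 0 < c) 4
    set a := (manyEdges n ((1 / 2) ^ (P + 1)) c 4).exp G boolInd
    set x := (edgeExponent n c P).exp G (fun i => (2 ^ i / (edgeCount G : ℝ)) ^ 2)
    have hx0 : 0 ≤ x := Expectation.nonneg _ fun i => sq_nonneg _
    have h1 := mul_le_of_le_one_left hx0 hf.2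
    set y : ℝ := 2 ^ (P + 1) / (edgeCount G : ℝ) with hy
    have hy0 : 0 < y := by positivity
    have h2 : a ≤ (y ^ 4)⁻¹ := by
      refine hle.trans ?_
      rw [← inv_pow]
      refine pow_le_pow_left₀ (by positivity) ?_ 4
      rw [hy, inv_div, one_div, inv_pow, ← div_eq_mul_inv, div_le_iff₀ (by linarith)]
      have : (0 : ℝ) ≤ edgeCount G / 2 ^ (P + 1) := by positivity
      nlinarith
    have h3 : a * y ^ 2 ≤ 1 := by
      by_cases hy1 : y ≤ 1
      · exact mul_le_one₀ ht.2 (sq_nonneg y) (pow_le_one₀ hy0.le hy1)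
      · have e : (y ^ 4)⁻¹ * y ^ 2 = (y ^ 2)⁻¹ := by field_simp
        refine (mul_le_mul_of_nonneg_right h2 (sq_nonneg y)).trans ?_
        rw [e]
        exact inv_le_one_of_one_le₀ (one_le_pow₀ (not_le.1 hy1).le)
    push_cast
    linarith

/-- Once the expected count exceeds `c`, the doubled cost of going on is outweighed by the
continuation probability of at most `1/8`; before that, each level costs only a multiple of `c`. -/
theorem cost_edgeExponent_le (hc : 192 * logSize n ≤ c) (P : ℕ) :
    (edgeExponent n c P).cost G ≤ 32 * logSize n * listFactor n *
      (2 * (edgeCount G * (1 / 2) ^ P) + 4 * c * P) := by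
  have hL := one_le_logSize n
  have hΛ := one_le_listFactor n
  have hc0 : 0 < c := by linarith
  induction P with
  | zero => rw [edgeExponent, RandTree.cost_ret]; positivity
  | succ P ih =>
    have hcost := cost_manyEdges_le G (c := c) (half_pow_mem (P + 1)).1 (half_pow_mem (P + 1)).2 4
    rw [mul_half_pow_succ] at ih
    set z : ℝ := edgeCount G * (1 / 2) ^ (P + 1) with hz
    have hz0 : 0 ≤ z := by positivity
    set Γ := 32 * logSize n * listFactor n with hΓ
    have hΓ0 : 0 < Γ := by positivity
    have e : (edgeExponent n c (P + 1)).cost G =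
        (manyEdges n ((1 / 2) ^ (P + 1)) c 4).cost G +
        (manyEdges n ((1 / 2) ^ (P + 1)) c 4).exp G (fun b => 1 - boolInd b) *
          (edgeExponent n c P).cost G := by
      rw [edgeExponent, RandTree.cost_bind, ← Expectation.mul_const]
      congr 2
      funext b
      cases b <;> simp [boolInd]
    rw [e]
    have hf := exp_not_manyEdges_mem G (c := c) ((1 / 2) ^ (P + 1)) 4
    have hx0 := RandTree.cost_nonneg G (edgeExponent n c P)
    set x := (edgeExponent n c P).cost G
    have hcost' : (manyEdges n ((1 / 2) ^ (P + 1)) c 4).cost G ≤ Γ * (1 + z) := by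
      refine hcost.trans_eq ?_
      rw [hΓ]; push_cast; ring
    push_cast
    by_cases h : c ≤ z
    · have h2 := exp_not_manyEdges_le G (half_pow_mem (P + 1)).1 (half_pow_mem (P + 1)).2 hc0 h 4
      have h3 : ((4 : ℕ) : ℝ) * (6 * logSize n / c) ≤ 1 / 8 := by
        rw [← mul_div_assoc, div_le_div_iff₀ hc0 (by norm_num)]
        push_cast; linarith
      have h4 := mul_le_mul_of_nonneg_right (h2.trans h3) hx0
      have h5 : Γ * (1 + z) + 1 / 8 * (Γ * (2 * (2 * z) + 4 * c * P)) ≤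
          Γ * (2 * z + 4 * c * (P + 1)) := by
        have : 1 + z + 1 / 8 * (2 * (2 * z) + 4 * c * P) ≤ 2 * z + 4 * c * (P + 1) := by
          have : 0 ≤ c * P := by positivity
          linarith
        calc _ = Γ * (1 + z + 1 / 8 * (2 * (2 * z) + 4 * c * P)) := by ring
          _ ≤ _ := mul_le_mul_of_nonneg_left this hΓ0.le
      linarith
    · have h4 := mul_le_of_le_one_left hx0 hf.2
      have h5 : Γ * (1 + z) + Γ * (2 * (2 * z) + 4 * c * P) ≤
          Γ * (2 * z + 4 * c * (P + 1)) := by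
        have : 1 + z + (2 * (2 * z) + 4 * c * P) ≤ 2 * z + 4 * c * (P + 1) := by
          linarith [not_le.1 h]
        calc _ = Γ * (1 + z + (2 * (2 * z) + 4 * c * P)) := by ring
          _ ≤ _ := mul_le_mul_of_nonneg_left this hΓ0.le
      linarith

end EdgeEstimate

/-! ### One trial with a guess for the number of triangles -/

/-! ### Comparing the two running times with the target rate. -/

section CostArithmetic

/-- The rate with which the running times are compared. -/
noncomputable def queryRate (m T : ℝ) : ℝ := min (m / √T) (m * √m / T)

/-- This lets additive constants in the costs be absorbed. From `T ≤ m^{3/2} ≤ m²` both entries of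
the minimum are at least one. -/
theorem one_le_queryRate {m T : ℝ} (hm : 0 ≤ m) (hT : 1 ≤ T) (h : T ^ 2 ≤ m ^ 3) :
    1 ≤ queryRate m T := by
  have h1 : T ≤ m * √m := by
    refine abs_le_of_sq_le_sq' ?_ (by positivity) |>.2
    rw [mul_pow, Real.sq_sqrt hm]; linarith [h, pow_succ m 2]
  have hm1 : 1 ≤ m := by
    by_contra hlt
    push Not at hlt
    have : m ^ 3 < 1 := pow_lt_one₀ hm hlt (by norm_num)
    nlinarith
  refine le_min ?_ ?_
  · rw [le_div_iff₀ (by positivity), one_mul]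
    refine Real.sqrt_le_iff.2 ⟨hm, h1.trans ?_⟩
    have : √m ≤ m := Real.sqrt_le_iff.2 ⟨hm, by nlinarith⟩
    nlinarith
  · rw [le_div_iff₀ (by positivity)]; linarith

/-- Fourth powers of `b` and `β` are the second moments of the edge estimate available in
expectation; all lower powers that occur are dominated by them. -/
theorem monomials_le {b β : ℝ} (hb : 0 < b) (hβ : 0 < β) :
    b ≤ 1 + b ^ 4 + β ^ 4 ∧ b ^ 2 ≤ 1 + b ^ 4 + β ^ 4 ∧ b ^ 3 ≤ 1 + b ^ 4 + β ^ 4 ∧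
      β ≤ 1 + b ^ 4 + β ^ 4 ∧ 1 ≤ 1 + b ^ 4 + β ^ 4 := by
  have key : ∀ x : ℝ, 0 < x → x ≤ 1 + x ^ 4 ∧ x ^ 2 ≤ 1 + x ^ 4 ∧ x ^ 3 ≤ 1 + x ^ 4 := fun x hx => by
    rcases le_total x 1 with hx1 | hx1
    · have h4 : 0 ≤ x ^ 4 := by positivity
      exact ⟨by linarith, by linarith [pow_le_one₀ (n := 2) hx.le hx1],
        by linarith [pow_le_one₀ (n := 3) hx.le hx1]⟩
    · have h1 := pow_le_pow_right₀ hx1 (show 1 ≤ 4 by norm_num)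
      have h2 := pow_le_pow_right₀ hx1 (show 2 ≤ 4 by norm_num)
      have h3 := pow_le_pow_right₀ hx1 (show 3 ≤ 4 by norm_num)
      exact ⟨by linarith, by linarith, by linarith⟩
  have hb4 : 0 ≤ b ^ 4 := by positivity
  have hβ4 : 0 ≤ β ^ 4 := by positivity
  obtain ⟨h1, h2, h3⟩ := key b hb
  exact ⟨by linarith, by linarith, by linarith, by linarith [(key β hβ).1], by linarith⟩

variable {t τ μ r b β : ℝ}

/-- If `s k ≥ a` for one of the relevant monomials `s`, then the common bound dominates `a`. -/
theorem le_common_bound {a s k S : ℝ} (i : ℕ) (hi : i ≤ 4) (hr : 1 ≤ r) (hk : 0 ≤ k) (hs : 0 ≤ s)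
    (hsS : s ≤ S) (h : a ≤ r ^ i * s * k) : a ≤ r ^ 4 * S * k :=
  h.trans (mul_le_mul_of_nonneg_right
    (mul_le_mul (pow_le_pow_right₀ hr hi) hsS hs (by positivity)) hk)

/-- Here `t`, `τ`, `μ` stand for the square roots of `T`, `s`, `m`, the ratio `b = β⁻¹` for that of
`√(2^i)` to `√m`, and `r` for `√(max 1 (T/s))`. Square roots make all exponents integral, and each
cost term is compared with both entries of the minimum. The relation `τ ≤ b μ` is the case condition
`s ≤ 2^i`. -/
theorem vertex_cost_arith (ht : 0 < t) (hτ : 0 < τ) (hμ : 0 < μ) (hr : 1 ≤ r) (hb : 0 < b)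
    (hβ : 0 < β) (htτ : t ≤ r * τ) (hτν : τ ≤ b * μ)
    (h1 : 1 ≤ min (μ ^ 2 / t) (μ ^ 3 / t ^ 2)) :
    1 + μ ^ 2 / τ + t ^ 2 / τ + τ ≤
      4 * (r ^ 4 * (1 + b ^ 4 + β ^ 4) * min (μ ^ 2 / t) (μ ^ 3 / t ^ 2)) := by
  obtain ⟨e1, e2, e3, -, e5⟩ := monomials_le hb hβ
  have hr0 : 0 < r := by linarith
  have hk1 : 0 ≤ μ ^ 2 / t := by positivity
  have hk2 : 0 ≤ μ ^ 3 / t ^ 2 := by positivity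
  have ht2 : t ^ 2 ≤ r ^ 2 * τ ^ 2 := by rw [← mul_pow]; exact pow_le_pow_left₀ ht.le htτ 2
  have hτ2 : τ ^ 2 ≤ b ^ 2 * μ ^ 2 := by rw [← mul_pow]; exact pow_le_pow_left₀ hτ.le hτν 2
  have hτ3 : τ ^ 3 ≤ b ^ 3 * μ ^ 3 := by rw [← mul_pow]; exact pow_le_pow_left₀ hτ.le hτν 3
  have comm : ∀ W : ℝ, 0 ≤ W → W * min (μ ^ 2 / t) (μ ^ 3 / t ^ 2) =
      min (W * (μ ^ 2 / t)) (W * (μ ^ 3 / t ^ 2)) := fun W hW => mul_min_of_nonneg _ _ hW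
  have hW : 0 ≤ r ^ 4 * (1 + b ^ 4 + β ^ 4) := by positivity
  have a1 : (1 : ℝ) ≤ r ^ 4 * (1 + b ^ 4 + β ^ 4) * min (μ ^ 2 / t) (μ ^ 3 / t ^ 2) :=
    le_common_bound 0 (by norm_num) hr (by linarith) zero_le_one e5 (by simpa using h1)
  have a2 : μ ^ 2 / τ ≤ r ^ 4 * (1 + b ^ 4 + β ^ 4) * min (μ ^ 2 / t) (μ ^ 3 / t ^ 2) := by
    rw [comm _ hW]
    refine le_min (le_common_bound 1 (by norm_num) hr hk1 zero_le_one e5 ?_)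
      (le_common_bound 2 (by norm_num) hr hk2 hb.le e1 ?_)
    · rw [← mul_div_assoc, div_le_div_iff₀ hτ ht]
      nlinarith [mul_le_mul_of_nonneg_left htτ (sq_nonneg μ)]
    · rw [← mul_div_assoc, div_le_div_iff₀ hτ (by positivity)]
      calc μ ^ 2 * t ^ 2 ≤ μ ^ 2 * (r ^ 2 * τ ^ 2) := by gcongr
        _ = μ ^ 2 * r ^ 2 * τ * τ := by ring
        _ ≤ μ ^ 2 * r ^ 2 * τ * (b * μ) := by gcongr
        _ = _ := by ring
  have a4' : τ ≤ r * b ^ 2 * (μ ^ 2 / t) := by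
    rw [← mul_div_assoc, le_div_iff₀ ht]
    calc τ * t ≤ τ * (r * τ) := by gcongr
      _ = r * τ ^ 2 := by ring
      _ ≤ r * (b ^ 2 * μ ^ 2) := by gcongr
      _ = _ := by ring
  have a4'' : τ ≤ r ^ 2 * b ^ 3 * (μ ^ 3 / t ^ 2) := by
    rw [← mul_div_assoc, le_div_iff₀ (by positivity)]
    calc τ * t ^ 2 ≤ τ * (r ^ 2 * τ ^ 2) := by gcongr
      _ = r ^ 2 * τ ^ 3 := by ring
      _ ≤ r ^ 2 * (b ^ 3 * μ ^ 3) := by gcongr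
      _ = _ := by ring
  have a3' : t ^ 2 / τ ≤ r ^ 2 * τ := by
    rw [div_le_iff₀ hτ]; linarith [ht2]
  have a4 : τ ≤ r ^ 4 * (1 + b ^ 4 + β ^ 4) * min (μ ^ 2 / t) (μ ^ 3 / t ^ 2) := by
    rw [comm _ hW]
    exact le_min (le_common_bound 1 (by norm_num) hr hk1 (by positivity) e2 (by simpa using a4'))
      (le_common_bound 2 (by norm_num) hr hk2 (by positivity) e3 a4'')
  have a3 : t ^ 2 / τ ≤ r ^ 4 * (1 + b ^ 4 + β ^ 4) * min (μ ^ 2 / t) (μ ^ 3 / t ^ 2) := by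
    rw [comm _ hW]
    refine le_min (le_common_bound 3 (by norm_num) hr hk1 (by positivity) e2 (a3'.trans ?_))
      (le_common_bound 4 (by norm_num) hr hk2 (by positivity) e3 (a3'.trans ?_))
    · exact (mul_le_mul_of_nonneg_left a4' (by positivity)).trans_eq (by ring)
    · exact (mul_le_mul_of_nonneg_left a4'' (by positivity)).trans_eq (by ring)
  linarith

/-- The counterpart for `s > 2^i`. One entry of the minimum is reached directly and the other after
a factor `b` or `β`, so errors of the edge estimate in both directions enter. -/
theorem edgeApex_cost_arith (ht : 0 < t) (hτ : 0 < τ) (hμ : 0 < μ) (hr : 1 ≤ r) (hb : 0 < b)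
    (hβ : 0 < β) (hbβ : b * β = 1) (htτ : t ≤ r * τ) (hτν : b * μ ≤ τ)
    (h1 : 1 ≤ min (μ ^ 2 / t) (μ ^ 3 / t ^ 2)) :
    1 + μ ^ 2 * (b * μ / τ ^ 2) + μ ^ 3 / τ ^ 2 ≤
      3 * (r ^ 4 * (1 + b ^ 4 + β ^ 4) * min (μ ^ 2 / t) (μ ^ 3 / t ^ 2)) := by
  obtain ⟨e1, -, -, e4, e5⟩ := monomials_le hb hβ
  have hr0 : 0 < r := by linarith
  have hk1 : 0 ≤ μ ^ 2 / t := by positivity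
  have hk2 : 0 ≤ μ ^ 3 / t ^ 2 := by positivity
  have ht2 : t ^ 2 ≤ r ^ 2 * τ ^ 2 := by rw [← mul_pow]; exact pow_le_pow_left₀ ht.le htτ 2
  have comm : ∀ W : ℝ, 0 ≤ W → W * min (μ ^ 2 / t) (μ ^ 3 / t ^ 2) =
      min (W * (μ ^ 2 / t)) (W * (μ ^ 3 / t ^ 2)) := fun W hW => mul_min_of_nonneg _ _ hW
  have hW : 0 ≤ r ^ 4 * (1 + b ^ 4 + β ^ 4) := by positivity
  have a1 : (1 : ℝ) ≤ r ^ 4 * (1 + b ^ 4 + β ^ 4) * min (μ ^ 2 / t) (μ ^ 3 / t ^ 2) :=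
    le_common_bound 0 (by norm_num) hr (by linarith) zero_le_one e5 (by simpa using h1)
  have a3' : μ ^ 3 / τ ^ 2 ≤ r ^ 2 * 1 * (μ ^ 3 / t ^ 2) := by
    rw [← mul_div_assoc, div_le_div_iff₀ (by positivity) (by positivity)]
    calc μ ^ 3 * t ^ 2 ≤ μ ^ 3 * (r ^ 2 * τ ^ 2) := by gcongr
      _ = _ := by ring
  have a2' : μ ^ 2 * (b * μ / τ ^ 2) ≤ r ^ 1 * 1 * (μ ^ 2 / t) := by
    rw [← mul_div_assoc, ← mul_div_assoc, div_le_div_iff₀ (by positivity) ht]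
    calc μ ^ 2 * (b * μ) * t ≤ μ ^ 2 * τ * (r * τ) := by gcongr
      _ = _ := by ring
  have a2 : μ ^ 2 * (b * μ / τ ^ 2) ≤
      r ^ 4 * (1 + b ^ 4 + β ^ 4) * min (μ ^ 2 / t) (μ ^ 3 / t ^ 2) := by
    rw [comm _ hW]
    refine le_min (le_common_bound 1 (by norm_num) hr hk1 zero_le_one e5 a2')
      (le_common_bound 2 (by norm_num) hr hk2 hb.le e1 ?_)
    have := mul_le_mul_of_nonneg_left a3' hb.le
    calc _ = b * (μ ^ 3 / τ ^ 2) := by ring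
      _ ≤ _ := this
      _ = _ := by ring
  have a3 : μ ^ 3 / τ ^ 2 ≤
      r ^ 4 * (1 + b ^ 4 + β ^ 4) * min (μ ^ 2 / t) (μ ^ 3 / t ^ 2) := by
    rw [comm _ hW]
    refine le_min (le_common_bound 1 (by norm_num) hr hk1 hβ.le e4 ?_)
      (le_common_bound 2 (by norm_num) hr hk2 zero_le_one e5 a3')
    have := mul_le_mul_of_nonneg_left a2' hβ.le
    calc μ ^ 3 / τ ^ 2 = (b * β) * (μ ^ 3 / τ ^ 2) := by rw [hbβ, one_mul]
      _ = β * (μ ^ 2 * (b * μ / τ ^ 2)) := by ring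
      _ ≤ _ := this
      _ = _ := by ring
  linarith

end CostArithmetic

/-! ### The estimator selected by the guesses for `T` and `m`. -/

section Trial

variable {n : ℕ}

/-- The unbiased estimator that is cheapest for the guess `s` of the number of triangles and the
guess `2 ^ i` of the number of edges. -/
noncomputable def guessEstimate (n : ℕ) (s : ℝ) (i : ℕ) : RandTree n ℝ :=
  -- The condition imitates `T ≤ m`. In the other case `p q = 1/s` and `p = √(2^i)/s`, which puts
  -- both variance terms at scale `T s` when `2^i` is near `m`.
  if s ≤ 2 ^ i then vertexEstimate n (1 / √s)
  else edgeApexEstimate n (√(2 ^ i) / s) (1 / √(2 ^ i))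

variable (G : SimpleGraph (Fin n)) [DecidableRel G.Adj] {s : ℝ}

theorem sqrt_two_pow_pos (i : ℕ) : 0 < √((2 : ℝ) ^ i) := by positivity

theorem sqrt_two_pow_div_le_one {i : ℕ} (h : ¬ s ≤ 2 ^ i) : √((2 : ℝ) ^ i) / s ≤ 1 := by
  push Not at h
  have h1 : √((2 : ℝ) ^ i) ≤ 2 ^ i :=
    Real.sqrt_le_iff.2 ⟨by positivity, by nlinarith [one_le_pow₀ (M₀ := ℝ) one_le_two (n := i)]⟩
  have h2 : (0 : ℝ) < 2 ^ i := by positivity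
  rw [div_le_one (by linarith)]; linarith

theorem one_div_sqrt_le_one (hs : 1 ≤ s) : 1 / √s ≤ 1 := by
  have := Real.one_le_sqrt.2 hs
  rw [div_le_one (by linarith)]; exact this

theorem exp_guessEstimate (hs : 1 ≤ s) (i : ℕ) :
    (guessEstimate n s i).exp G (fun x => x) = triangleCount G := by
  have hs0 : 0 < s := by linarith
  unfold guessEstimate
  split_ifs with h
  · exact exp_vertexEstimate G (by positivity) (one_div_sqrt_le_one hs)
  · exact exp_edgeApexEstimate G (by positivity) (sqrt_two_pow_div_le_one h) (by positivity)
      (one_div_sqrt_le_one (one_le_pow₀ one_le_two))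

/-- All variance terms are of order `T² + T s`, hence at most a multiple of `max(T, s)²`. Only an
underestimate of `m` can increase the variance, and the hypothesis on `i` limits it to a factor
`2c`. -/
theorem variance_guessEstimate_le (hs : 1 ≤ s) {i : ℕ} {c : ℝ} (hc : 1 ≤ c)
    (hi : (edgeCount G : ℝ) ≤ 2 * c * 2 ^ i) :
    (guessEstimate n s i).exp G (fun x => (x - triangleCount G) ^ 2) ≤
      20 * logSize n ^ 2 * c * max (triangleCount G : ℝ) s ^ 2 := by
  have hs0 : 0 < s := by linarith
  have hL := one_le_logSize n
  set T : ℝ := (triangleCount G : ℝ) with hT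
  have hT0 : 0 ≤ T := by positivity
  have hTZ : T ≤ max T s := le_max_left _ _
  have hsZ : s ≤ max T s := le_max_right _ _
  set Z := max T s
  have hTs : T * s ≤ Z ^ 2 := by rw [sq]; exact mul_le_mul hTZ hsZ hs0.le (hT0.trans hTZ)
  have hTT : T ^ 2 ≤ Z ^ 2 := pow_le_pow_left₀ hT0 hTZ 2
  have hL2 : 1 ≤ logSize n ^ 2 := one_le_pow₀ hL
  have hLc : 1 ≤ logSize n ^ 2 * c := one_le_mul_of_one_le_of_one_le hL2 hc
  unfold guessEstimate
  split_ifs with h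
  · refine (variance_vertexEstimate_le G (by positivity) (one_div_sqrt_le_one hs)).trans ?_
    have e : T / (1 / √s) ^ 2 = T * s := by
      rw [div_pow, Real.sq_sqrt hs0.le]; field_simp
    rw [← hT, e]
    nlinarith [mul_nonneg (sub_nonneg.2 hLc) (sq_nonneg Z), sq_nonneg Z]
  · refine (variance_edgeApexEstimate_le G (by positivity) (sqrt_two_pow_div_le_one h)
      (by positivity) (one_div_sqrt_le_one (one_le_pow₀ one_le_two))).trans ?_
    have hν := sqrt_two_pow_pos i
    have hm : √(edgeCount G : ℝ) ≤ 2 * c * √(2 ^ i) := by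
      refine Real.sqrt_le_iff.2 ⟨by positivity, hi.trans ?_⟩
      rw [mul_pow, Real.sq_sqrt (by positivity)]
      gcongr
      nlinarith
    have e1 : 2 * logSize n * T / (√(2 ^ i) / s * (1 / √(2 ^ i))) = 2 * logSize n * (T * s) := by
      field_simp
    have e2 : 9 * logSize n ^ 2 * T * √(edgeCount G : ℝ) / (√(2 ^ i) / s) ≤
        18 * logSize n ^ 2 * c * (T * s) := by
      rw [div_le_iff₀ (by positivity)]
      calc _ ≤ 9 * logSize n ^ 2 * T * (2 * c * √(2 ^ i)) := by gcongr
        _ = _ := by field_simp; ring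
    rw [← hT, e1]
    have hLL : logSize n ≤ logSize n ^ 2 * c := by nlinarith
    calc _ ≤ 2 * (logSize n ^ 2 * c) * (T * s) + 18 * logSize n ^ 2 * c * (T * s) := by gcongr
      _ = 20 * logSize n ^ 2 * c * (T * s) := by ring
      _ ≤ _ := by gcongr

theorem cost_guessEstimate_le (hs : 1 ≤ s) (hT : 1 ≤ triangleCount G) (i : ℕ) :
    (guessEstimate n s i).cost G ≤ 72 * logSize n * listFactor n *
      (max 1 ((triangleCount G : ℝ) / s) ^ 2 *
        (1 + (2 ^ i / (edgeCount G : ℝ)) ^ 2 + ((edgeCount G : ℝ) * (1 / 2) ^ i) ^ 2) *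
        queryRate (edgeCount G) (triangleCount G)) := by
  have hs0 : 0 < s := by linarith
  have hL := one_le_logSize n
  have hΛ := one_le_listFactor n
  have hTm := triangleCount_sq_le G
  set T : ℝ := (triangleCount G : ℝ) with hTdef
  set m : ℝ := (edgeCount G : ℝ) with hmdef
  have hT1 : 1 ≤ T := by rw [hTdef]; exact_mod_cast hT
  have hm0 : 0 ≤ m := by positivity
  have hrate := one_le_queryRate hm0 hT1 hTm
  have hmpos : 0 < m := by
    rcases hm0.eq_or_lt with h | h
    · rw [← h] at hTm; nlinarith
    · exact h
  have hν := sqrt_two_pow_pos i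
  have ht : 0 < √T := by positivity
  have hτ : 0 < √s := by positivity
  have hμ : 0 < √m := by positivity
  have hμ2 : √m ^ 2 = m := Real.sq_sqrt hm0
  have ht2 : √T ^ 2 = T := Real.sq_sqrt (by linarith)
  have hτ2 : √s ^ 2 = s := Real.sq_sqrt hs0.le
  have hν2 : √((2 : ℝ) ^ i) ^ 2 = 2 ^ i := Real.sq_sqrt (by positivity)
  have hμ3 : √m ^ 3 = m * √m := by rw [pow_succ, hμ2]
  have hb : 0 < √((2 : ℝ) ^ i) / √m := by positivity
  have hβ : 0 < √m / √((2 : ℝ) ^ i) := by positivity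
  have hbβ : √((2 : ℝ) ^ i) / √m * (√m / √((2 : ℝ) ^ i)) = 1 := by field_simp
  have hbμ : √((2 : ℝ) ^ i) / √m * √m = √(2 ^ i) := by field_simp
  have hb4 : (√((2 : ℝ) ^ i) / √m) ^ 4 = (2 ^ i / m) ^ 2 := by
    rw [show 4 = 2 * 2 by norm_num, pow_mul, div_pow, hν2, hμ2]
  have hβ4 : (√m / √((2 : ℝ) ^ i)) ^ 4 = (m * (1 / 2) ^ i) ^ 2 := by
    rw [show 4 = 2 * 2 by norm_num, pow_mul, div_pow, hν2, hμ2, one_div_pow, mul_one_div]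
  have hr : 1 ≤ √(max 1 (T / s)) := Real.one_le_sqrt.2 (le_max_left _ _)
  have hr4 : √(max 1 (T / s)) ^ 4 = max 1 (T / s) ^ 2 := by
    rw [show 4 = 2 * 2 by norm_num, pow_mul, Real.sq_sqrt (by positivity)]
  have htτ : √T ≤ √(max 1 (T / s)) * √s := by
    rw [← Real.sqrt_mul (by positivity)]
    refine Real.sqrt_le_sqrt ?_
    calc T = T / s * s := by field_simp
      _ ≤ _ := by gcongr; exact le_max_right _ _
  have hq : queryRate m T = min (√m ^ 2 / √T) (√m ^ 3 / √T ^ 2) := by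
    rw [queryRate, hμ2, hμ3, ht2]
  rw [hq] at hrate ⊢
  rw [← hr4, ← hb4, ← hβ4]
  have hW : 0 ≤ √(max 1 (T / s)) ^ 4 * (1 + (√((2 : ℝ) ^ i) / √m) ^ 4 +
      (√m / √((2 : ℝ) ^ i)) ^ 4) * min (√m ^ 2 / √T) (√m ^ 3 / √T ^ 2) := by positivity
  unfold guessEstimate
  split_ifs with h
  · refine (cost_vertexEstimate_le G (by positivity) (one_div_sqrt_le_one hs)).trans ?_
    have key := vertex_cost_arith ht hτ hμ hr hb hβ htτ
      (by rw [hbμ]; exact Real.sqrt_le_sqrt h) hrate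
    rw [← hTdef, ← hmdef]
    have e : 1 + m * (1 / √s) + T * (1 / √s) + 1 / (1 / √s) =
        1 + √m ^ 2 / √s + √T ^ 2 / √s + √s := by
      rw [hμ2, ht2]; simp only [mul_one_div, one_div_one_div]
    rw [e]
    refine (mul_le_mul_of_nonneg_left key (by positivity)).trans ?_
    rw [show ∀ W : ℝ, 18 * listFactor n * (4 * W) = 72 * 1 * listFactor n * W by intro W; ring]
    gcongr
  · push Not at h
    refine (cost_edgeApexEstimate_le G (by positivity) (sqrt_two_pow_div_le_one h.not_ge)
      (by positivity) (one_div_sqrt_le_one (one_le_pow₀ one_le_two))).trans ?_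
    have key := edgeApex_cost_arith ht hτ hμ hr hb hβ hbβ htτ
      (by rw [hbμ]; exact Real.sqrt_le_sqrt h.le) hrate
    rw [hbμ] at key
    rw [← hmdef]
    have e : 1 + m * (√(2 ^ i) / s) + √(2 ^ i) / s * (1 / √(2 ^ i)) * (m * √m) =
        1 + √m ^ 2 * (√(2 ^ i) / √s ^ 2) + √m ^ 3 / √s ^ 2 := by
      rw [hμ3, hμ2, hτ2]; field_simp
    rw [e]
    refine (mul_le_mul_of_nonneg_left key (by positivity)).trans ?_
    rw [show ∀ W : ℝ, 14 * logSize n * listFactor n * (3 * W) =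
      42 * logSize n * listFactor n * W by intro W; ring]
    gcongr
    norm_num

end Trial

/-! ### A trial: crude edge estimate followed by averaging. -/

section Trial

variable {n : ℕ}

/-- The threshold for the number of sampled edges. -/
noncomputable def edgeThreshold (n : ℕ) : ℝ := 768 * logSize n ^ 3

/-- The number of independent copies that are averaged. -/
noncomputable def repetitions (n : ℕ) (ε : ℝ) : ℕ :=
  -- The constant is `20 · 4 · 32`: variance constant, the `1/4` from the squared tolerance `ε/2`,
  -- and target failure probability `1/(32 L²)` with `L = logSize n`.
  ⌈2560 * logSize n ^ 4 * edgeThreshold n / ε ^ 2⌉₊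

/-- An estimate of the number of triangles, based on the guess `s` of that number. -/
noncomputable def trial (n : ℕ) (ε s : ℝ) : RandTree n ℝ :=
  (edgeExponent n (edgeThreshold n) (2 * bits n)).bind fun i =>
    average (repetitions n ε) (guessEstimate n s i)

/-- The polylogarithmic factor in the cost of a trial. -/
noncomputable def trialFactor (n : ℕ) (ε : ℝ) : ℝ :=
  1768 * repetitions n ε * logSize n ^ 2 * listFactor n * edgeThreshold n ^ 2

theorem one_le_edgeThreshold (n : ℕ) : 1 ≤ edgeThreshold n := by
  have := one_le_pow₀ (n := 3) (one_le_logSize n)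
  unfold edgeThreshold; linarith

theorem logSize_le_edgeThreshold (n : ℕ) : 192 * logSize n ≤ edgeThreshold n := by
  have h := one_le_logSize n
  have := pow_le_pow_right₀ h (show 1 ≤ 3 by norm_num)
  unfold edgeThreshold; linarith

theorem one_le_repetitions (n : ℕ) {ε : ℝ} (hε : 0 < ε) : 1 ≤ repetitions n ε := by
  have := one_le_logSize n
  have := one_le_edgeThreshold n
  exact Nat.ceil_pos.2 (by positivity)

variable (G : SimpleGraph (Fin n)) [DecidableRel G.Adj] {ε s : ℝ}

theorem edgeCount_le_sq : (edgeCount G : ℝ) ≤ n ^ 2 := by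
  have h := sum_degR G
  have : ∑ u, degR G u ≤ ∑ _u : Fin n, (n : ℝ) := Finset.sum_le_sum fun u _ => degR_le G u
  simp only [Finset.sum_const, Finset.card_univ, Fintype.card_fin, nsmul_eq_mul] at this
  nlinarith [Nat.cast_nonneg (α := ℝ) (edgeCount G)]

theorem edgeCount_le_two_pow : (edgeCount G : ℝ) ≤ 2 ^ (2 * bits n) := by
  refine (edgeCount_le_sq G).trans ?_
  rw [mul_comm, pow_mul]
  have : (n : ℝ) ≤ 2 ^ bits n := by exact_mod_cast le_two_pow_bits n
  gcongr

theorem six_mul_triangleCount_le : 6 * (triangleCount G : ℝ) ≤ n ^ 3 := by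
  have h : ∑ u, ∑ v, ∑ w, triInd G u v w ≤ ∑ _u : Fin n, ∑ _v : Fin n, ∑ _w : Fin n, (1 : ℝ) :=
    Finset.sum_le_sum fun u _ => Finset.sum_le_sum fun v _ => Finset.sum_le_sum fun w _ =>
      triInd_le_one G u v w
  simp only [Finset.sum_const, Finset.card_univ, Fintype.card_fin, nsmul_eq_mul, mul_one] at h
  rw [sum_triInd] at h
  exact h.trans_eq (by ring)

theorem triangleCount_le_two_pow : (triangleCount G : ℝ) ≤ 2 ^ (3 * bits n) := by
  have h2 : (n : ℝ) ≤ 2 ^ bits n := by exact_mod_cast le_two_pow_bits n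
  have h3 : (n : ℝ) ^ 3 ≤ (2 ^ bits n) ^ 3 := by gcongr
  rw [mul_comm 3, pow_mul]
  linarith [six_mul_triangleCount_le G, Nat.cast_nonneg (α := ℝ) (triangleCount G)]

theorem two_le_of_triangleCount_pos (hT : 1 ≤ triangleCount G) : 2 ≤ n := by
  by_contra hn
  have h2 : (n : ℝ) ≤ 1 := by exact_mod_cast (show n ≤ 1 by omega)
  have h3 : (n : ℝ) ^ 3 ≤ 1 := pow_le_one₀ (by positivity) h2
  have h4 : (1 : ℝ) ≤ triangleCount G := by exact_mod_cast hT
  linarith [six_mul_triangleCount_le G]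

/-- Two failures of probability `1/(32 L²)` each, with `L = logSize n`: a severe underestimate of
`m`, where `24 L / (768 L³)` explains the threshold, and a Chebyshev deviation of the average. -/
theorem prob_trial_le (hε : 0 < ε) (hs : 1 ≤ s) :
    ((trial n ε s).exp G).prob
      (fun x => ε / 2 * max (triangleCount G : ℝ) s < |x - triangleCount G|) ≤
      1 / (16 * logSize n ^ 2) := by
  have hL := one_le_logSize n
  have hc := one_le_edgeThreshold n
  have hk := one_le_repetitions n hε
  set Z := max (triangleCount G : ℝ) s with hZ
  have hZ0 : 0 < Z := lt_of_lt_of_le (by linarith) (le_max_right _ _)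
  have key : ∀ i, ((average (repetitions n ε) (guessEstimate n s i)).exp G).prob
      (fun x => ε / 2 * Z < |x - triangleCount G|) ≤
      (if 2 * edgeThreshold n * 2 ^ i < (edgeCount G : ℝ) then 1 else 0) +
        1 / (32 * logSize n ^ 2) := by
    intro i
    split_ifs with h
    · exact (Expectation.prob_le_one _ _).trans (le_add_of_nonneg_right (by positivity))
    · rw [zero_add]
      refine (Expectation.prob_abs_le _ (by positivity)).trans ?_
      rw [variance_average G (exp_guessEstimate G hs i) hk]
      have hv := variance_guessEstimate_le G hs hc (not_lt.1 h)
      rw [← hZ] at hv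
      have hk' : 2560 * logSize n ^ 4 * edgeThreshold n ≤ repetitions n ε * ε ^ 2 :=
        (div_le_iff₀ (by positivity)).1 (Nat.le_ceil _)
      have hk0 : (0 : ℝ) < repetitions n ε := by exact_mod_cast hk
      rw [div_div, div_le_div_iff₀ (by positivity) (by positivity), one_mul]
      calc _ ≤ 20 * logSize n ^ 2 * edgeThreshold n * Z ^ 2 * (32 * logSize n ^ 2) := by gcongr
        _ = 2560 * logSize n ^ 4 * edgeThreshold n * (Z ^ 2 / 4) := by ring
        _ ≤ repetitions n ε * ε ^ 2 * (Z ^ 2 / 4) := by gcongr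
        _ = _ := by ring
  have hu := prob_underestimate_le G (c := edgeThreshold n) (by linarith) (2 * bits n)
    (by nlinarith [edgeCount_le_two_pow G, pow_pos (two_pos (α := ℝ)) (2 * bits n)])
  calc _ = (edgeExponent n (edgeThreshold n) (2 * bits n)).exp G (fun i =>
        ((average (repetitions n ε) (guessEstimate n s i)).exp G).prob
          (fun x => ε / 2 * Z < |x - triangleCount G|)) := by
        simp only [Expectation.prob, trial, RandTree.exp_bind]
    _ ≤ _ := Expectation.mono _ key
    _ = _ := Expectation.add _ _ _
    _ ≤ 24 * logSize n / edgeThreshold n + 1 / (32 * logSize n ^ 2) := by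
        rw [Expectation.const]; gcongr
    _ = _ := by
        unfold edgeThreshold
        field_simp
        norm_num

/-- The estimator's cost depends on the random exponent only through the two squared ratios, whose
expectations were bounded; the cost of finding the exponent is polylogarithmic and absorbed since
the target rate is at least one. -/
theorem cost_trial_le (hε : 0 < ε) (hs : 1 ≤ s) (hT : 1 ≤ triangleCount G) :
    (trial n ε s).cost G ≤ trialFactor n ε * (max 1 ((triangleCount G : ℝ) / s) ^ 2 *
      queryRate (edgeCount G) (triangleCount G)) := by
  have hL := one_le_logSize n
  have hΛ := one_le_listFactor n
  have hc := one_le_edgeThreshold n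
  have hk : (1 : ℝ) ≤ repetitions n ε := by exact_mod_cast one_le_repetitions n hε
  have hT1 : (1 : ℝ) ≤ triangleCount G := by exact_mod_cast hT
  have hTm := triangleCount_sq_le G
  have hrate := one_le_queryRate (Nat.cast_nonneg _) hT1 hTm
  have hm : 1 ≤ edgeCount G := by
    by_contra h
    have : edgeCount G = 0 := by omega
    rw [this] at hTm; norm_num at hTm; nlinarith
  have hx : 1 ≤ max 1 ((triangleCount G : ℝ) / s) ^ 2 := one_le_pow₀ (le_max_left _ _)
  set L := logSize n with hLdef
  set Λ := listFactor n
  set c := edgeThreshold n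
  set k : ℝ := (repetitions n ε : ℝ)
  set x := max 1 ((triangleCount G : ℝ) / s) ^ 2
  set κ := queryRate (edgeCount G) (triangleCount G)
  have hxκ : 1 ≤ x * κ := one_le_mul_of_one_le_of_one_le hx hrate
  have hbits : (bits n : ℝ) = L - 1 := by rw [hLdef, logSize]; ring
  have hmP : (edgeCount G : ℝ) * (1 / 2) ^ (2 * bits n) ≤ 1 := by
    rw [one_div_pow, mul_one_div, div_le_one (by positivity)]
    exact edgeCount_le_two_pow G
  have hmP0 : 0 ≤ (edgeCount G : ℝ) * (1 / 2) ^ (2 * bits n) := by positivity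
  have hcost : (edgeExponent n c (2 * bits n)).cost G ≤ 256 * L ^ 2 * Λ * c := by
    refine (cost_edgeExponent_le G (logSize_le_edgeThreshold n) (2 * bits n)).trans ?_
    push_cast
    rw [hbits]
    calc _ ≤ 32 * L * Λ * (8 * c * L) := by
          refine mul_le_mul_of_nonneg_left ?_ (by positivity)
          nlinarith
      _ = _ := by ring
  have ho := exp_overestimate_le G (c := c) (by linarith [logSize_le_edgeThreshold n]) hm (2 * bits n)
  have hu := exp_underestimate_le G (c := c) (logSize_le_edgeThreshold n) (2 * bits n)
  have hsq : ((edgeCount G : ℝ) * (1 / 2) ^ (2 * bits n)) ^ 2 ≤ 1 := pow_le_one₀ hmP0 hmP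
  push_cast at ho hu
  rw [hbits] at ho hu
  have hY : (edgeExponent n c (2 * bits n)).exp G (fun i => 1 + (2 ^ i / (edgeCount G : ℝ)) ^ 2 +
      ((edgeCount G : ℝ) * (1 / 2) ^ i) ^ 2) ≤ 21 * L * c ^ 2 := by
    rw [Expectation.add, Expectation.add, Expectation.const]
    have hc2 : 1 ≤ c ^ 2 := one_le_pow₀ hc
    nlinarith [mul_nonneg (sub_nonneg.2 hL) (sub_nonneg.2 hc2)]
  rw [trial, RandTree.cost_bind]
  have hexp : (edgeExponent n c (2 * bits n)).exp G
      (fun i => (average (repetitions n ε) (guessEstimate n s i)).cost G) ≤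
      k * (72 * L * Λ) * (x * κ) * (21 * L * c ^ 2) := by
    calc _ ≤ (edgeExponent n c (2 * bits n)).exp G (fun i => k * (72 * L * Λ) * (x * κ) *
          (1 + (2 ^ i / (edgeCount G : ℝ)) ^ 2 + ((edgeCount G : ℝ) * (1 / 2) ^ i) ^ 2)) := by
          refine Expectation.mono _ fun i => ?_
          rw [cost_average]
          refine (mul_le_mul_of_nonneg_left (cost_guessEstimate_le G hs hT i)
            (by positivity)).trans_eq ?_
          ring
      _ ≤ _ := by
          rw [Expectation.const_mul]
          gcongr
  have h1 : 256 * L ^ 2 * Λ * c ≤ 256 * L ^ 2 * Λ * c ^ 2 * (k * (x * κ)) := by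
    have h2 : c ≤ c ^ 2 := by nlinarith
    have h3 : 1 ≤ k * (x * κ) := one_le_mul_of_one_le_of_one_le hk hxκ
    calc 256 * L ^ 2 * Λ * c ≤ 256 * L ^ 2 * Λ * c ^ 2 := by gcongr
      _ ≤ _ := le_mul_of_one_le_right (by positivity) h3
  calc _ ≤ 256 * L ^ 2 * Λ * c ^ 2 * (k * (x * κ)) +
        k * (72 * L * Λ) * (x * κ) * (21 * L * c ^ 2) := add_le_add (hcost.trans h1) hexp
    _ = _ := by unfold trialFactor; ring

end Trial

/-! ### The search for the number of triangles -/

section Search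

variable {n : ℕ}

/-- Lists all edges and counts the triangles. -/
noncomputable def exactCount (n : ℕ) : RandTree n ℝ :=
  .ofQueryTree ((listEdges Finset.univ Finset.univ).map fun F =>
    (∑ u, ∑ v, ∑ w, memInd F (u, v) * memInd F (u, w) * memInd F (v, w)) / 6)

/-- Tries the guesses `2 ^ (j - 1), …, 2, 1` until an estimate confirms the guess; if none does,
counts exactly. -/
noncomputable def guessSearch (n : ℕ) (ε : ℝ) : ℕ → RandTree n ℝ
  | 0 => exactCount n
  | j + 1 => (trial n ε (2 ^ j)).bind fun x => if 2 * 2 ^ j ≤ x then .ret x else guessSearch n ε j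

variable (G : SimpleGraph (Fin n)) [DecidableRel G.Adj] {ε : ℝ}

theorem exp_exactCount (f : ℝ → ℝ) : (exactCount n).exp G f = f (triangleCount G) := by
  have h : ∀ u v, memInd (edgesIn G Finset.univ Finset.univ) (u, v) = adjInd G u v := fun u v => by
    rw [memInd_edgesIn]; simp [memInd]
  have h6 : ∑ u, ∑ v, ∑ w, adjInd G u v * adjInd G u w * adjInd G v w = 6 * triangleCount G :=
    sum_triInd G
  simp only [exactCount, RandTree.exp_ofQueryTree, QueryTree.eval_map, eval_listEdges, h, h6]
  congr 1; ring

theorem cost_exactCount_le : (exactCount n).cost G ≤ listFactor n * (1 + 2 * edgeCount G) := by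
  have h : ((edgesIn G Finset.univ Finset.univ).card : ℝ) = 2 * edgeCount G := by
    rw [card_edgesIn, ← sum_adjInd]; simp
  simpa only [exactCount, RandTree.cost_ofQueryTree, QueryTree.cost_map, h] using
    cost_listEdges G Finset.univ Finset.univ

/-- A confirmed guess comes with an approximation, unless the trial failed. -/
theorem isApproximation_of_confirmed {T s x : ℝ} (hε1 : ε < 1) (hs : 0 < s)
    (hx : |x - T| ≤ ε / 2 * max T s) (h : 2 * s ≤ x) : IsApproximation ε x T := by
  obtain ⟨h1, h2⟩ := abs_le.1 hx
  rcases le_total T s with hTs | hTs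
  -- A guess with `T ≤ s` cannot be confirmed by a good trial, since then `x ≤ T + ε s / 2 < 2 s`.
  · rw [max_eq_right hTs] at h2; nlinarith
  · rw [max_eq_left hTs] at h1 h2
    exact ⟨by nlinarith, by nlinarith⟩

/-- A union bound over the trials: if none fails, the output is either a confirmed and hence
accurate estimate or the exact count. -/
theorem prob_guessSearch_le (hε0 : 0 < ε) (hε1 : ε < 1) (j : ℕ) :
    ((guessSearch n ε j).exp G).prob (fun x => ¬ IsApproximation ε x (triangleCount G)) ≤
      j * (1 / (16 * logSize n ^ 2)) := by
  have hT0 : (0 : ℝ) ≤ triangleCount G := by positivity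
  have hδ : 0 ≤ 1 / (16 * logSize n ^ 2) := by positivity
  induction j with
  | zero =>
    have : IsApproximation ε (triangleCount G) (triangleCount G) :=
      ⟨by nlinarith, by nlinarith⟩
    simp [Expectation.prob, guessSearch, exp_exactCount, this]
  | succ j ih =>
    have hs : (1 : ℝ) ≤ 2 ^ j := one_le_pow₀ one_le_two
    have ht := prob_trial_le G hε0 hs
    have key : ∀ x : ℝ, ((if 2 * 2 ^ j ≤ x then .ret x else guessSearch n ε j :
        RandTree n ℝ).exp G).prob (fun x => ¬ IsApproximation ε x (triangleCount G)) ≤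
        (by classical exact if ε / 2 * max (triangleCount G : ℝ) (2 ^ j) < |x - triangleCount G|
          then 1 else 0) + j * (1 / (16 * logSize n ^ 2)) := by
      intro x
      by_cases hbad : ε / 2 * max (triangleCount G : ℝ) (2 ^ j) < |x - triangleCount G|
      · rw [if_pos hbad]
        exact (Expectation.prob_le_one _ _).trans (le_add_of_nonneg_right (by positivity))
      · rw [if_neg hbad, zero_add]
        split_ifs with h
        · have := isApproximation_of_confirmed hε1 (by positivity) (not_lt.1 hbad) h
          simp only [Expectation.prob, RandTree.exp_ret, this, not_true_eq_false, if_false]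
          positivity
        · exact ih
    calc _ = (trial n ε (2 ^ j)).exp G (fun x =>
          ((if 2 * 2 ^ j ≤ x then .ret x else guessSearch n ε j :
            RandTree n ℝ).exp G).prob (fun x => ¬ IsApproximation ε x (triangleCount G))) := by
          simp only [Expectation.prob, guessSearch, RandTree.exp_bind]
      _ ≤ _ := Expectation.mono _ key
      _ = _ := Expectation.add _ _ _
      _ ≤ 1 / (16 * logSize n ^ 2) + j * (1 / (16 * logSize n ^ 2)) := by
          rw [Expectation.const]; exact add_le_add_left ht _
      _ = _ := by push_cast; ring

/-- The square in the bound is the inflation of a trial's cost when its guess is too small. It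
quadruples with each further guess, whereas below `T/4` each further guess is reached with
conditional probability at most `1/16`. -/
theorem cost_guessSearch_le (hε0 : 0 < ε) (hε1 : ε < 1) (hT : 1 ≤ triangleCount G) (j : ℕ) :
    (guessSearch n ε j).cost G ≤ trialFactor n ε * queryRate (edgeCount G) (triangleCount G) *
      (8 * ((triangleCount G : ℝ) / 2 ^ j) ^ 2 + 145 * j) := by
  have hL := one_le_logSize n
  have hΛ := one_le_listFactor n
  have hc := one_le_edgeThreshold n
  have hk : (1 : ℝ) ≤ repetitions n ε := by exact_mod_cast one_le_repetitions n hε0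
  have hT1 : (1 : ℝ) ≤ triangleCount G := by exact_mod_cast hT
  have hTm := triangleCount_sq_le G
  have hrate := one_le_queryRate (Nat.cast_nonneg _) hT1 hTm
  have hm : 1 ≤ edgeCount G := by
    by_contra h
    have : edgeCount G = 0 := by omega
    rw [this] at hTm; norm_num at hTm; nlinarith
  have hm1 : (1 : ℝ) ≤ edgeCount G := by exact_mod_cast hm
  have hΓ : listFactor n ≤ trialFactor n ε := by
    have h1 : 1 ≤ logSize n ^ 2 * edgeThreshold n ^ 2 :=
      one_le_mul_of_one_le_of_one_le (one_le_pow₀ hL) (one_le_pow₀ hc)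
    have h2 := one_le_mul_of_one_le_of_one_le hk h1
    have h3 : trialFactor n ε = 1768 * listFactor n *
        (repetitions n ε * (logSize n ^ 2 * edgeThreshold n ^ 2)) := by unfold trialFactor; ring
    rw [h3]; nlinarith
  have hΓ0 : 0 ≤ trialFactor n ε := by linarith
  set T : ℝ := (triangleCount G : ℝ) with hTdef
  set κ := queryRate (edgeCount G) T with hκ
  induction j with
  | zero =>
    -- The exact count costs about `m`, which the inflation factor `T²` of the last guess more than
    -- covers.
    have hmκ : (edgeCount G : ℝ) ≤ κ * T ^ 2 := by
      have hs1 : 1 ≤ √(edgeCount G : ℝ) := Real.one_le_sqrt.2 hm1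
      have hst : √T ≤ T := Real.sqrt_le_iff.2 ⟨by linarith, by nlinarith⟩
      rw [hκ, queryRate, min_mul_of_nonneg _ _ (by positivity)]
      refine le_min ?_ ?_
      · rw [div_mul_eq_mul_div, le_div_iff₀ (by positivity)]
        gcongr
        nlinarith
      · rw [div_mul_eq_mul_div, le_div_iff₀ (by positivity), mul_assoc]
        gcongr
        nlinarith [mul_nonneg (sub_nonneg.2 hs1) (sq_nonneg T)]
    calc _ ≤ listFactor n * (1 + 2 * edgeCount G) := cost_exactCount_le G
      _ ≤ trialFactor n ε * (8 * (κ * T ^ 2)) := by gcongr; linarith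
      _ = _ := by norm_num; ring
  | succ j ih =>
    have hs : (1 : ℝ) ≤ 2 ^ j := one_le_pow₀ one_le_two
    have hs0 : (0 : ℝ) < 2 ^ j := by positivity
    have ht := prob_trial_le G hε0 hs
    have hct := cost_trial_le G hε0 hs hT
    rw [← hTdef, ← hκ] at hct
    rw [← hTdef] at ht
    have hx : (T / 2 ^ (j + 1)) ^ 2 = (T / 2 ^ j) ^ 2 / 4 := by
      rw [show T / 2 ^ (j + 1) = T / 2 ^ j / 2 by rw [pow_succ]; field_simp]; ring
    have hmax : max 1 (T / 2 ^ j) ^ 2 ≤ 1 + (T / 2 ^ j) ^ 2 := by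
      rcases le_total 1 (T / 2 ^ j) with h | h
      · rw [max_eq_right h]; linarith
      · rw [max_eq_left h]; nlinarith [sq_nonneg (T / 2 ^ j)]
    have hct' : (trial n ε (2 ^ j)).cost G ≤
        trialFactor n ε * κ * (1 + (T / 2 ^ j) ^ 2) := by
      refine hct.trans ?_
      calc _ = trialFactor n ε * κ * max 1 (T / 2 ^ j) ^ 2 := by ring
        _ ≤ _ := by gcongr
    have hΓκ : 0 ≤ trialFactor n ε * κ := by positivity
    have hnn := RandTree.cost_nonneg G (guessSearch n ε j)
    rw [guessSearch, RandTree.cost_bind, hx]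
    set y := (T / 2 ^ j) ^ 2 with hy
    have hy0 : 0 ≤ y := sq_nonneg _
    by_cases hcase : 4 * 2 ^ j ≤ T
    · have hexp : (trial n ε (2 ^ j)).exp G (fun x => RandTree.cost G
          (if 2 * 2 ^ j ≤ x then .ret x else guessSearch n ε j)) ≤
          1 / 16 * (guessSearch n ε j).cost G := by
        calc _ ≤ (trial n ε (2 ^ j)).exp G (fun x =>
              (by classical exact if ε / 2 * max T (2 ^ j) < |x - T| then 1 else 0) *
                (guessSearch n ε j).cost G) := by
              refine Expectation.mono _ fun x => ?_
              by_cases h : 2 * 2 ^ j ≤ x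
              · rw [if_pos h, RandTree.cost_ret]
                refine mul_nonneg ?_ hnn
                split_ifs <;> norm_num
              -- Not confirming means `x < 2 · 2^j ≤ T/2`, an error larger than `ε T / 2`, so
              -- continuing implies that the trial failed.
              · have hbad : ε / 2 * max T (2 ^ j) < |x - T| := by
                  rw [max_eq_left (by linarith), abs_sub_comm]
                  refine lt_of_lt_of_le ?_ (le_abs_self _)
                  push Not at h
                  nlinarith
                rw [if_neg h, if_pos hbad, one_mul]
          _ = ((trial n ε (2 ^ j)).exp G).prob (fun x => ε / 2 * max T (2 ^ j) < |x - T|) *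
              (guessSearch n ε j).cost G := Expectation.mul_const _ _ _
          _ ≤ _ := by
              refine mul_le_mul_of_nonneg_right (ht.trans ?_) hnn
              have : 1 ≤ logSize n ^ 2 := one_le_pow₀ hL
              exact one_div_le_one_div_of_le (by norm_num) (by linarith)
      calc _ ≤ trialFactor n ε * κ * (1 + y) +
            1 / 16 * (trialFactor n ε * κ * (8 * y + 145 * j)) := by
            refine add_le_add hct' (hexp.trans ?_); gcongr
        _ = trialFactor n ε * κ * (1 + y + 1 / 16 * (8 * y + 145 * j)) := by ring
        _ ≤ _ := by
            refine mul_le_mul_of_nonneg_left ?_ hΓκ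
            push_cast
            linarith [Nat.cast_nonneg (α := ℝ) j]
    -- For guesses above `T/4` the search may well continue, so the recursive cost is taken in full.
    -- The inflation is bounded there, and `1 + 9 · 16 = 145` per guess covers the increase.
    · have hy16 : y ≤ 16 := by
        have : T / 2 ^ j ≤ 4 := by rw [div_le_iff₀ hs0]; linarith
        have h0 : 0 ≤ T / 2 ^ j := by positivity
        rw [hy]; nlinarith
      have hexp : (trial n ε (2 ^ j)).exp G (fun x => RandTree.cost G
          (if 2 * 2 ^ j ≤ x then .ret x else guessSearch n ε j)) ≤ (guessSearch n ε j).cost G := by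
        refine Expectation.le_const _ fun x => ?_
        split_ifs
        · simpa using hnn
        · exact le_rfl
      calc _ ≤ trialFactor n ε * κ * (1 + y) + trialFactor n ε * κ * (8 * y + 145 * j) :=
            add_le_add hct' (hexp.trans ih)
        _ = trialFactor n ε * κ * (1 + y + (8 * y + 145 * j)) := by ring
        _ ≤ _ := by
            refine mul_le_mul_of_nonneg_left ?_ hΓκ
            push_cast
            linarith

/-- The estimator of the number of triangles. -/
noncomputable def triangleSearch (n : ℕ) (ε : ℝ) : RandTree n ℝ :=
  guessSearch n ε (3 * bits n + 1)

theorem prob_triangleSearch_ge (hε0 : 0 < ε) (hε1 : ε < 1) :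
    1 - (logSize n)⁻¹ ≤
      ((triangleSearch n ε).exp G).prob (fun x => IsApproximation ε x (triangleCount G)) := by
  have hL := one_le_logSize n
  have h := prob_guessSearch_le G hε0 hε1 (3 * bits n + 1)
  rw [Expectation.prob_not] at h
  have hb : ((3 * bits n + 1 : ℕ) : ℝ) ≤ 3 * logSize n := by
    unfold logSize; push_cast; linarith
  have h1 : ((3 * bits n + 1 : ℕ) : ℝ) * (1 / (16 * logSize n ^ 2)) ≤ (logSize n)⁻¹ := by
    calc _ ≤ 3 * logSize n * (1 / (16 * logSize n ^ 2)) := by gcongr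
      _ = 3 / 16 * (logSize n)⁻¹ := by field_simp
      _ ≤ _ := by linarith [inv_nonneg.2 (zero_le_one.trans hL)]
  unfold triangleSearch
  linarith

theorem cost_triangleSearch_le (hε0 : 0 < ε) (hε1 : ε < 1) (hT : 1 ≤ triangleCount G) :
    (triangleSearch n ε).cost G ≤
      435 * logSize n * trialFactor n ε * queryRate (edgeCount G) (triangleCount G) := by
  have hL := one_le_logSize n
  have hΛ := one_le_listFactor n
  have hT1 : (1 : ℝ) ≤ triangleCount G := by exact_mod_cast hT
  have hrate := one_le_queryRate (Nat.cast_nonneg _) hT1 (triangleCount_sq_le G)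
  have hΓ0 : 0 ≤ trialFactor n ε := by unfold trialFactor; positivity
  have hx : ((triangleCount G : ℝ) / 2 ^ (3 * bits n + 1)) ^ 2 ≤ 1 := by
    refine pow_le_one₀ (by positivity) ?_
    rw [div_le_one (by positivity)]
    exact (triangleCount_le_two_pow G).trans (pow_le_pow_right₀ one_le_two (Nat.le_succ _))
  refine (cost_guessSearch_le G hε0 hε1 hT _).trans ?_
  have hb : (bits n : ℝ) = logSize n - 1 := by unfold logSize; ring
  push_cast
  rw [hb]
  calc _ ≤ trialFactor n ε * queryRate (edgeCount G) (triangleCount G) * (435 * logSize n) := by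
        refine mul_le_mul_of_nonneg_left ?_ (by positivity)
        linarith
    _ = _ := by ring

/-! ### Explicit polylogarithmic factors and the logarithm. -/

theorem trialFactor_le (n : ℕ) (hε0 : 0 < ε) (hε1 : ε < 1) :
    trialFactor n ε ≤ 1768 * 2561 * 8 * 768 ^ 3 * logSize n ^ 17 / ε ^ 2 := by
  have hL := one_le_logSize n
  have hc := one_le_edgeThreshold n
  have hε2 : ε ^ 2 ≤ 1 := pow_le_one₀ hε0.le hε1.le
  have hk : (repetitions n ε : ℝ) ≤ 2561 * logSize n ^ 4 * edgeThreshold n / ε ^ 2 := by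
    have h1 := (Nat.ceil_lt_add_one
      (show 0 ≤ 2560 * logSize n ^ 4 * edgeThreshold n / ε ^ 2 by positivity)).le
    have h2 : 1 ≤ logSize n ^ 4 * edgeThreshold n / ε ^ 2 := by
      rw [le_div_iff₀ (by positivity)]
      exact (by linarith : 1 * ε ^ 2 ≤ 1).trans
        (one_le_mul_of_one_le_of_one_le (one_le_pow₀ hL) hc)
    calc _ ≤ _ := h1
      _ ≤ 2560 * logSize n ^ 4 * edgeThreshold n / ε ^ 2 +
          logSize n ^ 4 * edgeThreshold n / ε ^ 2 := by gcongr
      _ = _ := by ring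
  unfold trialFactor
  -- The exponent is `17 = (4 + 3) + 2 + 2 + 6`, from the repetitions, the explicit power, the
  -- listing factor and the squared threshold. The number of guesses later adds one.
  calc _ ≤ 1768 * (2561 * logSize n ^ 4 * edgeThreshold n / ε ^ 2) * logSize n ^ 2 * listFactor n *
        edgeThreshold n ^ 2 := by
        have := one_le_listFactor n
        gcongr
    _ = _ := by unfold listFactor edgeThreshold; ring

theorem log_le_logSize (n : ℕ) : Real.log n ≤ logSize n := by
  rcases Nat.eq_zero_or_pos n with rfl | hn
  · have := one_le_logSize 0
    simp; linarith
  have h : (n : ℝ) ≤ 2 ^ bits n := by exact_mod_cast le_two_pow_bits n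
  have h1 := Real.log_le_log (by exact_mod_cast hn) h
  rw [Real.log_pow] at h1
  have h2 : (bits n : ℝ) * Real.log 2 ≤ bits n * 1 := by
    gcongr; linarith [Real.log_two_lt_d9]
  unfold logSize; linarith

/-- Since `2^{bits n - 1} < n`, the bit count is at most `1 + log n / log 2`, and `log n ≥ log 2`
absorbs the constants. The bound on `n` holds as soon as there is a triangle. -/
theorem logSize_le_log (hn : 2 ≤ n) : logSize n ≤ 5 * Real.log n := by
  have h : 2 ^ (bits n).pred < n := Nat.pow_pred_clog_lt_self (by norm_num) hn
  have h1 : (2 : ℝ) ^ (bits n).pred ≤ n := by exact_mod_cast h.le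
  have h2 := Real.log_le_log (by positivity) h1
  rw [Real.log_pow] at h2
  have hpos : 0 < bits n := Nat.clog_pos (by norm_num) hn
  have h3 : ((bits n).pred : ℝ) = bits n - 1 := by
    rw [Nat.pred_eq_sub_one]; push_cast [Nat.cast_sub hpos]; ring
  rw [h3] at h2
  have h4 : Real.log 2 ≤ Real.log n := Real.log_le_log (by norm_num) (by exact_mod_cast hn)
  have h5 := Real.log_two_gt_d9
  have h6 : (1 : ℝ) ≤ bits n := by exact_mod_cast hpos
  unfold logSize
  nlinarith

theorem tendsto_inv_logSize : Filter.Tendsto (fun n => (logSize n)⁻¹) Filter.atTop (nhds 0) :=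
  tendsto_inv_atTop_zero.comp (Filter.tendsto_atTop_mono log_le_logSize
    (Real.tendsto_log_atTop.comp tendsto_natCast_atTop_atTop))

theorem cost_triangleSearch_le_log (hε0 : 0 < ε) (hε1 : ε < 1) (hT : 1 ≤ triangleCount G) :
    (triangleSearch n ε).cost G ≤ 435 * (1768 * 2561 * 8 * 768 ^ 3) * 5 ^ 18 *
      (Real.log n * (1 / ε)) ^ 18 * queryRate (edgeCount G) (triangleCount G) := by
  have hL := one_le_logSize n
  have hT1 : (1 : ℝ) ≤ triangleCount G := by exact_mod_cast hT
  have hrate := one_le_queryRate (Nat.cast_nonneg _) hT1 (triangleCount_sq_le G)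
  have hLlog := logSize_le_log (two_le_of_triangleCount_pos G hT)
  refine (cost_triangleSearch_le G hε0 hε1 hT).trans ?_
  refine mul_le_mul_of_nonneg_right ?_ (by linarith)
  -- Only `ε^{-2}` is needed; the power is raised to share one exponent with the logarithm.
  have h1 : 1 / ε ^ 2 ≤ (1 / ε) ^ 18 := by
    rw [← one_div_pow]
    exact pow_le_pow_right₀ (by rw [le_div_iff₀ hε0]; linarith) (by norm_num)
  calc _ ≤ 435 * logSize n * (1768 * 2561 * 8 * 768 ^ 3 * logSize n ^ 17 / ε ^ 2) := by
        gcongr; exact trialFactor_le n hε0 hε1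
    _ = 435 * (1768 * 2561 * 8 * 768 ^ 3) * (logSize n ^ 18 * (1 / ε ^ 2)) := by ring
    _ ≤ 435 * (1768 * 2561 * 8 * 768 ^ 3) * ((5 * Real.log n) ^ 18 * (1 / ε) ^ 18) := by gcongr
    _ = _ := by rw [mul_pow, mul_pow]; ring

end Search

theorem mainTheorem2 :
    ∃ (triangleEst : (n : ℕ) → ℝ → BISAlgorithm n) (δ : ℕ → ℝ) (C : ℝ) (k : ℕ),
      Filter.Tendsto δ Filter.atTop (nhds 0) ∧
      ∀ (n : ℕ) (ε : ℝ), 0 < ε → ε < 1 →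
        ∀ (G : SimpleGraph (Fin n)) [DecidableRel G.Adj],
          1 - δ n ≤ (triangleEst n ε).outputProb G
              (fun x => IsApproximation ε x (triangleCount G)) ∧
          (0 < triangleCount G →
            (triangleEst n ε).expectedQueries G ≤
              ENNReal.ofReal (C * (Real.log n * (1 / ε)) ^ k *
                min ((edgeCount G : ℝ) / Real.sqrt (triangleCount G))
                  ((edgeCount G : ℝ) ^ (3 / 2 : ℝ) / (triangleCount G : ℝ)))) := by
  refine ⟨fun n ε => (triangleSearch n ε).toAlgorithm, fun n => (logSize n)⁻¹,
    435 * (1768 * 2561 * 8 * 768 ^ 3) * 5 ^ 18, 18, tendsto_inv_logSize,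
    fun n ε hε0 hε1 G _ => ⟨?_, fun hT => ?_⟩⟩
  · rw [RandTree.outputProb_toAlgorithm]
    exact prob_triangleSearch_ge G hε0 hε1
  · rw [RandTree.expectedQueries_toAlgorithm]
    refine ENNReal.ofReal_le_ofReal ?_
    have h : (edgeCount G : ℝ) ^ (3 / 2 : ℝ) = edgeCount G * √(edgeCount G : ℝ) := by
      rw [show (3 / 2 : ℝ) = 1 + 1 / 2 by norm_num,
        Real.rpow_add' (Nat.cast_nonneg _) (by norm_num), Real.rpow_one, Real.sqrt_eq_rpow]
    rw [h]
    exact cost_triangleSearch_le_log G hε0 hε1 hT
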